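/- Let $p_1,\dots,p_k\in\mathbb{R}^3$ ($k\ge 2$) be distinct points, let $m\ge 0$, and put $$\phi(x)=m+\sum_{i=1}^k\frac{1}{2|x-p_i|}.$$ Let $(X,g)$ be the multi-Eguchi–Hanson ($m=0$) or multi-Taub–NUT ($m>0$) $4$-manifold given by the Gibbons–Hawking ansatz: over $\mathbb{R}^3\setminus\{p_1,\dots,p_k\}$, $X$ is a principal circle bundle (with fibres of period $2\pi$) with projection $\pi$ and connection form $\eta$ satisfying $*d\eta=-d\phi$, $g=\phi^{-1}\eta^2+\phi\,\pi^*g_{\mathbb{R}^3}$, and one point is added over each $p_i$, to which the smooth structure, $\pi$ and the metric extend smoothly. Let $\gamma\subset\mathbb{R}^3$ be the straight line segment from $p_1$ to $p_2$, let $2d=|p_1-p_2|$ be its length and $q$ its midpoint. Suppose that $s\ge\max\{4,\sqrt{(k-2)/2}\}$ and that $|p_i-q|>sd$ for all $i>2$. Then $\pi^{-1}(\gamma)$ is a smoothly embedded minimal $2$-sphere in $(X,g)$ and the Gauss curvature $K$ of its induced metric is positive at every point. Moreover, at each point of $\pi^{-1}(\gamma)$ lying over a point of $\gamma$ other than $p_1,p_2$,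 $$K=-\frac{\partial^2}{\partial\mu^2}\left(\frac{1}{2\phi}\right),$$ where $\mu$ is the Euclidean arclength parameter along $\gamma$. -/

import Mathlib

open scoped Manifold ContDiff Topology

set_option maxSynthPendingDepth 3
set_option linter.unusedSectionVars false

namespace GibbonsHawking

noncomputable section

/-- Euclidean three-space. -/
abbrev E3 : Type := EuclideanSpace ℝ (Fin 3)

/-- The complex plane `ℂ²`, regarded as a real vector space of dimension four. -/
abbrev C2 : Type := ℂ × ℂ

/-- The real part of the standard Hermitian form, i.e. the Euclidean inner product of `ℂ²`. -/
def hin : C2 →L[ℝ] C2 →L[ℝ] ℝ :=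
  (innerSL ℝ (E := ℂ)).bilinearComp (ContinuousLinearMap.fst ℝ ℂ ℂ) (ContinuousLinearMap.fst ℝ ℂ ℂ) +
  (innerSL ℝ (E := ℂ)).bilinearComp (ContinuousLinearMap.snd ℝ ℂ ℂ) (ContinuousLinearMap.snd ℝ ℂ ℂ)

lemma hin_apply (u v : C2) : hin u v = inner ℝ u.1 v.1 + inner ℝ u.2 v.2 := rfl

lemma hin_eq (u v : C2) :
    hin u v = u.1.re * v.1.re + u.1.im * v.1.im + (u.2.re * v.2.re + u.2.im * v.2.im) := by
  simp [hin_apply, Complex.inner]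
  ring

/-- The Hopf map `ℂ² → ℝ³`; it satisfies `‖hopf w‖ = |w|² / 2`. -/
def hopf (w : C2) : E3 :=
  !₂[(starRingEnd ℂ w.1 * w.2).re, (starRingEnd ℂ w.1 * w.2).im,
    (Complex.normSq w.1 - Complex.normSq w.2) / 2]

/-- The connection form of the Hopf bundle `ℂ² ∖ {0} → ℝ³ ∖ {0}` at `w`, for the
circle action `w ↦ e^{iθ} w`. -/
def hopfConn (w : C2) : C2 →L[ℝ] ℝ := (hin w w)⁻¹ • hin (Complex.I • w)

/-- One of the two complex coordinates of `ℂ²`. -/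
def cpt (b : Bool) (w : C2) : ℂ := if b then w.1 else w.2

/-- The phase `z / |z|`. -/
def phase (z : ℂ) : ℂ := z / (‖z‖ : ℂ)

/-- The section of the Hopf map on which the coordinate `cpt b` is real and nonnegative. It is
smooth away from the closed ray on which this coordinate vanishes. -/
def sec (b : Bool) (v : E3) : C2 :=
  if b then
    ((√(‖v‖ + v 2) : ℂ), if ‖v‖ + v 2 = 0 then (√(2 * ‖v‖) : ℂ)
      else (⟨v 0, v 1⟩ : ℂ) / (√(‖v‖ + v 2) : ℂ))
  else
    (if ‖v‖ - v 2 = 0 then (√(2 * ‖v‖) : ℂ)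
      else (⟨v 0, -v 1⟩ : ℂ) / (√(‖v‖ - v 2) : ℂ), (√(‖v‖ - v 2) : ℂ))

lemma norm_sq_E3 (v : E3) : ‖v‖ ^ 2 = v 0 ^ 2 + v 1 ^ 2 + v 2 ^ 2 := by
  rw [EuclideanSpace.real_norm_sq_eq, Fin.sum_univ_three]

lemma norm_hopf (w : C2) : ‖hopf w‖ = hin w w / 2 := by
  have h : 0 ≤ hin w w := by
    rw [hin_apply, real_inner_self_eq_norm_sq, real_inner_self_eq_norm_sq]; positivity
  rw [← sq_eq_sq₀ (norm_nonneg _) (by linarith), norm_sq_E3, hin_eq]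
  simp [hopf, Complex.normSq_apply]
  ring

lemma abs_coord_le (v : E3) : |v 2| ≤ ‖v‖ := by
  refine abs_le_of_sq_le_sq ?_ (norm_nonneg _)
  nlinarith [norm_sq_E3 v, sq_nonneg (v 0), sq_nonneg (v 1)]

lemma hopf_sec (b : Bool) (v : E3) : hopf (sec b v) = v := by
  have h1 := norm_sq_E3 v
  have h2 := abs_le.1 (abs_coord_le v)
  have h3 := norm_nonneg v
  have key : ∀ s : ℝ, 0 ≤ s → (√s : ℝ) * √s = s := fun s hs => Real.mul_self_sqrt hs
  cases b
  · by_cases h0 : ‖v‖ - v 2 = 0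
    · have h01 : v 0 = 0 := by nlinarith [sq_nonneg (v 0), sq_nonneg (v 1)]
      have h02 : v 1 = 0 := by nlinarith [sq_nonneg (v 0), sq_nonneg (v 1)]
      have hk : √2 * √‖v‖ * (√2 * √‖v‖) = 2 * ‖v‖ := by
        rw [← Real.sqrt_mul (by norm_num)]; exact key _ (by positivity)
      ext i
      fin_cases i
      · simp [hopf, sec, h0, h01]
      · simp [hopf, sec, h0, h02]
      · simp only [hopf, sec, h0, Complex.normSq_apply]
        simp
        linarith
    · have hpos : 0 < ‖v‖ - v 2 := lt_of_le_of_ne (by linarith) (Ne.symm h0)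
      have hs := key (‖v‖ - v 2) hpos.le
      have hs0 : (√(‖v‖ - v 2) : ℝ) ≠ 0 := (Real.sqrt_pos.2 hpos).ne'
      ext i
      fin_cases i
      · simp [hopf, sec, h0, Complex.div_ofReal_re, hs0]
      · simp [hopf, sec, h0, Complex.div_ofReal_im, hs0]
      · simp only [hopf, sec, h0, Complex.normSq_apply]
        simp [Complex.div_ofReal_re, Complex.div_ofReal_im]
        field_simp
        rw [Real.sq_sqrt hpos.le]
        nlinarith
  · by_cases h0 : ‖v‖ + v 2 = 0
    · have h01 : v 0 = 0 := by nlinarith [sq_nonneg (v 0), sq_nonneg (v 1)]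
      have h02 : v 1 = 0 := by nlinarith [sq_nonneg (v 0), sq_nonneg (v 1)]
      have hk : √2 * √‖v‖ * (√2 * √‖v‖) = 2 * ‖v‖ := by
        rw [← Real.sqrt_mul (by norm_num)]; exact key _ (by positivity)
      ext i
      fin_cases i
      · simp [hopf, sec, h0, h01]
      · simp [hopf, sec, h0, h02]
      · simp only [hopf, sec, h0, Complex.normSq_apply]
        simp
        linarith
    · have hpos : 0 < ‖v‖ + v 2 := lt_of_le_of_ne (by linarith) (Ne.symm h0)
      have hs := key (‖v‖ + v 2) hpos.le
      have hs0 : (√(‖v‖ + v 2) : ℝ) ≠ 0 := (Real.sqrt_pos.2 hpos).ne'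
      ext i
      fin_cases i
      · simp [hopf, sec, h0, Complex.div_ofReal_re, hs0]
        field_simp
      · simp [hopf, sec, h0, Complex.div_ofReal_im, hs0]
        field_simp
      · simp only [hopf, sec, h0, Complex.normSq_apply]
        simp [Complex.div_ofReal_re, Complex.div_ofReal_im]
        field_simp
        rw [Real.sq_sqrt hpos.le]
        nlinarith

lemma norm_phase {z : ℂ} (hz : z ≠ 0) : ‖phase z‖ = 1 := by
  simp [phase, norm_ne_zero_iff.2 hz]

lemma hin_smul_smul (c : ℂ) (u v : C2) : hin (c • u) (c • v) = ‖c‖ ^ 2 * hin u v := by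
  rw [hin_eq, hin_eq, ← Complex.normSq_eq_norm_sq, Complex.normSq_apply]
  simp
  ring

lemma hopf_smul (c : ℂ) (hc : ‖c‖ = 1) (w : C2) : hopf (c • w) = hopf w := by
  have h : c.re * c.re + c.im * c.im = 1 := by
    rw [← Complex.normSq_apply, Complex.normSq_eq_norm_sq, hc]; norm_num
  ext i
  fin_cases i
  · simp [hopf]; linear_combination ((w.1.re * w.2.re + w.1.im * w.2.im)) * h
  · simp [hopf]; linear_combination ((w.1.re * w.2.im - w.1.im * w.2.re)) * h
  · simp [hopf, Complex.normSq_apply]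
    linear_combination (w.1.re * w.1.re + w.1.im * w.1.im - w.2.re * w.2.re - w.2.im * w.2.im) * h

lemma cpt_smul (b : Bool) (c : ℂ) (w : C2) : cpt b (c • w) = c * cpt b w := by
  cases b <;> simp [cpt]

lemma phase_mul (z w : ℂ) : phase (z * w) = phase z * phase w := by
  simp [phase]; ring

lemma phase_of_norm_one {z : ℂ} (hz : ‖z‖ = 1) : phase z = z := by simp [phase, hz]

lemma conj_mul_self_of_norm_one {z : ℂ} (hz : ‖z‖ = 1) : starRingEnd ℂ z * z = 1 := by
  rw [mul_comm, Complex.mul_conj, Complex.normSq_eq_norm_sq, hz]; norm_num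

/-- The section recovers a spinor up to the phase of the chosen coordinate. -/
lemma sec_hopf (b : Bool) (w : C2) (h : cpt b w ≠ 0) :
    sec b (hopf w) = starRingEnd ℂ (phase (cpt b w)) • w := by
  obtain ⟨z, y⟩ := w
  have hn := norm_hopf (z, y)
  have hnn : hin (z, y) (z, y) = ‖z‖ ^ 2 + ‖y‖ ^ 2 := by
    simp [hin_apply]
  have h2 : hopf (z, y) 2 = (‖z‖ ^ 2 - ‖y‖ ^ 2) / 2 := by
    simp [hopf, Complex.normSq_eq_norm_sq]
  have h01 : (⟨hopf (z, y) 0, hopf (z, y) 1⟩ : ℂ) = starRingEnd ℂ z * y := by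
    apply Complex.ext <;> simp [hopf]
  have h01' : (⟨hopf (z, y) 0, -hopf (z, y) 1⟩ : ℂ) = z * starRingEnd ℂ y := by
    apply Complex.ext <;> simp [hopf] <;> ring
  cases b
  · have hy : y ≠ 0 := by simpa [cpt] using h
    have hy' : ‖y‖ ≠ 0 := norm_ne_zero_iff.2 hy
    have e : ‖hopf (z, y)‖ - hopf (z, y) 2 = ‖y‖ ^ 2 := by rw [hn, hnn, h2]; ring
    have hc : (‖y‖ : ℂ) ≠ 0 := by exact_mod_cast hy'
    have hyy : starRingEnd ℂ y * y = (‖y‖ : ℂ) ^ 2 := by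
      rw [mul_comm, Complex.mul_conj, Complex.normSq_eq_norm_sq]; norm_cast
    simp only [sec, e, h01', Real.sqrt_sq (norm_nonneg y), cpt, phase]
    simp only [Bool.false_eq_true, if_false, ne_eq, pow_eq_zero_iff, hy',
      OfNat.ofNat_ne_zero, not_false_eq_true]
    refine Prod.ext ?_ ?_
    · simp; ring
    · simp; field_simp; linear_combination (-1 : ℂ) * hyy
  · have hy : z ≠ 0 := by simpa [cpt] using h
    have hy' : ‖z‖ ≠ 0 := norm_ne_zero_iff.2 hy
    have e : ‖hopf (z, y)‖ + hopf (z, y) 2 = ‖z‖ ^ 2 := by rw [hn, hnn, h2]; ring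
    have hc : (‖z‖ : ℂ) ≠ 0 := by exact_mod_cast hy'
    have hyy : starRingEnd ℂ z * z = (‖z‖ : ℂ) ^ 2 := by
      rw [mul_comm, Complex.mul_conj, Complex.normSq_eq_norm_sq]; norm_cast
    simp only [sec, e, h01, Real.sqrt_sq (norm_nonneg z), cpt, phase]
    simp only [if_true, ne_eq, pow_eq_zero_iff, hy',
      OfNat.ofNat_ne_zero, not_false_eq_true, if_false]
    refine Prod.ext ?_ ?_
    · simp; field_simp; linear_combination (-1 : ℂ) * hyy
    · simp; ring


lemma contDiff_hin : ContDiff ℝ ∞ (fun w : C2 => hin w w) :=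
  (hin.contDiff).clm_apply contDiff_id

lemma contDiff_hopf : ContDiff ℝ ∞ hopf := by
  rw [contDiff_euclidean]
  have h1 : ContDiff ℝ ∞ (fun w : C2 => starRingEnd ℂ w.1 * w.2) :=
    (Complex.conjCLE.contDiff.comp contDiff_fst).mul contDiff_snd
  have h2 : ∀ w : C2, (Complex.normSq w.1 - Complex.normSq w.2) / 2
      = (inner ℝ w.1 w.1 - inner ℝ w.2 w.2) / 2 := by
    intro w
    simp [Complex.normSq_eq_norm_sq]
  intro i
  fin_cases i
  · exact Complex.reCLM.contDiff.comp h1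
  · exact Complex.imCLM.contDiff.comp h1
  · simp only [hopf]
    simp only [h2]
    exact ((contDiff_fst.inner ℝ contDiff_fst).sub (contDiff_snd.inner ℝ contDiff_snd)).div_const _

lemma cpt_sec (b : Bool) (v : E3) :
    cpt b (sec b v) = (√(if b then ‖v‖ + v 2 else ‖v‖ - v 2) : ℂ) := by
  cases b <;> simp [cpt, sec]

lemma phase_cpt_sec (b : Bool) (v : E3) (h : cpt b (sec b v) ≠ 0) :
    phase (cpt b (sec b v)) = 1 := by
  rw [cpt_sec] at h ⊢
  have h' : √(if b then ‖v‖ + v 2 else ‖v‖ - v 2) ≠ 0 := by exact_mod_cast h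
  rw [phase, Complex.norm_real, Real.norm_of_nonneg (Real.sqrt_nonneg _), div_self h]

lemma contDiffAt_phase {z : ℂ} (hz : z ≠ 0) : ContDiffAt ℝ ∞ phase z := by
  unfold phase
  have h : ContDiffAt ℝ ∞ (fun z : ℂ => (‖z‖ : ℂ)) z :=
    Complex.ofRealCLM.contDiff.contDiffAt.comp z (contDiffAt_norm ℝ hz)
  have h0 : (‖z‖ : ℂ) ≠ 0 := by simpa using hz
  simp only [div_eq_mul_inv]
  exact contDiffAt_id.mul (h.inv h0)

lemma contDiff_cpt (b : Bool) : ContDiff ℝ ∞ (cpt b) := by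
  cases b
  · exact contDiff_snd
  · exact contDiff_fst

lemma continuous_cpt_sec (b : Bool) : Continuous (fun v => cpt b (sec b v)) := by
  simp only [cpt_sec]
  cases b <;> simp only [Bool.false_eq_true, if_false, if_true] <;> fun_prop

lemma contDiffAt_sec (b : Bool) (v : E3) (h : cpt b (sec b v) ≠ 0) :
    ContDiffAt ℝ ∞ (sec b) v := by
  have hv : v ≠ 0 := by
    rintro rfl
    apply h
    rw [cpt_sec]
    simp
  have hco : ∀ i : Fin 3, ContDiffAt ℝ ∞ (fun v : E3 => v i) v := fun i =>
    (EuclideanSpace.proj (𝕜 := ℝ) i).contDiff.contDiffAt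
  have hnear : ∀ᶠ u in 𝓝 v, cpt b (sec b u) ≠ 0 :=
    (continuous_cpt_sec b).continuousAt.eventually_ne h
  have hofReal : ContDiff ℝ ∞ (fun x : ℝ => (x : ℂ)) := Complex.ofRealCLM.contDiff
  have hmk : ContDiff ℝ ∞ (fun x : ℝ × ℝ => (⟨x.1, x.2⟩ : ℂ)) :=
    Complex.equivRealProdCLM.symm.contDiff
  cases b
  · have hne : ‖v‖ - v 2 ≠ 0 := by
      intro h0
      apply h
      rw [cpt_sec]; simp [h0]
    have hs : ContDiffAt ℝ ∞ (fun u : E3 => ((√(‖u‖ - u 2) : ℝ) : ℂ)) v :=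
      hofReal.contDiffAt.comp v (((contDiffAt_norm ℝ hv).sub (hco 2)).sqrt hne)
    have hn : ContDiffAt ℝ ∞ (fun u : E3 => (⟨u 0, -u 1⟩ : ℂ)) v :=
      hmk.contDiffAt.comp v ((hco 0).prodMk (hco 1).neg)
    have hs0 : ((√(‖v‖ - v 2) : ℝ) : ℂ) ≠ 0 := by simpa [cpt_sec] using h
    refine ((hn.mul (hs.inv hs0)).prodMk hs).congr_of_eventuallyEq ?_
    filter_upwards [hnear] with u hu
    have : ‖u‖ - u 2 ≠ 0 := by
      intro h0
      apply hu
      rw [cpt_sec]; simp [h0]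
    simp [sec, this, div_eq_mul_inv]
  · have hne : ‖v‖ + v 2 ≠ 0 := by
      intro h0
      apply h
      rw [cpt_sec]; simp [h0]
    have hs : ContDiffAt ℝ ∞ (fun u : E3 => ((√(‖u‖ + u 2) : ℝ) : ℂ)) v :=
      hofReal.contDiffAt.comp v (((contDiffAt_norm ℝ hv).add (hco 2)).sqrt hne)
    have hn : ContDiffAt ℝ ∞ (fun u : E3 => (⟨u 0, u 1⟩ : ℂ)) v :=
      hmk.contDiffAt.comp v ((hco 0).prodMk (hco 1))
    have hs0 : ((√(‖v‖ + v 2) : ℝ) : ℂ) ≠ 0 := by simpa [cpt_sec] using h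
    refine (hs.prodMk (hn.mul (hs.inv hs0))).congr_of_eventuallyEq ?_
    filter_upwards [hnear] with u hu
    have : ‖u‖ + u 2 ≠ 0 := by
      intro h0
      apply hu
      rw [cpt_sec]; simp [h0]
    simp [sec, this, div_eq_mul_inv]

lemma hopf_eq_zero {w : C2} (h : hopf w = 0) : w = 0 := by
  have := norm_hopf w
  rw [h, norm_zero] at this
  simp only [hin_apply, real_inner_self_eq_norm_sq] at this
  have h1 : ‖w.1‖ ^ 2 = 0 := by nlinarith [sq_nonneg ‖w.1‖, sq_nonneg ‖w.2‖]
  have h2 : ‖w.2‖ ^ 2 = 0 := by nlinarith [sq_nonneg ‖w.1‖, sq_nonneg ‖w.2‖]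
  exact Prod.ext (by simpa using h1) (by simpa using h2)

variable {ι : Type*} [Fintype ι] [DecidableEq ι] [Nonempty ι]

/-- The fibre product over `ℝ³` of the Hopf maps centred at the points `p i`: tuples `w` for which
`p i + hopf (w i)` is the same point of `ℝ³` for all `i`. -/
abbrev Fib (p : ι ↪ E3) : Type _ := {w : ι → C2 // ∀ i j, p i + hopf (w i) = p j + hopf (w j)}

/-- The action of the torus of tuples of phases with product one on the fibre product. -/
def torusSetoid (p : ι ↪ E3) : Setoid (Fib p) where
  r w w' := ∃ l : ι → ℂ, (∀ i, ‖l i‖ = 1) ∧ ∏ i, l i = 1 ∧ ∀ i, w'.1 i = l i • w.1 i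
  iseqv := by
    refine ⟨fun w => ⟨1, by simp, by simp, by simp⟩, ?_, ?_⟩
    · rintro w w' ⟨l, h1, h2, h3⟩
      refine ⟨fun i => starRingEnd ℂ (l i), by simpa using h1, ?_, fun i => ?_⟩
      · rw [← map_prod, h2, map_one]
      · rw [h3, smul_smul, conj_mul_self_of_norm_one (h1 i), one_smul]
    · rintro w w' w'' ⟨l, h1, h2, h3⟩ ⟨m, k1, k2, k3⟩
      refine ⟨fun i => m i * l i, by simp [h1, k1], ?_, fun i => ?_⟩
      · rw [Finset.prod_mul_distrib, h2, k2, one_mul]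
      · rw [k3, h3, smul_smul]

/-- The four-manifold `X` underlying the multi-Eguchi–Hanson and multi-Taub–NUT metrics with
singular points `p i`: the quotient of the fibre product by the torus. Over the complement of the
points `p i` it is the product of the pullbacks of the Hopf circle bundles centred at the `p i`;
over each `p i` there is exactly one point. -/
def Space (p : ι ↪ E3) : Type _ := Quotient (torusSetoid p)

variable (p : ι ↪ E3)

/-- The projection `X → ℝ³`. -/
def proj : Space p → E3 :=
  Quotient.lift (fun w : Fib p => p (Classical.arbitrary ι) + hopf (w.1 (Classical.arbitrary ι)))
    (by
      rintro w w' ⟨l, h1, -, h3⟩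
      rw [h3, hopf_smul _ (h1 _)])

lemma proj_mk (w : Fib p) (i : ι) : proj p (Quotient.mk (torusSetoid p) w) = p i + hopf (w.1 i) :=
  w.2 _ _

/-- Charts of `X` are indexed by a point `p i` and, for each `j`, a choice of a section of the Hopf
map (only those with `j ≠ i` matter). -/
abbrev ChartIndex (ι : Type*) : Type _ := ι × (ι → Bool)

/-- A section of `Fib p → X` parametrized by the component `u = w i`; the components with `j ≠ i`
are given by the chosen sections of the Hopf map. -/
def lift (c : ChartIndex ι) (u : C2) (j : ι) : C2 :=
  if j = c.1 then u else sec (c.2 j) (p c.1 + hopf u - p j)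

lemma lift_self (c : ChartIndex ι) (u : C2) : lift p c u c.1 = u := by simp [lift]

lemma add_hopf_lift (c : ChartIndex ι) (u : C2) (j : ι) :
    p j + hopf (lift p c u j) = p c.1 + hopf u := by
  unfold lift
  split_ifs with h
  · rw [h]
  · rw [hopf_sec]; abel

/-- The parametrization of an open subset of `X` by an open subset of `ℂ²`. -/
def param (c : ChartIndex ι) (u : C2) : Space p :=
  Quotient.mk (torusSetoid p) ⟨lift p c u, fun i j => by rw [add_hopf_lift, add_hopf_lift]⟩

/-- The coordinate map inverse to `param`. -/
def coordFun (c : ChartIndex ι) (w : ι → C2) : C2 :=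
  (∏ j ∈ Finset.univ.erase c.1, phase (cpt (c.2 j) (w j))) • w c.1

/-- The domain of the chart, on the level of the fibre product. -/
def coordDom (c : ChartIndex ι) (w : ι → C2) : Prop := ∀ j, j ≠ c.1 → cpt (c.2 j) (w j) ≠ 0

lemma coordDom_smul {c : ChartIndex ι} {w w' : ι → C2} {l : ι → ℂ} (h1 : ∀ i, ‖l i‖ = 1)
    (h3 : ∀ i, w' i = l i • w i) : coordDom c w' ↔ coordDom c w := by
  have : ∀ i, l i ≠ 0 := fun i => norm_ne_zero_iff.1 (by rw [h1]; norm_num)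
  simp [coordDom, h3, cpt_smul, this]

lemma coordFun_smul {c : ChartIndex ι} {w w' : ι → C2} {l : ι → ℂ} (h1 : ∀ i, ‖l i‖ = 1)
    (h2 : ∏ i, l i = 1) (h3 : ∀ i, w' i = l i • w i) : coordFun c w' = coordFun c w := by
  unfold coordFun
  simp only [h3, cpt_smul, phase_mul, phase_of_norm_one (h1 _)]
  rw [Finset.prod_mul_distrib, smul_smul, mul_right_comm,
    Finset.prod_erase_mul _ _ (Finset.mem_univ _), h2, one_mul]

/-- The phases relating a point of the fibre product to its representative in a chart. -/
def chartPhase (c : ChartIndex ι) (w : ι → C2) (j : ι) : ℂ :=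
  if j = c.1 then ∏ k ∈ Finset.univ.erase c.1, phase (cpt (c.2 k) (w k))
  else starRingEnd ℂ (phase (cpt (c.2 j) (w j)))

lemma norm_chartPhase {c : ChartIndex ι} {w : ι → C2} (h : coordDom c w) (j : ι) :
    ‖chartPhase c w j‖ = 1 := by
  unfold chartPhase
  split_ifs with hj
  · rw [norm_prod]
    exact Finset.prod_eq_one fun k hk => norm_phase (h k (Finset.ne_of_mem_erase hk))
  · simpa using norm_phase (h j hj)

lemma prod_chartPhase {c : ChartIndex ι} {w : ι → C2} (h : coordDom c w) :
    ∏ j, chartPhase c w j = 1 := by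
  rw [← Finset.mul_prod_erase _ _ (Finset.mem_univ c.1)]
  have : ∏ j ∈ Finset.univ.erase c.1, chartPhase c w j
      = ∏ j ∈ Finset.univ.erase c.1, starRingEnd ℂ (phase (cpt (c.2 j) (w j))) :=
    Finset.prod_congr rfl fun j hj => by simp [chartPhase, Finset.ne_of_mem_erase hj]
  rw [this, chartPhase, if_pos rfl, ← map_prod, Complex.mul_conj, Complex.normSq_eq_norm_sq,
    norm_prod]
  rw [Finset.prod_eq_one fun k hk => norm_phase (h k (Finset.ne_of_mem_erase hk))]
  norm_num

lemma lift_coordFun {c : ChartIndex ι} {w : Fib p} (h : coordDom c w.1) (j : ι) :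
    lift p c (coordFun c w.1) j = chartPhase c w.1 j • w.1 j := by
  by_cases hj : j = c.1
  · subst hj
    simp [lift_self, chartPhase, coordFun]
  · have hn := norm_chartPhase h c.1
    have e : coordFun c w.1 = chartPhase c w.1 c.1 • w.1 c.1 := by simp [chartPhase, coordFun]
    rw [lift, if_neg hj, e, hopf_smul _ hn, w.2 c.1 j, add_sub_cancel_left, sec_hopf _ _ (h j hj),
      chartPhase, if_neg hj]

/-- The charts of `X`. -/
def chart (c : ChartIndex ι) : PartialEquiv (Space p) C2 where
  toFun := Quotient.lift (fun w : Fib p => coordFun c w.1) (by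
    rintro w w' ⟨l, h1, h2, h3⟩
    exact (coordFun_smul h1 h2 h3).symm)
  invFun := param p c
  source := {x | Quotient.lift (fun w : Fib p => coordDom c w.1) (by
    rintro w w' ⟨l, h1, h2, h3⟩
    exact propext (coordDom_smul h1 h3).symm) x}
  target := {u | coordDom c (lift p c u)}
  map_source' := by
    intro x
    induction x using Quotient.inductionOn with
    | h w =>
      intro (h : coordDom c w.1) j hj
      change cpt (c.2 j) (lift p c (coordFun c w.1) j) ≠ 0
      rw [lift_coordFun p h, cpt_smul]
      exact mul_ne_zero (norm_ne_zero_iff.1 (by rw [norm_chartPhase h]; norm_num)) (h j hj)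
  map_target' := fun u h => h
  left_inv' := by
    intro x
    induction x using Quotient.inductionOn with
    | h w =>
      intro (h : coordDom c w.1)
      refine Quotient.sound ((torusSetoid p).symm ⟨chartPhase c w.1, norm_chartPhase h, prod_chartPhase h,
        fun i => lift_coordFun p h i⟩)
  right_inv' := by
    intro u h
    change coordFun c (lift p c u) = u
    unfold coordFun
    rw [Finset.prod_eq_one, one_smul, lift_self]
    intro j hj
    have hj' := Finset.ne_of_mem_erase hj
    have := h j hj'
    simp only [lift, if_neg hj'] at this ⊢
    exact phase_cpt_sec _ _ this

lemma exists_chart (x : Space p) : ∃ c : ChartIndex ι, x ∈ (chart p c).source := by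
  induction x using Quotient.inductionOn with
  | h w =>
    have h1 : ∃ i, ∀ j, j ≠ i → w.1 j ≠ 0 := by
      by_cases h : ∃ i, w.1 i = 0
      · obtain ⟨i, hi⟩ := h
        refine ⟨i, fun j hj h0 => hj (p.injective ?_)⟩
        have := w.2 j i
        rw [hi, h0] at this
        simpa using this
      · push Not at h
        exact ⟨Classical.arbitrary ι, fun j _ => h j⟩
    obtain ⟨i, hi⟩ := h1
    have h2 : ∀ j, ∃ b : Bool, j ≠ i → cpt b (w.1 j) ≠ 0 := by
      intro j
      by_cases h : (w.1 j).1 = 0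
      · refine ⟨false, fun hj h' => hi j hj (Prod.ext h (by simpa [cpt] using h'))⟩
      · exact ⟨true, fun _ => by simpa [cpt] using h⟩
    choose σ hσ using h2
    exact ⟨(i, σ), fun j hj => hσ j hj⟩

/-- A chart whose domain contains the given point. -/
def indexAt (x : Space p) : ChartIndex ι := (exists_chart p x).choose

lemma mem_source_indexAt (x : Space p) : x ∈ (chart p (indexAt p x)).source :=
  (exists_chart p x).choose_spec

lemma contDiffAt_lift {c : ChartIndex ι} {u : C2} (h : coordDom c (lift p c u)) (j : ι) :
    ContDiffAt ℝ ∞ (fun u => lift p c u j) u := by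
  by_cases hj : j = c.1
  · simp only [lift, hj, if_true]
    exact contDiffAt_id
  · have := h j hj
    simp only [lift, if_neg hj] at this ⊢
    exact (contDiffAt_sec _ _ this).comp u
      ((contDiffAt_const.add contDiff_hopf.contDiffAt).sub contDiffAt_const)

lemma isOpen_coordDom (c : ChartIndex ι) : IsOpen {u | coordDom c (lift p c u)} := by
  simp only [coordDom, Set.ofPred_forall]
  refine isOpen_iInter_of_finite fun j => ?_
  by_cases hj : j = c.1
  · simp [hj]
  · simp only [ne_eq, hj, not_false_eq_true, lift, if_false, Set.iInter_true]
    exact isOpen_ne_fun ((continuous_cpt_sec _).comp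
      ((continuous_const.add contDiff_hopf.continuous).sub continuous_const)) continuous_const

lemma continuousOn_cpt_lift (c : ChartIndex ι) (b : Bool) (j : ι) :
    ContinuousOn (fun u => cpt b (lift p c u j)) {u | coordDom c (lift p c u)} := fun u hu =>
  ((contDiff_cpt b).continuous.continuousAt.comp
    (contDiffAt_lift p hu j).continuousAt).continuousWithinAt

lemma trans_source (c c' : ChartIndex ι) : ((chart p c).symm.trans (chart p c')).source =
    {u | coordDom c (lift p c u) ∧ coordDom c' (lift p c u)} := by
  ext u
  rw [PartialEquiv.trans_source]
  rfl

lemma isOpen_trans_source (c c' : ChartIndex ι) :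
    IsOpen ((chart p c).symm.trans (chart p c')).source := by
  rw [trans_source, Set.ofPred_and]
  have : {u | coordDom c (lift p c u)} ∩ {u | coordDom c' (lift p c u)} =
      ⋂ j, ({u | coordDom c (lift p c u)} ∩
        (fun u => cpt (c'.2 j) (lift p c u j)) ⁻¹' {z | j ≠ c'.1 → z ≠ 0}) := by
    ext u
    simp [coordDom, forall_and]
  rw [this]
  refine isOpen_iInter_of_finite fun j => ?_
  refine (continuousOn_cpt_lift p c _ j).isOpen_inter_preimage (isOpen_coordDom p c) ?_
  by_cases hj : j = c'.1
  · simp [hj]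
  · simpa [hj] using isOpen_ne

lemma contDiffAt_coordFun_lift {c c' : ChartIndex ι} {u : C2} (h : coordDom c (lift p c u))
    (h' : coordDom c' (lift p c u)) : ContDiffAt ℝ ∞ (fun u => coordFun c' (lift p c u)) u := by
  unfold coordFun
  refine ContDiffAt.smul (𝕜' := ℂ) (contDiffAt_prod fun j hj => ?_) (contDiffAt_lift p h _)
  exact (contDiffAt_phase (h' j (Finset.ne_of_mem_erase hj))).comp u
    ((contDiff_cpt _).contDiffAt.comp u (contDiffAt_lift p h j))

lemma contDiffOn_trans (c c' : ChartIndex ι) :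
    ContDiffOn ℝ ∞ ((chart p c).symm.trans (chart p c'))
      ((chart p c).symm.trans (chart p c')).source := by
  rw [trans_source]
  exact fun u hu => (contDiffAt_coordFun_lift p hu.1 hu.2).contDiffWithinAt

/-- The smooth atlas of `X`. -/
def chartedSpaceCore : ChartedSpaceCore C2 (Space p) where
  atlas := Set.range (chart p)
  chartAt x := chart p (indexAt p x)
  mem_chart_source := mem_source_indexAt p
  chart_mem_atlas x := ⟨_, rfl⟩
  open_source := by
    rintro _ _ ⟨c, rfl⟩ ⟨c', rfl⟩
    exact isOpen_trans_source p c c'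
  continuousOn_toFun := by
    rintro _ _ ⟨c, rfl⟩ ⟨c', rfl⟩
    exact (contDiffOn_trans p c c').continuousOn

/-- The topology in which all charts are homeomorphisms onto open sets. -/
instance : TopologicalSpace (Space p) := (chartedSpaceCore p).toTopologicalSpace

instance : ChartedSpace C2 (Space p) := (chartedSpaceCore p).toChartedSpace

lemma mem_atlas_iff (e : OpenPartialHomeomorph (Space p) C2) :
    e ∈ atlas C2 (Space p) ↔ ∃ c, e = (chartedSpaceCore p).openPartialHomeomorph (chart p c) ⟨c, rfl⟩ := by
  constructor
  · intro he
    obtain ⟨_, ⟨e0, rfl⟩, he⟩ := he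
    obtain ⟨_, ⟨⟨c, rfl⟩, rfl⟩, he⟩ := he
    exact ⟨c, he⟩
  · rintro ⟨c, rfl⟩
    exact Set.mem_iUnion.2 ⟨chart p c, Set.mem_iUnion.2 ⟨⟨c, rfl⟩, rfl⟩⟩

instance : IsManifold 𝓘(ℝ, C2) ∞ (Space p) := by
  refine isManifold_of_contDiffOn _ _ _ ?_
  intro e e' he he'
  obtain ⟨c, rfl⟩ := (mem_atlas_iff p e).1 he
  obtain ⟨c', rfl⟩ := (mem_atlas_iff p e').1 he'
  simp only [modelWithCornersSelf_coe, modelWithCornersSelf_coe_symm, Set.range_id, Set.inter_univ,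
    Set.preimage_id]
  exact contDiffOn_trans p c c'

/-- The Euclidean inner product of `ℝ³`. -/
def innerE3 : E3 →L[ℝ] E3 →L[ℝ] ℝ := innerSL ℝ

lemma innerE3_apply (x y : E3) : innerE3 x y = inner ℝ x y := rfl

/-- The harmonic function `φ = m + ∑ 1 / (2 |x - p i|)` on `ℝ³ ∖ {p i}`. -/
def phi (m : ℝ) (x : E3) : ℝ := m + ∑ i, 1 / (2 * ‖x - p i‖)

/-- The connection form `η` on `X ∖ {fixed points}` in the chart with index `c`: the sum of the
pullbacks of the Hopf connection forms centred at the points `p i`. -/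
def etaForm (c : ChartIndex ι) (u : C2) : C2 →L[ℝ] ℝ :=
  ∑ j, (hopfConn (lift p c u j)).comp (fderiv ℝ (fun u => lift p c u j) u)

open Classical in
/-- The Gibbons–Hawking metric `φ⁻¹ η² + φ |dπ|²` in the chart with index `c`, and its continuous
extension to the points of `X` over the `p i` (which have coordinate `u = 0`), where it is the
Euclidean inner product of `ℂ²`. -/
def coordForm (m : ℝ) (c : ChartIndex ι) (u : C2) : C2 →L[ℝ] C2 →L[ℝ] ℝ :=
  if p c.1 + hopf u ∈ Set.range p then hin
  else (phi p m (p c.1 + hopf u))⁻¹ • (etaForm p c u).smulRight (etaForm p c u) +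
    phi p m (p c.1 + hopf u) •
      innerE3.bilinearComp (fderiv ℝ hopf u) (fderiv ℝ hopf u)

/-! The proof that these forms define a smooth Riemannian metric on `X`. -/

lemma hin_self (u : C2) : hin u u = ‖u.1‖ ^ 2 + ‖u.2‖ ^ 2 := by
  rw [hin_apply, real_inner_self_eq_norm_sq, real_inner_self_eq_norm_sq]

lemma hin_self_nonneg (u : C2) : 0 ≤ hin u u := by rw [hin_self]; positivity

lemma hin_self_pos {u : C2} (h : u ≠ 0) : 0 < hin u u := by
  refine lt_of_le_of_ne (hin_self_nonneg u) fun h0 => h ?_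
  rw [hin_self] at h0
  have h1 : ‖u.1‖ ^ 2 = 0 := by nlinarith [sq_nonneg ‖u.1‖, sq_nonneg ‖u.2‖]
  have h2 : ‖u.2‖ ^ 2 = 0 := by nlinarith [sq_nonneg ‖u.1‖, sq_nonneg ‖u.2‖]
  exact Prod.ext (by simpa using h1) (by simpa using h2)

lemma hin_comm (u v : C2) : hin u v = hin v u := by
  rw [hin_apply, hin_apply, real_inner_comm, real_inner_comm u.2]

/-- The derivative of the Hopf map. -/
def dhopf (u v : C2) : E3 :=
  !₂[(starRingEnd ℂ u.1 * v.2 + starRingEnd ℂ v.1 * u.2).re,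
    (starRingEnd ℂ u.1 * v.2 + starRingEnd ℂ v.1 * u.2).im,
    inner ℝ u.1 v.1 - inner ℝ u.2 v.2]

lemma fderiv_hopf (u v : C2) : fderiv ℝ hopf u v = dhopf u v := by
  have hd : DifferentiableAt ℝ hopf u := (contDiff_hopf.differentiable (by simp)).differentiableAt
  have hl : HasDerivAt (fun t : ℝ => hopf (u + t • v)) (fderiv ℝ hopf u v) 0 := by
    have h1 : HasDerivAt (fun t : ℝ => u + t • v) v 0 := by
      simpa using ((hasDerivAt_id (0 : ℝ)).smul_const v).const_add u
    have h2 : HasFDerivAt hopf (fderiv ℝ hopf u) (u + (0 : ℝ) • v) := by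
      simpa using hd.hasFDerivAt
    exact h2.comp_hasDerivAt 0 h1
  have hr : HasDerivAt (fun t : ℝ => hopf u + t • dhopf u v + t ^ 2 • hopf v) (dhopf u v) 0 := by
    have h1 : HasDerivAt (fun t : ℝ => t • dhopf u v) (dhopf u v) 0 := by
      simpa using (hasDerivAt_id (0 : ℝ)).smul_const (dhopf u v)
    have h2 : HasDerivAt (fun t : ℝ => t ^ 2 • hopf v) 0 0 := by
      simpa using (hasDerivAt_pow 2 (0 : ℝ)).smul_const (hopf v)
    have h3 := (h1.const_add (hopf u)).add h2
    rw [add_zero] at h3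
    exact h3
  have he : (fun t : ℝ => hopf (u + t • v)) =
      fun t : ℝ => hopf u + t • dhopf u v + t ^ 2 • hopf v := by
    funext t
    ext i
    fin_cases i
    · simp [hopf, dhopf]; ring
    · simp [hopf, dhopf]; ring
    · simp [hopf, dhopf, Complex.normSq_apply, Complex.inner]; ring
  rw [he] at hl
  exact hl.unique hr

lemma inner_dhopf (u v w : C2) : inner ℝ (dhopf u v) (dhopf u w) =
    hin u u * hin v w - hin (Complex.I • u) v * hin (Complex.I • u) w := by
  simp [dhopf, PiLp.inner_apply, Fin.sum_univ_three, hin_eq, Complex.inner]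
  ring

/-- The part of `etaForm` that is regular at `u = 0`. -/
def etaReg (c : ChartIndex ι) (u : C2) : C2 →L[ℝ] ℝ :=
  ∑ j ∈ Finset.univ.erase c.1, (hopfConn (lift p c u j)).comp (fderiv ℝ (fun u => lift p c u j) u)

/-- The part of `phi` that is regular at `u = 0`. -/
def phiReg (m : ℝ) (c : ChartIndex ι) (u : C2) : ℝ :=
  m + ∑ j ∈ Finset.univ.erase c.1, 1 / (2 * ‖p c.1 + hopf u - p j‖)

/-- A manifestly smooth expression for `coordForm`. -/
def smoothForm (m : ℝ) (c : ChartIndex ι) (u : C2) : C2 →L[ℝ] C2 →L[ℝ] ℝ :=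
  (1 + phiReg p m c u * hin u u) • hin
    - phiReg p m c u • (hin (Complex.I • u)).smulRight (hin (Complex.I • u))
    + (1 + hin u u * phiReg p m c u)⁻¹ •
      ((hin (Complex.I • u)).smulRight (etaReg p c u) + (etaReg p c u).smulRight (hin (Complex.I • u))
        + hin u u • (etaReg p c u).smulRight (etaReg p c u)
        - phiReg p m c u • (hin (Complex.I • u)).smulRight (hin (Complex.I • u)))

lemma phiReg_nonneg {m : ℝ} (hm : 0 ≤ m) (c : ChartIndex ι) (u : C2) : 0 ≤ phiReg p m c u :=
  add_nonneg hm (Finset.sum_nonneg fun _ _ => by positivity)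

lemma etaForm_eq (c : ChartIndex ι) (u : C2) :
    etaForm p c u = (hin u u)⁻¹ • hin (Complex.I • u) + etaReg p c u := by
  rw [etaForm, ← Finset.add_sum_erase _ _ (Finset.mem_univ c.1)]
  congr 1
  have : (fun u => lift p c u c.1) = id := funext fun u => lift_self p c u
  rw [this, fderiv_id, lift_self, hopfConn]
  rfl

lemma phi_eq (m : ℝ) (c : ChartIndex ι) {u : C2} (hu : u ≠ 0) :
    phi p m (p c.1 + hopf u) = (hin u u)⁻¹ + phiReg p m c u := by
  have := (hin_self_pos hu).ne'
  rw [phi, phiReg, ← Finset.add_sum_erase _ _ (Finset.mem_univ c.1), add_sub_cancel_left, norm_hopf]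
  field_simp
  ring

lemma not_mem_range {c : ChartIndex ι} {u : C2} (h : coordDom c (lift p c u)) :
    p c.1 + hopf u ∈ Set.range p ↔ u = 0 := by
  constructor
  · rintro ⟨j, hj⟩
    by_cases hjc : j = c.1
    · rw [hjc] at hj
      exact hopf_eq_zero (by simpa using hj)
    · refine absurd ?_ (h j hjc)
      rw [lift, if_neg hjc, ← hj, sub_self, cpt_sec]
      simp
  · rintro rfl
    exact ⟨c.1, by ext i; fin_cases i <;> simp [hopf]⟩

lemma coordForm_eq {m : ℝ} (hm : 0 ≤ m) {c : ChartIndex ι} {u : C2}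
    (h : coordDom c (lift p c u)) : coordForm p m c u = smoothForm p m c u := by
  by_cases hu : u = 0
  · rw [coordForm, if_pos ((not_mem_range p h).2 hu), hu]
    ext v w <;> simp [smoothForm]
  · rw [coordForm, if_neg (fun h' => hu ((not_mem_range p h).1 h'))]
    have h1 := hin_self_pos hu
    have h2 := phiReg_nonneg p hm c u
    refine ContinuousLinearMap.ext fun v => ContinuousLinearMap.ext fun w => ?_
    simp only [add_apply, smul_apply,
      ContinuousLinearMap.smulRight_apply, ContinuousLinearMap.bilinearComp_apply, innerE3_apply,
      fderiv_hopf, inner_dhopf, smoothForm, etaForm_eq, phi_eq p m c hu, smul_eq_mul,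
      sub_apply]
    have h3 : (hin u u)⁻¹ + phiReg p m c u ≠ 0 := by positivity
    have h4 : 1 + hin u u * phiReg p m c u ≠ 0 := by positivity
    have h5 : ((hin u u)⁻¹ + phiReg p m c u)⁻¹ = hin u u * (1 + hin u u * phiReg p m c u)⁻¹ := by
      field_simp
    rw [h5]
    generalize hin u u = N at *
    field_simp
    ring

lemma coordForm_symm (m : ℝ) (c : ChartIndex ι) (u v w : C2) :
    coordForm p m c u v w = coordForm p m c u w v := by
  unfold coordForm
  split_ifs
  · exact hin_comm v w
  · simp [innerE3_apply, real_inner_comm, mul_comm]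

lemma etaReg_apply_eq_zero {c : ChartIndex ι} {u v : C2} (h : coordDom c (lift p c u))
    (hv : fderiv ℝ hopf u v = 0) : etaReg p c u v = 0 := by
  simp only [etaReg, sum_apply, ContinuousLinearMap.comp_apply]
  refine Finset.sum_eq_zero fun j hj => ?_
  have hj' := Finset.ne_of_mem_erase hj
  have h1 : (fun u => lift p c u j) = sec (c.2 j) ∘ fun u => p c.1 + hopf u - p j := by
    funext u; simp [lift, hj']
  have h2 := h j hj'
  rw [lift, if_neg hj'] at h2
  have h3 : HasFDerivAt (fun u => p c.1 + hopf u - p j) (fderiv ℝ hopf u) u :=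
    (((contDiff_hopf.differentiable (by simp)).differentiableAt).hasFDerivAt.const_add _).sub_const _
  have h4 := ((contDiffAt_sec _ _ h2).differentiableAt (by simp)).hasFDerivAt.comp u h3
  rw [h1, h4.fderiv, ContinuousLinearMap.comp_apply, hv, map_zero, map_zero]

lemma phi_pos {m : ℝ} (hm : 0 ≤ m) {x : E3} (hx : x ∉ Set.range p) : 0 < phi p m x := by
  have h : ∀ i, 0 < ‖x - p i‖ := fun i =>
    norm_pos_iff.2 (sub_ne_zero.2 fun h => hx ⟨i, h.symm⟩)
  exact add_pos_of_nonneg_of_pos hm (Finset.sum_pos (fun i _ => by have := h i; positivity)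
    Finset.univ_nonempty)

lemma coordForm_pos {m : ℝ} (hm : 0 ≤ m) {c : ChartIndex ι} {u v : C2}
    (h : coordDom c (lift p c u)) (hv : v ≠ 0) : 0 < coordForm p m c u v v := by
  unfold coordForm
  split_ifs with hu
  · exact hin_self_pos hv
  · have hphi := phi_pos p hm hu
    have hu0 : u ≠ 0 := fun h0 => hu ((not_mem_range p h).2 h0)
    simp only [add_apply, smul_apply,
      ContinuousLinearMap.smulRight_apply, ContinuousLinearMap.bilinearComp_apply,
      innerE3_apply, smul_eq_mul]
    by_cases hd : fderiv ℝ hopf u v = 0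
    · have h1 := etaReg_apply_eq_zero p h hd
      have h2 : inner ℝ (fderiv ℝ hopf u v) (fderiv ℝ hopf u v) = (0 : ℝ) := by simp [hd]
      rw [fderiv_hopf, inner_dhopf] at h2
      have h3 : etaForm p c u v ≠ 0 := by
        rw [etaForm_eq]
        simp only [add_apply, h1, smul_apply, smul_eq_mul,
          add_zero]
        have h4 := hin_self_pos hu0
        have h5 := hin_self_pos hv
        intro h6
        rcases mul_eq_zero.1 h6 with h7 | h7
        · exact (inv_ne_zero h4.ne') h7
        · rw [h7] at h2
          have := mul_pos h4 h5
          linarith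
      rw [hd]
      have := mul_self_pos.2 h3
      simp only [inner_zero_left, mul_zero, add_zero]
      positivity
    · have h1 : 0 < inner ℝ (fderiv ℝ hopf u v) (fderiv ℝ hopf u v) := real_inner_self_pos.2 hd
      have := mul_self_nonneg (etaForm p c u v)
      positivity

lemma contDiffAt_smoothForm {m : ℝ} (hm : 0 ≤ m) {c : ChartIndex ι} {u : C2}
    (h : coordDom c (lift p c u)) : ContDiffAt ℝ ∞ (smoothForm p m c) u := by
  have hI : ContDiffAt ℝ ∞ (fun u : C2 => hin (Complex.I • u)) u :=
    hin.contDiff.contDiffAt.comp u (contDiffAt_id.const_smul Complex.I)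
  have hN : ContDiffAt ℝ ∞ (fun u : C2 => hin u u) u := contDiff_hin.contDiffAt
  have hne : ∀ j ∈ Finset.univ.erase c.1, lift p c u j ≠ 0 := by
    intro j hj h0
    exact h j (Finset.ne_of_mem_erase hj) (by rw [h0]; cases c.2 j <;> simp [cpt])
  have hphi : ContDiffAt ℝ ∞ (phiReg p m c) u := by
    refine contDiffAt_const.add (ContDiffAt.sum fun j hj => ?_)
    have h1 : ContDiffAt ℝ ∞ (fun u => p c.1 + hopf u - p j) u :=
      (contDiffAt_const.add contDiff_hopf.contDiffAt).sub contDiffAt_const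
    have h2 : p c.1 + hopf u - p j ≠ 0 := by
      intro h0
      apply hne j hj
      apply hopf_eq_zero
      have := add_hopf_lift p c u j
      rw [sub_eq_zero.1 h0] at this
      simpa using this
    exact contDiffAt_const.div (contDiffAt_const.mul (h1.norm ℝ h2)) (by simpa using h2)
  have heta : ContDiffAt ℝ ∞ (etaReg p c) u := by
    unfold etaReg
    refine ContDiffAt.sum fun j hj => ?_
    have h1 := contDiffAt_lift p h j
    have h2 : ContDiffAt ℝ ∞ (fun u => hopfConn (lift p c u j)) u := by
      have h3 : ContDiffAt ℝ ∞ hopfConn (lift p c u j) := by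
        unfold hopfConn
        refine ContDiffAt.smul (contDiff_hin.contDiffAt.inv (hin_self_pos (hne j hj)).ne') ?_
        exact hin.contDiff.contDiffAt.comp _ (contDiffAt_id.const_smul Complex.I)
      exact h3.comp u h1
    exact h2.clm_comp (h1.fderiv_right (m := ∞) (by simp))
  have hne1 : 1 + hin u u * phiReg p m c u ≠ 0 := by
    have := phiReg_nonneg p hm c u
    have := hin_self_nonneg u
    positivity
  unfold smoothForm
  refine ContDiffAt.add (ContDiffAt.sub ?_ ?_) ?_
  · exact (contDiffAt_const.add (hphi.mul hN)).smul contDiffAt_const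
  · exact hphi.smul (hI.smulRight hI)
  · refine ContDiffAt.smul ((contDiffAt_const.add (hN.mul hphi)).inv hne1) ?_
    exact (((hI.smulRight heta).add (heta.smulRight hI)).add (hN.smul (heta.smulRight heta))).sub
      (hphi.smul (hI.smulRight hI))

lemma contDiffAt_chartPhase {c c' : ChartIndex ι} {u : C2} (h : coordDom c (lift p c u))
    (h' : coordDom c' (lift p c u)) (j : ι) :
    ContDiffAt ℝ ∞ (fun u => chartPhase c' (lift p c u) j) u := by
  have key : ∀ k, k ≠ c'.1 → ContDiffAt ℝ ∞ (fun u => phase (cpt (c'.2 k) (lift p c u k))) u :=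
    fun k hk => (contDiffAt_phase (h' k hk)).comp (f := fun u => cpt (c'.2 k) (lift p c u k)) u
      ((contDiff_cpt _).contDiffAt.comp u (contDiffAt_lift p h k))
  unfold chartPhase
  by_cases hj : j = c'.1
  · simp only [hj, if_true]
    exact contDiffAt_prod fun k hk => key k (Finset.ne_of_mem_erase hk)
  · simp only [hj, if_false]
    exact Complex.conjCLE.contDiff.contDiffAt.comp u (key j hj)

lemma sum_im_conj_mul_fderiv {f : ι → C2 → ℂ} {u : C2} (hd : ∀ j, DifferentiableAt ℝ (f j) u)
    (hn : ∀ j, ‖f j u‖ = 1) (hp : ∀ᶠ x in 𝓝 u, ∏ j, f j x = 1) (v : C2) :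
    ∑ j, (starRingEnd ℂ (f j u) * fderiv ℝ (f j) u v).im = 0 := by
  have h1 : HasFDerivAt (fun x => ∏ j, f j x) (0 : C2 →L[ℝ] ℂ) u :=
    (hasFDerivAt_const (1 : ℂ) u).congr_of_eventuallyEq hp
  have h2 := HasFDerivAt.finsetProd (u := Finset.univ) (g := f)
    (fun j _ => (hd j).hasFDerivAt)
  have h3 := congrArg (fun L : C2 →L[ℝ] ℂ => L v) (h1.unique h2)
  simp only [zero_apply, sum_apply, smul_apply, smul_eq_mul] at h3
  have h4 : ∀ j, ∏ k ∈ Finset.univ.erase j, f k u = starRingEnd ℂ (f j u) := by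
    intro j
    have h5 := Finset.mul_prod_erase Finset.univ (fun k => f k u) (Finset.mem_univ j)
    rw [hp.self_of_nhds] at h5
    have h6 := congrArg (fun z => starRingEnd ℂ (f j u) * z) h5
    simp only [← mul_assoc, conj_mul_self_of_norm_one (hn j), one_mul, mul_one] at h6
    exact h6
  simp only [h4] at h3
  rw [← Complex.im_sum, ← h3, Complex.zero_im]

lemma hin_I_smul (l m : ℂ) (w v : C2) (hl : ‖l‖ = 1) :
    hin (Complex.I • l • w) (l • v + m • w) =
      hin (Complex.I • w) v + (starRingEnd ℂ l * m).im * hin w w := by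
  have h : l.re * l.re + l.im * l.im = 1 := by
    rw [← Complex.normSq_apply, Complex.normSq_eq_norm_sq, hl]; norm_num
  simp only [hin_eq]
  simp
  linear_combination (-w.1.im * v.1.re + w.1.re * v.1.im - w.2.im * v.2.re + w.2.re * v.2.im) * h

lemma hopfConn_smul (l m : ℂ) (w v : C2) (hl : ‖l‖ = 1) (hw : w ≠ 0) :
    hopfConn (l • w) (l • v + m • w) = hopfConn w v + (starRingEnd ℂ l * m).im := by
  have h := (hin_self_pos hw).ne'
  simp only [hopfConn, smul_apply, smul_eq_mul]
  rw [hin_I_smul l m w v hl, hin_smul_smul, hl]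
  field_simp

/-- The transition map between two charts. -/
def trans (c c' : ChartIndex ι) (u : C2) : C2 := coordFun c' (lift p c u)

lemma lift_trans {c c' : ChartIndex ι} {u : C2} (h' : coordDom c' (lift p c u)) (j : ι) :
    lift p c' (trans p c c' u) j = chartPhase c' (lift p c u) j • lift p c u j :=
  lift_coordFun p (w := ⟨lift p c u, fun i j => by rw [add_hopf_lift, add_hopf_lift]⟩) h' j

lemma coordDom_trans {c c' : ChartIndex ι} {u : C2} (h' : coordDom c' (lift p c u)) :
    coordDom c' (lift p c' (trans p c c' u)) :=
  (coordDom_smul (norm_chartPhase h') (lift_trans p h')).2 h'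

lemma add_hopf_trans {c c' : ChartIndex ι} {u : C2} (h' : coordDom c' (lift p c u)) :
    p c'.1 + hopf (trans p c c' u) = p c.1 + hopf u := by
  rw [← add_hopf_lift p c' _ c'.1, lift_trans p h', hopf_smul _ (norm_chartPhase h' _),
    add_hopf_lift]

lemma eventually_dom {c c' : ChartIndex ι} {u : C2} (h : coordDom c (lift p c u))
    (h' : coordDom c' (lift p c u)) :
    ∀ᶠ x in 𝓝 u, coordDom c (lift p c x) ∧ coordDom c' (lift p c x) := by
  have := isOpen_trans_source p c c'
  rw [trans_source] at this
  exact this.mem_nhds ⟨h, h'⟩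

lemma differentiableAt_trans {c c' : ChartIndex ι} {u : C2} (h : coordDom c (lift p c u))
    (h' : coordDom c' (lift p c u)) : DifferentiableAt ℝ (trans p c c') u :=
  (contDiffAt_coordFun_lift p h h').differentiableAt (by simp)

lemma etaForm_trans {c c' : ChartIndex ι} {u : C2} (h : coordDom c (lift p c u))
    (h' : coordDom c' (lift p c u)) (hu : u ≠ 0) (v : C2) :
    etaForm p c' (trans p c c' u) (fderiv ℝ (trans p c c') u v) = etaForm p c u v := by
  have hlift : ∀ j, lift p c u j ≠ 0 := by
    intro j h0
    by_cases hj : j = c.1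
    · rw [hj, lift_self] at h0; exact hu h0
    · exact h j hj (by rw [h0]; cases c.2 j <;> simp [cpt])
  have hd : ∀ j, DifferentiableAt ℝ (fun x => chartPhase c' (lift p c x) j) u :=
    fun j => (contDiffAt_chartPhase p h h' j).differentiableAt (by simp)
  have hl : ∀ j, DifferentiableAt ℝ (fun x => lift p c x j) u :=
    fun j => (contDiffAt_lift p h j).differentiableAt (by simp)
  have hev := eventually_dom p h h'
  have key : ∀ j, fderiv ℝ (fun x => lift p c' x j) (trans p c c' u)
      (fderiv ℝ (trans p c c') u v) =
      chartPhase c' (lift p c u) j • fderiv ℝ (fun x => lift p c x j) u v +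
        fderiv ℝ (fun x => chartPhase c' (lift p c x) j) u v • lift p c u j := by
    intro j
    have h1 : HasFDerivAt ((fun x => lift p c' x j) ∘ trans p c c') _ u :=
      ((contDiffAt_lift p (coordDom_trans p h') j).differentiableAt
        (by simp)).hasFDerivAt.comp u (differentiableAt_trans p h h').hasFDerivAt
    have h2 := (hd j).hasFDerivAt.smul (hl j).hasFDerivAt
    have h3 := h2.congr_of_eventuallyEq (f₁ := (fun x => lift p c' x j) ∘ trans p c c')
      (hev.mono fun x hx => lift_trans p hx.2 j)
    have h4 := congrArg (fun L : C2 →L[ℝ] C2 => L v) (h1.unique h3)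
    simpa using h4
  have hsum := sum_im_conj_mul_fderiv hd (fun j => norm_chartPhase h' j)
    (hev.mono fun x hx => prod_chartPhase hx.2) v
  simp only [etaForm, sum_apply, ContinuousLinearMap.comp_apply, key]
  simp only [lift_trans p h', hopfConn_smul _ _ _ _ (norm_chartPhase h' _) (hlift _)]
  rw [Finset.sum_add_distrib, hsum, add_zero]

lemma fderiv_hopf_trans {c c' : ChartIndex ι} {u : C2} (h : coordDom c (lift p c u))
    (h' : coordDom c' (lift p c u)) (v : C2) :
    fderiv ℝ hopf (trans p c c' u) (fderiv ℝ (trans p c c') u v) = fderiv ℝ hopf u v := by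
  have hd : ∀ x, DifferentiableAt ℝ hopf x := fun x =>
    (contDiff_hopf.differentiable (by simp)).differentiableAt
  have h1 : HasFDerivAt (fun x => p c'.1 + hopf (trans p c c' x)) _ u :=
    ((hd _).hasFDerivAt.comp u (differentiableAt_trans p h h').hasFDerivAt).const_add _
  have h2 : HasFDerivAt (fun x => p c.1 + hopf x) _ u := (hd u).hasFDerivAt.const_add _
  have h3 := h2.congr_of_eventuallyEq (f₁ := fun x => p c'.1 + hopf (trans p c c' x))
    ((eventually_dom p h h').mono fun x hx => add_hopf_trans p hx.2)
  exact congrArg (fun L : C2 →L[ℝ] E3 => L v) (h1.unique h3)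

/-- The local expressions of the metric are compatible with the transition maps. -/
lemma coordForm_trans (m : ℝ) {c c' : ChartIndex ι} {u : C2} (h : coordDom c (lift p c u))
    (h' : coordDom c' (lift p c u)) (v w : C2) :
    coordForm p m c' (trans p c c' u) (fderiv ℝ (trans p c c') u v)
      (fderiv ℝ (trans p c c') u w) = coordForm p m c u v w := by
  unfold coordForm
  rw [add_hopf_trans p h']
  split_ifs with hu
  · have hu0 := (not_mem_range p h).1 hu
    have ht0 := (not_mem_range p (coordDom_trans p h')).1 (by rwa [add_hopf_trans p h'])
    have hc : c'.1 = c.1 := by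
      have := add_hopf_trans p h'
      rw [ht0, hu0] at this
      exact p.injective (by simpa using this)
    have hd : DifferentiableAt ℝ (fun x => chartPhase c' (lift p c x) c'.1) u :=
      (contDiffAt_chartPhase p h h' c'.1).differentiableAt (by simp)
    have h1 := (hd.hasFDerivAt.smul (hasFDerivAt_id (𝕜 := ℝ) u)).congr_of_eventuallyEq
      (f₁ := trans p c c') ((eventually_dom p h h').mono fun x hx => by
        have h2 := lift_trans p hx.2 c'.1
        rw [lift_self] at h2
        rw [h2, hc, lift_self]
        rfl)
    have h3 : ∀ v, fderiv ℝ (trans p c c') u v = chartPhase c' (lift p c u) c'.1 • v := by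
      intro v
      rw [h1.fderiv]
      simp [hu0]
    rw [h3, h3, hin_smul_smul, norm_chartPhase h']
    ring
  · have hu0 : u ≠ 0 := fun h0 => hu ((not_mem_range p h).2 h0)
    simp only [add_apply, smul_apply, ContinuousLinearMap.smulRight_apply,
      ContinuousLinearMap.bilinearComp_apply, etaForm_trans p h h' hu0, fderiv_hopf_trans p h h']

/-- The Gibbons–Hawking metric at a point of `X`. The tangent space at `x` is identified with `ℂ²`
by the preferred chart at `x`. -/
def metricForm (m : ℝ) (x : Space p) :
    TangentSpace 𝓘(ℝ, C2) x →L[ℝ] TangentSpace 𝓘(ℝ, C2) x →L[ℝ] ℝ :=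
  coordForm p m (indexAt p x) (chart p (indexAt p x) x)

lemma dom_of_mem {c : ChartIndex ι} {x : Space p} (h : x ∈ (chart p c).source) :
    coordDom c (lift p c (chart p c x)) := (chart p c).map_source h

lemma dom_of_mem' {c c' : ChartIndex ι} {x : Space p} (h : x ∈ (chart p c).source)
    (h' : x ∈ (chart p c').source) : coordDom c' (lift p c (chart p c x)) := by
  have h1 : (chart p c).symm (chart p c x) ∈ (chart p c').source := by
    rwa [(chart p c).left_inv h]
  exact h1

lemma isBounded_of_pos (B : C2 →L[ℝ] C2 →L[ℝ] ℝ) (hB : ∀ v, v ≠ 0 → 0 < B v v) :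
    Bornology.IsVonNBounded ℝ {v : C2 | B v v < 1} := by
  have hc : IsCompact (Metric.sphere (0 : C2) 1) := isCompact_sphere 0 1
  have hne : (Metric.sphere (0 : C2) 1).Nonempty := (NormedSpace.sphere_nonempty).2 zero_le_one
  have hcont : ContinuousOn (fun v => B v v) (Metric.sphere (0 : C2) 1) := by fun_prop
  obtain ⟨v0, hv0, hmin⟩ := hc.exists_isMinOn hne hcont
  have hv0' : v0 ≠ 0 := by
    rintro rfl
    simp at hv0
  have hpos := hB v0 hv0'
  rw [NormedSpace.isVonNBounded_iff, isBounded_iff_forall_norm_le]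
  refine ⟨√(1 / B v0 v0), fun v (hv : B v v < 1) => ?_⟩
  by_cases h0 : v = 0
  · simp [h0]
  · have hn : 0 < ‖v‖ := norm_pos_iff.2 h0
    have h1 : B v0 v0 ≤ B (‖v‖⁻¹ • v) (‖v‖⁻¹ • v) := hmin (by simp [norm_smul, hn.ne'])
    simp only [map_smul, smul_apply, smul_eq_mul] at h1
    apply Real.le_sqrt_of_sq_le
    rw [le_div_iff₀ hpos]
    have h2 : B v0 v0 * ‖v‖ ^ 2 ≤ B v v := by
      calc B v0 v0 * ‖v‖ ^ 2 ≤ ‖v‖⁻¹ * (‖v‖⁻¹ * B v v) * ‖v‖ ^ 2 := by gcongr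
        _ = B v v := by field_simp
    linarith

lemma metricForm_coord (m : ℝ) (x₀ x : Space p) (hx : x ∈ (chartAt C2 x₀).source) (v w : C2) :
    metricForm p m x ((tangentBundleCore 𝓘(ℝ, C2) (Space p)).coordChange (achart C2 x₀) (achart C2 x) x v)
      ((tangentBundleCore 𝓘(ℝ, C2) (Space p)).coordChange (achart C2 x₀) (achart C2 x) x w) =
    coordForm p m (indexAt p x₀) (chart p (indexAt p x₀) x) v w := by
  have h := dom_of_mem p (c := indexAt p x₀) (x := x) hx
  have h' := dom_of_mem' p (c := indexAt p x₀) (x := x) hx (mem_source_indexAt p x)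
  have e : (tangentBundleCore 𝓘(ℝ, C2) (Space p)).coordChange (achart C2 x₀) (achart C2 x) x =
      fderiv ℝ (trans p (indexAt p x₀) (indexAt p x)) (chart p (indexAt p x₀) x) := by
    rw [tangentBundleCore_coordChange_achart]
    simp only [modelWithCornersSelf_coe, Set.range_id, fderivWithin_univ]
    rfl
  rw [e, ← coordForm_trans p m h h', metricForm]
  congr 2
  have : chart p (indexAt p x) x =
      trans p (indexAt p x₀) (indexAt p x) (chart p (indexAt p x₀) x) := by
    change _ = chart p (indexAt p x) ((chart p (indexAt p x₀)).symm (chart p (indexAt p x₀) x))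
    rw [(chart p (indexAt p x₀)).left_inv hx]
  rw [this]

/-- The Gibbons–Hawking metric on `X` with harmonic function `φ = m + ∑ 1 / (2 |x - p i|)`: the
multi-Eguchi–Hanson metric if `m = 0`, and the multi-Taub–NUT metric if `m > 0`. -/
def metric (m : ℝ) (hm : 0 ≤ m) :
    Bundle.ContMDiffRiemannianMetric 𝓘(ℝ, C2) ∞ C2
      (fun x : Space p => TangentSpace 𝓘(ℝ, C2) x) where
  inner := metricForm p m
  symm x v w := coordForm_symm p m _ _ v w
  pos x v hv := coordForm_pos p hm (dom_of_mem p (mem_source_indexAt p x)) hv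
  isVonNBounded x := isBounded_of_pos _ fun v hv =>
    coordForm_pos p hm (dom_of_mem p (mem_source_indexAt p x)) hv
  contMDiff := by
    intro x₀
    rw [contMDiffAt_hom_bundle]
    refine ⟨contMDiffAt_id, ?_⟩
    have h1 : ContMDiffAt 𝓘(ℝ, C2) 𝓘(ℝ, C2 →L[ℝ] C2 →L[ℝ] ℝ) ∞
        (fun x => smoothForm p m (indexAt p x₀) (chart p (indexAt p x₀) x)) x₀ :=
      (contDiffAt_smoothForm p hm (dom_of_mem p (mem_source_indexAt p x₀))).contMDiffAt.comp x₀
        (contMDiffAt_extChartAt (I := 𝓘(ℝ, C2)) (n := ∞) (x := x₀))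
    refine h1.congr_of_eventuallyEq ?_
    filter_upwards [(chartAt C2 x₀).open_source.mem_nhds (mem_chart_source C2 x₀)] with x hx
    have hx' : x ∈ (chart p (indexAt p x₀)).source := hx
    rw [← coordForm_eq p hm (dom_of_mem p hx')]
    refine ContinuousLinearMap.ext fun v => ContinuousLinearMap.ext fun w => ?_
    rw [← metricForm_coord p m x₀ x hx, inCoordinates_apply_eq₂ hx hx (Set.mem_univ _)]
    have hs := TangentBundle.symmL_trivializationAt_eq_core (I := 𝓘(ℝ, C2)) hx
    have hv : ∀ v : C2, (trivializationAt C2 (TangentSpace 𝓘(ℝ, C2)) x₀).symm x v =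
        (tangentBundleCore 𝓘(ℝ, C2) (Space p)).coordChange (achart C2 x₀) (achart C2 x) x v := by
      intro v
      rw [← hs]
      exact (Bundle.Trivialization.symmL_apply (R := ℝ) (trivializationAt C2 (TangentSpace 𝓘(ℝ, C2)) x₀)
        (b := x) hx v).symm
    rw [hv, hv]
    simp

/-! Surfaces in a Riemannian manifold. -/

section Surfaces

variable {E : Type*} [NormedAddCommGroup E] [NormedSpace ℝ E] {M : Type*} [TopologicalSpace M]
  [ChartedSpace E M]

/-- `F` restricts to a smooth immersion of the open set `U ⊆ ℝ²` into the manifold `M`, with values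
in `S`. If `S` is an embedded surface, this means that `F` is, near each point of `U`, a regular
local parametrization of `S`. -/
structure IsSurfacePatch (S : Set M) (U : Set (ℝ × ℝ)) (F : ℝ × ℝ → M) : Prop where
  isOpen : IsOpen U
  contMDiffOn : ContMDiffOn 𝓘(ℝ, ℝ × ℝ) 𝓘(ℝ, E) ∞ F U
  injective_mfderiv : ∀ u ∈ U, Function.Injective (mfderiv 𝓘(ℝ, ℝ × ℝ) 𝓘(ℝ, E) F u)
  mapsTo : Set.MapsTo F U S

/-- The partial derivative with respect to the first coordinate. -/
def pd1 (f : ℝ × ℝ → ℝ) (u : ℝ × ℝ) : ℝ := fderiv ℝ f u (1, 0)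

/-- The partial derivative with respect to the second coordinate. -/
def pd2 (f : ℝ × ℝ → ℝ) (u : ℝ × ℝ) : ℝ := fderiv ℝ f u (0, 1)

/-- The Gauss curvature of the metric `e du² + 2 f du dv + g dv²`, by the Brioschi formula. -/
def brioschi (e f g : ℝ × ℝ → ℝ) (u : ℝ × ℝ) : ℝ :=
  (Matrix.det !![-(pd2 (pd2 e) u) / 2 + pd2 (pd1 f) u - pd1 (pd1 g) u / 2,
        pd1 e u / 2, pd1 f u - pd2 e u / 2;
      pd2 f u - pd1 g u / 2, e u, f u;
      pd2 g u / 2, f u, g u] -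
    Matrix.det !![0, pd2 e u / 2, pd1 g u / 2;
      pd2 e u / 2, e u, f u;
      pd1 g u / 2, f u, g u]) / (e u * g u - f u ^ 2) ^ 2

variable [IsManifold 𝓘(ℝ, E) ∞ M]
  (g : Bundle.ContMDiffRiemannianMetric 𝓘(ℝ, E) ∞ E (fun x : M => TangentSpace 𝓘(ℝ, E) x))

/-- The metric induced by a map `F : ℝ² → M`. -/
def inducedMetric (F : ℝ × ℝ → M) (a b : ℝ × ℝ) (u : ℝ × ℝ) : ℝ :=
  g.inner (F u) (mfderiv 𝓘(ℝ, ℝ × ℝ) 𝓘(ℝ, E) F u a) (mfderiv 𝓘(ℝ, ℝ × ℝ) 𝓘(ℝ, E) F u b)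

/-- The metric induced by `g` on the surface `S` has Gauss curvature `K` at `x`. The value does not
depend on the chosen parametrization. -/
def HasGaussCurvatureAt (S : Set M) (x : M) (K : ℝ) : Prop :=
  ∃ (U : Set (ℝ × ℝ)) (F : ℝ × ℝ → M) (u : ℝ × ℝ),
    IsSurfacePatch (E := E) S U F ∧ u ∈ U ∧ F u = x ∧
      K = brioschi (inducedMetric g F (1, 0) (1, 0)) (inducedMetric g F (1, 0) (0, 1))
        (inducedMetric g F (0, 1) (0, 1)) u

/-- The metric in the coordinates given by a chart. -/
def coordMetric (e : OpenPartialHomeomorph M E) (a b : E) (y : E) : ℝ :=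
  g.inner (e.symm y) (mfderiv 𝓘(ℝ, E) 𝓘(ℝ, E) e.symm y a) (mfderiv 𝓘(ℝ, E) 𝓘(ℝ, E) e.symm y b)

/-- The Christoffel symbols of the first kind: `g(∇_a b, c)` for the Levi-Civita connection and
vector fields `a`, `b`, `c` that are constant in the coordinates given by a chart. -/
def christoffel (e : OpenPartialHomeomorph M E) (y a b c : E) : ℝ :=
  (fderiv ℝ (coordMetric g e b c) y a + fderiv ℝ (coordMetric g e a c) y b -
    fderiv ℝ (coordMetric g e a b) y c) / 2

/-- `g(∇_{∂a} ∂b F, ν)` for a map `F : ℝ² → M` at `u`, in the coordinates given by a chart; for `ν`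
normal to the image of `F`, this is the second fundamental form in the direction of `ν`. -/
def secondForm (e : OpenPartialHomeomorph M E) (F : ℝ × ℝ → M) (u a b : ℝ × ℝ) (ν : E) : ℝ :=
  coordMetric g e (fderiv ℝ (fun z => fderiv ℝ (e ∘ F) z b) u a) ν (e (F u)) +
    christoffel g e (e (F u)) (fderiv ℝ (e ∘ F) u a) (fderiv ℝ (e ∘ F) u b) ν

/-- The trace `g(H, ν)` of the second fundamental form with respect to the induced metric. -/
def meanCurvature (e : OpenPartialHomeomorph M E) (F : ℝ × ℝ → M) (u : ℝ × ℝ) (ν : E) : ℝ :=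
  (inducedMetric g F (0, 1) (0, 1) u * secondForm g e F u (1, 0) (1, 0) ν
    - 2 * inducedMetric g F (1, 0) (0, 1) u * secondForm g e F u (1, 0) (0, 1) ν
    + inducedMetric g F (1, 0) (1, 0) u * secondForm g e F u (0, 1) (0, 1) ν) /
  (inducedMetric g F (1, 0) (1, 0) u * inducedMetric g F (0, 1) (0, 1) u
    - inducedMetric g F (1, 0) (0, 1) u ^ 2)

/-- The surface `S` is minimal: at each of its points, the mean curvature vanishes in all normal
directions. This does not depend on the chosen parametrization of `S` and chart of `M`. -/
def IsMinimalSurface (S : Set M) : Prop :=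
  ∀ x ∈ S, ∃ (U : Set (ℝ × ℝ)) (F : ℝ × ℝ → M) (u : ℝ × ℝ),
    IsSurfacePatch (E := E) S U F ∧ u ∈ U ∧ F u = x ∧
      ∃ e ∈ IsManifold.maximalAtlas 𝓘(ℝ, E) ∞ M, x ∈ e.source ∧
        ∀ ν : E, (∀ a : ℝ × ℝ, coordMetric g e (fderiv ℝ (e ∘ F) u a) ν (e x) = 0) →
          meanCurvature g e F u ν = 0

end Surfaces

end
end GibbonsHawking

namespace GibbonsHawking

noncomputable section

/-! Spinors, sections and the topology of the total space. -/

/-! Topology. In the chart of `X` centred at `p i` the projection is `p i + hopf u`, and `hopf (z •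
w) = ‖z‖ ^ 2 • hopf w`. So the preimage of the half-open segment from `p i` to `p j` is the unit
disk in the complex line spanned by a spinor `w` over `p j - p i`. The disks around the two ends are
glued by `z ↦ (z / |z|) √(1 - |z|²)` (`param_smul_spinor`). This is also the transition between the
Lambert azimuthal coordinates of the round sphere at opposite poles, which gives the embedding
(`exists_sphere_embedding`).

Minimality. Fibres have length `2π φ^(-1/2)` and horizontal lengths are scaled by `φ^(1/2)`, so the
preimage of a curve has area `2π` times the Euclidean length of the curve, and straight lines are
critical. The code checks the infinitesimal form of this: the trace of the Christoffel symbols over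
the complex line through `u` vanishes in normal directions (`trace_chartGamma_eq_zero`). At the
poles the metric is even in `u`, so its first derivatives vanish (`fderiv_smoothForm_zero`), and the
surface is linear in the chart.

Curvature. In Euclidean arclength `s` and angle `θ` the induced metric is `φ⁻¹ (dθ + α ds)² + φ
ds²`, with determinant one and coefficients that depend on `s` only. The Brioschi formula then
collapses to `K = -(1/φ)'' / 2` (`brioschi_of_eq_fst`, `brioschi_polarSpinor`). At a pole a two-jet
computation gives `K = 4 * phiReg`, where `phiReg` is `φ` without its singular term
(`brioschi_tipSpinor`); this is positive at once.

Positivity between the poles means `φ φ'' > 2 φ'²` (`potential_inequality`). For the potential `A`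
of the two end charges alone, `1/A` is a quadratic polynomial in `s`, and `A A'' - 2 A'² = 2 A³ / d`
exactly. The other charges are at distance more than `(s - 1) d ≥ 3 d`. By Cauchy–Schwarz and a
termwise positive quadratic form, what they take away is bounded by `∑ 1 / (2 r³)`, and the
hypotheses on `s` make this at most `16 / (27 d³)`. -/

lemma hopf_zero : hopf 0 = 0 := by
  ext i; fin_cases i <;> simp [hopf]

lemma hopf_smul_eq (z : ℂ) (w : C2) : hopf (z • w) = (‖z‖ ^ 2) • hopf w := by
  rw [← Complex.normSq_eq_norm_sq, Complex.normSq_apply]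
  ext i
  fin_cases i
  · simp [hopf]; ring
  · simp [hopf]; ring
  · simp [hopf, Complex.normSq_apply]; ring

/-- Both sections are homogeneous of degree one half. Hence along a ray from a singular point the
section only rescales a fixed spinor. -/
lemma sec_smul (b : Bool) {r : ℝ} (hr : 0 < r) (v : E3) :
    sec b ((r ^ 2) • v) = (r : ℂ) • sec b v := by
  have hr0 : (r : ℂ) ≠ 0 := by exact_mod_cast hr.ne'
  have hn : ‖(r ^ 2) • v‖ = r ^ 2 * ‖v‖ := by
    rw [norm_smul, Real.norm_of_nonneg (by positivity)]
  have hs : ∀ a : ℝ, √(r ^ 2 * a) = r * √a := fun a => by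
    rw [Real.sqrt_mul (by positivity), Real.sqrt_sq hr.le]
  have h0 : ∀ a : ℝ, r ^ 2 * a = 0 ↔ a = 0 := fun a => by simp [hr.ne']
  have h1 : ‖(r ^ 2) • v‖ + ((r ^ 2) • v) 2 = r ^ 2 * (‖v‖ + v 2) := by
    rw [hn]; simp; ring
  have h2 : ‖(r ^ 2) • v‖ - ((r ^ 2) • v) 2 = r ^ 2 * (‖v‖ - v 2) := by
    rw [hn]; simp; ring
  have h3 : √(2 * ‖(r ^ 2) • v‖) = r * √(2 * ‖v‖) := by
    rw [hn, ← hs]; congr 1; ring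
  have h4 : ∀ a : ℝ, (⟨((r ^ 2) • v) 0, a * ((r ^ 2) • v) 1⟩ : ℂ) = (r : ℂ) ^ 2 * ⟨v 0, a * v 1⟩ := by
    intro a
    rw [← Complex.ofReal_pow]
    apply Complex.ext
    · rw [Complex.re_ofReal_mul]; simp
    · rw [Complex.im_ofReal_mul]; simp; ring
  have h5 := h4 1
  have h6 := h4 (-1)
  simp only [one_mul, neg_one_mul] at h5 h6
  cases b
  · simp only [sec, h2, h3, hs, h0, h6, Complex.ofReal_mul, Bool.false_eq_true, if_false]
    split_ifs with h
    · rfl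
    · refine Prod.ext ?_ rfl
      simp only [Prod.smul_fst, smul_eq_mul]
      field_simp
  · simp only [sec, h1, h3, hs, h0, h5, Complex.ofReal_mul, if_true]
    split_ifs with h
    · rfl
    · refine Prod.ext rfl ?_
      simp only [Prod.smul_snd, smul_eq_mul]
      field_simp

/-- The quantities `‖v‖ ± v 2` at `v = hopf w` are the squared moduli of the two coordinates of `w`.
As a result, membership in a chart domain depends on the projection to `ℝ³` only. -/
lemma norm_cpt_sec_hopf (b : Bool) (w : C2) : ‖cpt b (sec b (hopf w))‖ = ‖cpt b w‖ := by
  have h : (if b then ‖hopf w‖ + hopf w 2 else ‖hopf w‖ - hopf w 2) = ‖cpt b w‖ ^ 2 := by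
    rw [norm_hopf, hin_self]
    have h2 : hopf w 2 = (‖w.1‖ ^ 2 - ‖w.2‖ ^ 2) / 2 := by
      simp [hopf, Complex.normSq_eq_norm_sq]
    rw [h2]
    cases b
    · simp [cpt]; ring
    · simp [cpt]; ring
  rw [cpt_sec, h, Real.sqrt_sq (norm_nonneg _)]
  simp

lemma cpt_sec_hopf_ne_zero (b : Bool) (w : C2) : cpt b (sec b (hopf w)) ≠ 0 ↔ cpt b w ≠ 0 := by
  rw [← norm_ne_zero_iff, norm_cpt_sec_hopf, norm_ne_zero_iff]

/-- The fibres of the Hopf map are the orbits of the circle action. -/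
lemma exists_smul_of_hopf_eq {u v : C2} (h : hopf u = hopf v) : ∃ l : ℂ, ‖l‖ = 1 ∧ u = l • v := by
  by_cases hv : v = 0
  · subst hv
    rw [hopf_zero] at h
    exact ⟨1, by simp, by rw [hopf_eq_zero h]; simp⟩
  · obtain ⟨b, hb⟩ : ∃ b, cpt b v ≠ 0 := by
      by_contra! h0
      exact hv (Prod.ext (h0 true) (h0 false))
    have hb' : cpt b u ≠ 0 := by
      rw [← cpt_sec_hopf_ne_zero, h, cpt_sec_hopf_ne_zero]; exact hb
    have h1 := sec_hopf b v hb
    have h2 := sec_hopf b u hb'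
    rw [h, h1] at h2
    refine ⟨phase (cpt b u) * starRingEnd ℂ (phase (cpt b v)), ?_, ?_⟩
    · simp [norm_phase hb, norm_phase hb']
    · rw [mul_smul, h2, smul_smul, mul_comm, conj_mul_self_of_norm_one (norm_phase hb'), one_smul]

/-- The preimage of a ray under the Hopf map is a complex line: rescale `w` by `√τ`, then use that
fibres are circle orbits. -/
lemma exists_smul_of_hopf_eq_smul {u w : C2} {τ : ℝ} (hτ : 0 ≤ τ) (h : hopf u = τ • hopf w) :
    ∃ z : ℂ, ‖z‖ ^ 2 = τ ∧ u = z • w := by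
  have h1 : hopf u = hopf ((√τ : ℂ) • w) := by
    rw [h, hopf_smul_eq, Complex.norm_real, Real.norm_of_nonneg (Real.sqrt_nonneg _), Real.sq_sqrt hτ]
  obtain ⟨l, hl, hu⟩ := exists_smul_of_hopf_eq h1
  refine ⟨l * (√τ : ℂ), ?_, by rw [hu, smul_smul]⟩
  rw [norm_mul, hl, one_mul, Complex.norm_real, Real.norm_of_nonneg (Real.sqrt_nonneg _), Real.sq_sqrt hτ]

/-- Equality in `|v 2| ≤ ‖v‖` forces `v 0 = v 1 = 0`, so the bad set is a closed vertical half-axis.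
-/
lemma cpt_sec_eq_zero_iff (b : Bool) (v : E3) :
    cpt b (sec b v) = 0 ↔ v 0 = 0 ∧ v 1 = 0 ∧ (if b then v 2 ≤ 0 else 0 ≤ v 2) := by
  have h1 := norm_sq_E3 v
  have h2 := abs_le.1 (abs_coord_le v)
  have h3 := norm_nonneg v
  rw [cpt_sec, Complex.ofReal_eq_zero]
  cases b
  · simp only [Bool.false_eq_true, if_false]
    rw [Real.sqrt_eq_zero (by linarith)]
    constructor
    · intro h
      refine ⟨by nlinarith [sq_nonneg (v 0), sq_nonneg (v 1)],
        by nlinarith [sq_nonneg (v 0), sq_nonneg (v 1)], by linarith⟩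
    · rintro ⟨h4, h5, h6⟩
      rw [h4, h5] at h1
      nlinarith
  · simp only [if_true]
    rw [Real.sqrt_eq_zero (by linarith)]
    constructor
    · intro h
      refine ⟨by nlinarith [sq_nonneg (v 0), sq_nonneg (v 1)],
        by nlinarith [sq_nonneg (v 0), sq_nonneg (v 1)], by linarith⟩
    · rintro ⟨h4, h5, h6⟩
      rw [h4, h5] at h1
      nlinarith

/-- A convex set that avoids the origin is disjoint from one of the two closed rays on which the
sections of the Hopf map fail to be smooth. -/
lemma exists_section_of_convex {s : Set E3} (hs : Convex ℝ s) (h0 : (0 : E3) ∉ s) :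
    ∃ b, ∀ v ∈ s, cpt b (sec b v) ≠ 0 := by
  by_contra! h
  obtain ⟨u, hu, hu'⟩ := h true
  obtain ⟨v, hv, hv'⟩ := h false
  rw [cpt_sec_eq_zero_iff] at hu' hv'
  simp only [if_true, Bool.false_eq_true, if_false] at hu' hv'
  obtain ⟨hu0, hu1, hu2⟩ := hu'
  obtain ⟨hv0, hv1, hv2⟩ := hv'
  rcases hu2.lt_or_eq with hlt | heq
  · have hpos : 0 < v 2 - u 2 := by linarith
    -- Points on opposite half-axes have the origin on the segment between them; these weights make
    -- the third coordinate zero.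
    have h1 := hs hu hv (a := v 2 / (v 2 - u 2)) (b := -u 2 / (v 2 - u 2)) (by positivity)
      (div_nonneg (by linarith) hpos.le) (by field_simp; ring)
    refine h0 (by convert h1 using 1; ext i; fin_cases i <;> simp [*]; field_simp; ring)
  · exact h0 (by convert hu using 1; ext i; fin_cases i <;> simp [*])

/-! ### Charts, continuity of the projection and the Hausdorff property. -/

variable {ι : Type*} [Fintype ι] [DecidableEq ι] [Nonempty ι] (p : ι ↪ E3)

/-- The chart with index `c`, as an element of the atlas. -/
def ochart (c : ChartIndex ι) : OpenPartialHomeomorph (Space p) C2 :=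
  (chartedSpaceCore p).openPartialHomeomorph (chart p c) ⟨c, rfl⟩

lemma ochart_mem_maximalAtlas (c : ChartIndex ι) :
    ochart p c ∈ IsManifold.maximalAtlas 𝓘(ℝ, C2) ∞ (Space p) :=
  IsManifold.subset_maximalAtlas ((mem_atlas_iff p _).2 ⟨c, rfl⟩)

lemma ochart_symm_coe (c : ChartIndex ι) : ((ochart p c).symm : C2 → Space p) = param p c := rfl

lemma ochart_source (c : ChartIndex ι) : (ochart p c).source = (chart p c).source := rfl

lemma chart_param {c : ChartIndex ι} {u : C2} (h : coordDom c (lift p c u)) :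
    chart p c (param p c u) = u := (chart p c).right_inv h

lemma param_mem_source {c : ChartIndex ι} {u : C2} (h : coordDom c (lift p c u)) :
    param p c u ∈ (chart p c).source := (chart p c).map_target h

lemma proj_param (c : ChartIndex ι) (u : C2) : proj p (param p c u) = p c.1 + hopf u := by
  rw [param, proj_mk p _ c.1]
  simp only [lift_self]

/-- Chart domains are preimages of subsets of `ℝ³`, so they contain each fibre of `proj` entirely or
not at all. -/
lemma mem_source_iff (c : ChartIndex ι) (x : Space p) : x ∈ (chart p c).source ↔
    ∀ k, k ≠ c.1 → cpt (c.2 k) (sec (c.2 k) (proj p x - p k)) ≠ 0 := by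
  induction x using Quotient.inductionOn with
  | h w =>
    change coordDom c w.1 ↔ _
    refine forall_congr' fun k => imp_congr_right fun _ => ?_
    rw [proj_mk p w k, add_sub_cancel_left, cpt_sec_hopf_ne_zero]

lemma coordDom_lift_iff (c : ChartIndex ι) (u : C2) : coordDom c (lift p c u) ↔
    ∀ k, k ≠ c.1 → cpt (c.2 k) (sec (c.2 k) (p c.1 + hopf u - p k)) ≠ 0 := by
  rw [← proj_param, ← mem_source_iff]
  rfl

lemma continuous_proj : Continuous (proj p) := by
  rw [continuous_iff_continuousAt]
  intro x
  obtain ⟨c, hc⟩ := exists_chart p x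
  have h1 : ContinuousAt (fun y => p c.1 + hopf (ochart p c y)) x :=
    continuousAt_const.add (contDiff_hopf.continuous.continuousAt.comp
      ((ochart p c).continuousAt hc))
  refine h1.congr ?_
  filter_upwards [(ochart p c).open_source.mem_nhds hc] with y hy
  rw [← proj_param, ← ochart_symm_coe, (ochart p c).left_inv hy]

/-- Needed to turn an injective continuous map from the compact sphere into an embedding. Points
with different projections are separated in `ℝ³`; points with the same projection lie in a common
chart, since chart domains are unions of fibres. -/
instance : T2Space (Space p) := by
  refine ⟨fun x y hxy => ?_⟩
  by_cases h : proj p x = proj p y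
  · obtain ⟨c, hx⟩ := exists_chart p x
    have hy : y ∈ (ochart p c).source := by
      rw [ochart_source, mem_source_iff, ← h, ← mem_source_iff]
      exact hx
    have hne : ochart p c x ≠ ochart p c y := fun h' => hxy ((ochart p c).injOn hx hy h')
    obtain ⟨U, V, hU, hV, hxU, hyV, hd⟩ := t2_separation hne
    refine ⟨_, _, (ochart p c).isOpen_inter_preimage hU, (ochart p c).isOpen_inter_preimage hV,
      ⟨hx, hxU⟩, ⟨hy, hyV⟩, ?_⟩
    exact (hd.preimage _).mono Set.inter_subset_right Set.inter_subset_right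
  · exact separated_by_continuous (continuous_proj p) h

/-! ### The complex lines over a segment. -/

/-- The sections chosen by `b` are smooth along the segment from `p i` to `p j`, away from the
points `p i` and `p j`. -/
def SegDom (i j : ι) (b : ι → Bool) : Prop :=
  ∀ τ : ℝ, 0 ≤ τ → τ < 1 → ∀ k, k ≠ i →
    cpt (b k) (sec (b k) (p i + τ • (p j - p i) - p k)) ≠ 0

/-- A translate of the segment that avoids the origin misses one of the two bad half-axes. One `b`
serves both ends: for `k ≠ i, j` the whole closed segment avoids `p k`, while `b i` is constrained
only by the chart at `p j`, and `b j` only by the chart at `p i`. -/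
lemma exists_segDom {i j : ι} (hij : i ≠ j)
    (hseg : ∀ k, k ≠ i → k ≠ j → p k ∉ segment ℝ (p i) (p j)) :
    ∃ b, SegDom p i j b ∧ SegDom p j i b := by
  have key : ∀ (i j k : ι), p k ∉ (fun τ : ℝ => p i + τ • (p j - p i)) '' Set.Ico 0 1 →
      ∃ b, ∀ τ : ℝ, 0 ≤ τ → τ < 1 → cpt b (sec b (p i + τ • (p j - p i) - p k)) ≠ 0 := by
    intro i j k hk
    have hc : Convex ℝ ((fun τ : ℝ => p i + τ • (p j - p i) - p k) '' Set.Ico 0 1) := by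
      have : (fun τ : ℝ => p i + τ • (p j - p i) - p k) = AffineMap.lineMap (p i - p k) (p j - p k) := by
        funext τ
        simp only [AffineMap.lineMap_apply, vsub_eq_sub, vadd_eq_add, sub_sub_sub_cancel_right]
        abel
      rw [this]
      exact (convex_Ico 0 1).affine_image _
    obtain ⟨b, hb⟩ := exists_section_of_convex hc (by
      rintro ⟨τ, hτ, h⟩
      exact hk ⟨τ, hτ, sub_eq_zero.1 h⟩)
    exact ⟨b, fun τ h0 h1 => hb _ ⟨τ, ⟨h0, h1⟩, rfl⟩⟩
  have hne : p j - p i ≠ 0 := sub_ne_zero.2 fun h => hij (p.injective h).symm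
  have hex : ∀ k, ∃ b, (k ≠ i → ∀ τ : ℝ, 0 ≤ τ → τ < 1 → cpt b (sec b (p i + τ • (p j - p i) - p k)) ≠ 0) ∧
      (k ≠ j → ∀ τ : ℝ, 0 ≤ τ → τ < 1 → cpt b (sec b (p j + τ • (p i - p j) - p k)) ≠ 0) := by
    intro k
    by_cases hki : k = i
    · obtain ⟨b, hb⟩ := key j i k (by
        rintro ⟨τ, hτ, h⟩
        rw [hki] at h
        have h1 : (1 - τ) • (p j - p i) = 0 := by
          rw [sub_smul, one_smul, ← sub_eq_zero.2 h]
          simp only [smul_sub]; abel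
        rcases smul_eq_zero.1 h1 with h2 | h2
        · linarith [hτ.2]
        · exact hne h2)
      exact ⟨b, fun h => absurd hki h, fun _ => hb⟩
    · by_cases hkj : k = j
      · obtain ⟨b, hb⟩ := key i j k (by
          rintro ⟨τ, hτ, h⟩
          rw [hkj] at h
          have h1 : (1 - τ) • (p j - p i) = 0 := by
            rw [sub_smul, one_smul, ← neg_eq_zero, ← sub_eq_zero.2 h]
            simp only [smul_sub]; abel
          rcases smul_eq_zero.1 h1 with h2 | h2
          · linarith [hτ.2]
          · exact hne h2)
        exact ⟨b, fun _ => hb, fun h => absurd hkj h⟩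
      · have hc : Convex ℝ ((fun x => x + -p k) '' segment ℝ (p i) (p j)) := by
          simpa using (convex_segment (p i) (p j)).translate (-p k) |> fun h => by
            simpa [add_comm] using h
        obtain ⟨b, hb⟩ := exists_section_of_convex hc (by
          rintro ⟨x, hx, h⟩
          replace h : x + -p k = 0 := h
          rw [← sub_eq_add_neg, sub_eq_zero] at h
          exact hseg k hki hkj (h ▸ hx))
        refine ⟨b, fun _ τ h0 h1 => hb _ ⟨p i + τ • (p j - p i), ?_, (sub_eq_add_neg _ _).symm⟩,
          fun _ τ h0 h1 => hb _ ⟨p j + τ • (p i - p j), ?_, (sub_eq_add_neg _ _).symm⟩⟩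
        · rw [segment_eq_image']; exact ⟨τ, ⟨h0, h1.le⟩, rfl⟩
        · rw [segment_symm, segment_eq_image']; exact ⟨τ, ⟨h0, h1.le⟩, rfl⟩
  choose b hb using hex
  exact ⟨b, fun τ h0 h1 k hk => (hb k).1 hk τ h0 h1, fun τ h0 h1 k hk => (hb k).2 hk τ h0 h1⟩

/-- A spinor over the vector from `p i` to `p j`. -/
def spinor (i j : ι) (b : ι → Bool) : C2 := sec (b i) (p j - p i)

lemma hopf_spinor (i j : ι) (b : ι → Bool) : hopf (spinor p i j b) = p j - p i := hopf_sec _ _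

lemma hopf_smul_spinor (i j : ι) (b : ι → Bool) (z : ℂ) :
    hopf (z • spinor p i j b) = (‖z‖ ^ 2) • (p j - p i) := by
  rw [hopf_smul_eq, hopf_spinor]

lemma spinor_ne_zero {i j : ι} (hij : i ≠ j) (b : ι → Bool) : spinor p i j b ≠ 0 := by
  intro h
  have := hopf_spinor p i j b
  rw [h, hopf_zero, eq_comm, sub_eq_zero] at this
  exact hij (p.injective this).symm

variable {p}

lemma SegDom.coordDom {i j : ι} {b : ι → Bool} (h : SegDom p i j b) {z : ℂ} (hz : ‖z‖ < 1) :
    coordDom (i, b) (lift p (i, b) (z • spinor p i j b)) := by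
  rw [coordDom_lift_iff]
  intro k hk
  rw [hopf_smul_spinor]
  exact h _ (by positivity) (by nlinarith [norm_nonneg z]) k hk

/-- The chart centred at `p i` contains the full fibre over the given point, and its coordinate
there satisfies `hopf u = τ • hopf w`, so it lies on the complex line of the spinor. -/
lemma SegDom.exists_param {i j : ι} {b : ι → Bool} (h : SegDom p i j b) {x : Space p} {τ : ℝ}
    (h0 : 0 ≤ τ) (h1 : τ < 1) (hx : proj p x = p i + τ • (p j - p i)) :
    ∃ z : ℂ, ‖z‖ ^ 2 = τ ∧ x = param p (i, b) (z • spinor p i j b) := by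
  have hs : x ∈ (chart p (i, b)).source := by
    rw [mem_source_iff, hx]
    exact h τ h0 h1
  have e : param p (i, b) (chart p (i, b) x) = x := (chart p (i, b)).left_inv hs
  have h2 : hopf (chart p (i, b) x) = τ • hopf (spinor p i j b) := by
    rw [← e, proj_param] at hx
    rw [hopf_spinor]
    exact add_left_cancel hx
  obtain ⟨z, hz, hu⟩ := exists_smul_of_hopf_eq_smul h0 h2
  exact ⟨z, hz, by rw [← hu, e]⟩

variable (p)

/-- The transition between the parametrizations of the preimage of a segment that are centred at
its two endpoints. -/
lemma param_smul_spinor {i j : ι} (hij : i ≠ j) (b : ι → Bool) {z : ℂ} (hz : z ≠ 0) (hz1 : ‖z‖ < 1) :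
    param p (i, b) (z • spinor p i j b) =
      param p (j, b) ((phase z * (√(1 - ‖z‖ ^ 2) : ℂ)) • spinor p j i b) := by
  have hn : 0 < ‖z‖ := norm_pos_iff.2 hz
  have hs : 0 < √(1 - ‖z‖ ^ 2) := Real.sqrt_pos.2 (by nlinarith)
  have hs2 : √(1 - ‖z‖ ^ 2) ^ 2 = 1 - ‖z‖ ^ 2 := Real.sq_sqrt (by nlinarith)
  have hp := norm_phase hz
  have hnz : ‖phase z * (√(1 - ‖z‖ ^ 2) : ℂ)‖ = √(1 - ‖z‖ ^ 2) := by
    rw [norm_mul, hp, one_mul, Complex.norm_real, Real.norm_of_nonneg hs.le]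
  have hzp : phase z * (‖z‖ : ℂ) = z := by
    rw [phase, div_mul_cancel₀]
    exact_mod_cast hn.ne'
  -- The torus element moves the phase of `z` from component `i` to component `j`; the two phases
  -- are inverse, so the product is one.
  refine Quotient.sound ⟨fun k => if k = i then starRingEnd ℂ (phase z) else if k = j then phase z else 1,
    fun k => ?_, ?_, fun k => ?_⟩
  · simp only
    split_ifs <;> simp [hp]
  · rw [← Finset.mul_prod_erase _ _ (Finset.mem_univ i),
      ← Finset.mul_prod_erase _ _ (Finset.mem_erase.2 ⟨hij.symm, Finset.mem_univ j⟩),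
      Finset.prod_eq_one]
    · simp [hij.symm, conj_mul_self_of_norm_one hp]
    · intro k hk
      simp only [Finset.mem_erase] at hk
      simp [hk.1, hk.2.1]
  · have hpt : p i + hopf (z • spinor p i j b) =
        p j + hopf ((phase z * (√(1 - ‖z‖ ^ 2) : ℂ)) • spinor p j i b) := by
      rw [hopf_smul_spinor, hopf_smul_spinor, hnz, hs2, sub_smul, one_smul]
      simp only [smul_sub]
      abel
    change lift p (j, b) _ k = _ • lift p (i, b) _ k
    by_cases hki : k = i
    · subst hki
      simp only [lift, if_true, if_neg hij]
      -- In the chart at `p j` the component `i` is `sec (b i) (‖z‖ ^ 2 • (p j - p i))`, which is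
      -- `‖z‖` times the spinor because the spinor was defined with the same section `b i`.
      rw [← hpt, add_sub_cancel_left, hopf_smul_spinor, sec_smul _ hn, smul_smul]
      have : starRingEnd ℂ (phase z) * z = (‖z‖ : ℂ) := by
        nth_rewrite 2 [← hzp]
        rw [← mul_assoc, conj_mul_self_of_norm_one hp, one_mul]
      rw [this]
      rfl
    · by_cases hkj : k = j
      · subst hkj
        simp only [lift, if_true, if_neg hki]
        rw [hpt, add_sub_cancel_left, hopf_smul_spinor, hnz, sec_smul _ hs, smul_smul]
        rfl
      · simp only [lift, if_neg hki, if_neg hkj, hpt, one_smul]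

end
end GibbonsHawking

namespace GibbonsHawking

noncomputable section

/-! Polar charts of the two-sphere and the embedding of the sphere. -/

/-- The Euclidean plane. -/
abbrev E2 : Type := EuclideanSpace ℝ (Fin 2)

/-- The unit sphere in `ℝ³`. -/
abbrev S2 : Type := Metric.sphere (0 : E3) 1

lemma norm_sq_E2 (v : E2) : ‖v‖ ^ 2 = v 0 ^ 2 + v 1 ^ 2 := by
  rw [EuclideanSpace.real_norm_sq_eq, Fin.sum_univ_two]

lemma S2_eq (x : S2) : x.1 0 ^ 2 + x.1 1 ^ 2 + x.1 2 ^ 2 = 1 := by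
  rw [← norm_sq_E3, norm_eq_of_mem_sphere]; norm_num

/-- The Lambert azimuthal coordinate centred at the pole `(0, 0, σ)`, where `σ = ±1`. -/
def polarAux (σ : ℝ) (v : E3) : E2 := (√(2 * (1 + σ * v 2)))⁻¹ • !₂[v 0, v 1]

/-- The inverse of `polarAux`. -/
def polarInvAux (σ : ℝ) (y : E2) : E3 :=
  !₂[2 * √(1 - ‖y‖ ^ 2) * y 0, 2 * √(1 - ‖y‖ ^ 2) * y 1, σ * (1 - 2 * ‖y‖ ^ 2)]

lemma polarInvAux_mem {σ : ℝ} (hσ : σ ^ 2 = 1) {y : E2} (hy : ‖y‖ < 1) :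
    polarInvAux σ y ∈ Metric.sphere (0 : E3) 1 := by
  have h1 : √(1 - ‖y‖ ^ 2) ^ 2 = 1 - ‖y‖ ^ 2 := Real.sq_sqrt (by nlinarith [norm_nonneg y])
  have h2 := norm_sq_E2 y
  rw [mem_sphere_zero_iff_norm, ← sq_eq_sq₀ (norm_nonneg _) zero_le_one, norm_sq_E3]
  simp only [polarInvAux, PiLp.toLp_apply, Matrix.cons_val_zero, Matrix.cons_val_one, Matrix.cons_val]
  generalize √(1 - ‖y‖ ^ 2) = s at *
  generalize ‖y‖ = r at *
  linear_combination (4 * (y 0 ^ 2 + y 1 ^ 2)) * h1 + (-4 * (1 - r ^ 2)) * h2 +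
    (1 - 2 * r ^ 2) ^ 2 * hσ

open Classical in
/-- The inverse of the Lambert azimuthal coordinate. -/
def polarInv (σ : ℝ) (y : E2) : S2 :=
  -- The default point is arbitrary: only the open unit disk is used, and there the first case
  -- applies.
  if h : polarInvAux σ y ∈ Metric.sphere (0 : E3) 1 then ⟨_, h⟩ else ⟨!₂[0, 0, 1], by
    rw [mem_sphere_zero_iff_norm, ← sq_eq_sq₀ (norm_nonneg _) zero_le_one, norm_sq_E3]
    simp⟩

lemma polarInv_coe {σ : ℝ} (hσ : σ ^ 2 = 1) {y : E2} (hy : ‖y‖ < 1) :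
    (polarInv σ y : E3) = polarInvAux σ y := by
  rw [polarInv, dif_pos (polarInvAux_mem hσ hy)]

/-- The squared radius is affine in the height, so the radii for `σ = 1` and `σ = -1` satisfy `r² +
r'² = 1`. This is why Lambert coordinates match the gluing of the two disks over a segment. -/
lemma norm_sq_polarAux {σ : ℝ} (hσ : σ ^ 2 = 1) {x : S2} (hx : 0 < 1 + σ * x.1 2) :
    ‖polarAux σ x‖ ^ 2 = (1 - σ * x.1 2) / 2 := by
  have h1 := S2_eq x
  rw [polarAux, norm_smul, mul_pow, norm_sq_E2, norm_inv, Real.norm_of_nonneg (Real.sqrt_nonneg _),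
    inv_pow, Real.sq_sqrt (by linarith)]
  simp only [Matrix.cons_val_zero, Matrix.cons_val_one]
  field_simp
  linear_combination h1 + x.1 2 ^ 2 * hσ

lemma norm_polarAux_lt {σ : ℝ} (hσ : σ ^ 2 = 1) {x : S2} (hx : 0 < 1 + σ * x.1 2) :
    ‖polarAux σ x‖ < 1 := by
  have h1 := norm_sq_polarAux hσ hx
  rw [← abs_of_nonneg (norm_nonneg (polarAux σ x)), ← sq_lt_one_iff_abs_lt_one]
  linarith

lemma polarAux_polarInvAux {σ : ℝ} (hσ : σ ^ 2 = 1) {y : E2} (hy : ‖y‖ < 1) :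
    polarAux σ (polarInvAux σ y) = y := by
  have h0 : 0 < 1 - ‖y‖ ^ 2 := by nlinarith [norm_nonneg y]
  have h1 : 2 * (1 + σ * (polarInvAux σ y) 2) = 2 ^ 2 * (1 - ‖y‖ ^ 2) := by
    simp only [polarInvAux, PiLp.toLp_apply, Matrix.cons_val]
    linear_combination (2 * (1 - 2 * ‖y‖ ^ 2)) * hσ
  have h2 : 0 < √(1 - ‖y‖ ^ 2) := Real.sqrt_pos.2 h0
  rw [polarAux, h1, Real.sqrt_mul (by norm_num), Real.sqrt_sq (by norm_num)]
  ext i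
  fin_cases i <;> simp [polarInvAux] <;> field_simp

lemma polarInvAux_polarAux {σ : ℝ} (hσ : σ ^ 2 = 1) {x : S2} (hx : 0 < 1 + σ * x.1 2) :
    polarInvAux σ (polarAux σ x) = x := by
  have h1 := norm_sq_polarAux hσ hx
  have h2 : 1 - (1 - σ * x.1 2) / 2 = 2 * (1 + σ * x.1 2) / 2 ^ 2 := by ring
  have h3 : 0 < √(2 * (1 + σ * x.1 2)) := Real.sqrt_pos.2 (by linarith)
  rw [polarInvAux, h1, h2, Real.sqrt_div (by linarith), Real.sqrt_sq (by norm_num)]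
  ext i
  fin_cases i
  · simp [polarAux]; field_simp
  · simp [polarAux]; field_simp
  · simp only [Fin.reduceFinMk, Matrix.cons_val]
    linear_combination x.1 2 * hσ

lemma contMDiffOn_polarAux (σ : ℝ) :
    ContMDiffOn (𝓡 2) (𝓡 2) ∞ (fun x : S2 => polarAux σ x) {x | 0 < 1 + σ * x.1 2} := by
  have h1 : ContDiffOn ℝ ∞ (polarAux σ) {v | 0 < 1 + σ * v 2} := by
    intro v hv
    have hco : ∀ i : Fin 3, ContDiffAt ℝ ∞ (fun v : E3 => v i) v := fun i =>
      (EuclideanSpace.proj (𝕜 := ℝ) i).contDiff.contDiffAt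
    have hv' : 0 < 2 * (1 + σ * v 2) := by linarith [show 0 < 1 + σ * v 2 from hv]
    have h2 : ContDiffAt ℝ ∞ (fun v : E3 => √(2 * (1 + σ * v 2))) v :=
      (contDiffAt_const.mul (contDiffAt_const.add (contDiffAt_const.mul (hco 2)))).sqrt hv'.ne'
    refine ContDiffAt.contDiffWithinAt (ContDiffAt.smul (h2.inv (Real.sqrt_pos.2 hv').ne') ?_)
    rw [contDiffAt_euclidean]
    intro i
    fin_cases i
    · exact hco 0
    · exact hco 1
  have h3 : ContMDiff (𝓡 2) 𝓘(ℝ, E3) ∞ ((↑) : S2 → E3) :=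
    have := Fact.mk (@finrank_euclideanSpace_fin ℝ _ (2 + 1))
    contMDiff_coe_sphere
  exact h1.contMDiffOn.comp h3.contMDiffOn fun x hx => hx

lemma contMDiffOn_polarInv {σ : ℝ} (hσ : σ ^ 2 = 1) :
    ContMDiffOn (𝓡 2) (𝓡 2) ∞ (polarInv σ) (Metric.ball 0 1) := by
  -- Smoothness into the sphere follows from smoothness into `ℝ³` for maps that take values in the
  -- sphere everywhere, so the disk is treated as a manifold of its own.
  let U : TopologicalSpace.Opens E2 := ⟨Metric.ball 0 1, Metric.isOpen_ball⟩
  have hU : ∀ y : U, ‖y.1‖ < 1 := fun y => mem_ball_zero_iff.1 y.2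
  have h1 : ContDiffOn ℝ ∞ (polarInvAux σ) (Metric.ball 0 1) := by
    intro y hy
    have hy' : 1 - ‖y‖ ^ 2 ≠ 0 := by
      have := mem_ball_zero_iff.1 hy
      nlinarith [norm_nonneg y]
    have hco : ∀ i : Fin 2, ContDiffAt ℝ ∞ (fun v : E2 => v i) y := fun i =>
      (EuclideanSpace.proj (𝕜 := ℝ) i).contDiff.contDiffAt
    have hn : ContDiffAt ℝ ∞ (fun y : E2 => ‖y‖ ^ 2) y := (contDiff_norm_sq ℝ).contDiffAt
    have hs : ContDiffAt ℝ ∞ (fun y : E2 => √(1 - ‖y‖ ^ 2)) y := (contDiffAt_const.sub hn).sqrt hy'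
    refine ContDiffAt.contDiffWithinAt ?_
    rw [contDiffAt_euclidean]
    intro i
    fin_cases i
    · exact (contDiffAt_const.mul hs).mul (hco 0)
    · exact (contDiffAt_const.mul hs).mul (hco 1)
    · exact contDiffAt_const.mul (contDiffAt_const.sub (contDiffAt_const.mul hn))
  have h2 : ContMDiff (𝓡 2) 𝓘(ℝ, E3) ∞ (fun y : U => polarInvAux σ y) :=
    h1.contMDiffOn.comp_contMDiff contMDiff_subtype_val fun y => y.2
  have := Fact.mk (@finrank_euclideanSpace_fin ℝ _ (2 + 1))
  have h3 := h2.codRestrict_sphere (n := 2) fun y => polarInvAux_mem hσ (hU y)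
  intro y hy
  refine ContMDiffAt.contMDiffWithinAt ?_
  have h4 := (contMDiffAt_subtype_iff (U := U) (f := polarInv σ) (x := ⟨y, hy⟩) (n := ∞)
    (I := 𝓡 2) (I' := 𝓡 2)).1
  refine h4 ?_
  convert! h3 ⟨y, hy⟩ using 1
  funext z
  exact Subtype.ext (polarInv_coe hσ (hU z))

/-- The Lambert azimuthal chart centred at the pole `(0, 0, σ)`. -/
def polarChart {σ : ℝ} (hσ : σ ^ 2 = 1) : OpenPartialHomeomorph S2 E2 where
  toFun x := polarAux σ x
  invFun := polarInv σ
  source := {x | 0 < 1 + σ * x.1 2}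
  target := Metric.ball 0 1
  map_source' x hx := mem_ball_zero_iff.2 (norm_polarAux_lt hσ hx)
  map_target' y hy := by
    have hy' := mem_ball_zero_iff.1 hy
    change 0 < 1 + σ * (polarInv σ y : E3) 2
    rw [polarInv_coe hσ hy']
    simp only [polarInvAux, PiLp.toLp_apply, Matrix.cons_val]
    rw [← mul_assoc, ← sq, hσ]
    nlinarith [norm_nonneg y]
  left_inv' x hx := Subtype.ext (by
    rw [polarInv_coe hσ (norm_polarAux_lt hσ hx), polarInvAux_polarAux hσ hx])
  right_inv' y hy := by
    have hy' := mem_ball_zero_iff.1 hy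
    rw [polarInv_coe hσ hy', polarAux_polarInvAux hσ hy']
  open_source := isOpen_lt continuous_const (by fun_prop)
  open_target := Metric.isOpen_ball
  continuousOn_toFun := (contMDiffOn_polarAux σ).continuousOn
  continuousOn_invFun := (contMDiffOn_polarInv hσ).continuousOn

lemma polarChart_mem_maximalAtlas {σ : ℝ} (hσ : σ ^ 2 = 1) :
    polarChart hσ ∈ IsManifold.maximalAtlas (𝓡 2) ∞ S2 :=
  have : IsManifold (𝓡 2) ∞ S2 := IsManifold.of_le (n := ω) le_top
  (polarChart hσ).mem_maximalAtlas_of_contMDiffOn (contMDiffOn_polarAux σ) (contMDiffOn_polarInv hσ)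

/-- The identification of the Euclidean plane with `ℂ`. -/
def planeC : E2 ≃ₗᵢ[ℝ] ℂ := Complex.orthonormalBasisOneI.repr.symm

/-- A linear isomorphism that maps `(y, 0)` to the multiple of the spinor `w` by `planeC y`. -/
def spinorEquiv {w : C2} (hw : w ≠ 0) : (E2 × ℂ) ≃L[ℝ] C2 :=
  (LinearMap.linearEquivOfInjective
    ({ toFun := fun y => planeC y.1 • w + y.2 • ((-starRingEnd ℂ w.2, starRingEnd ℂ w.1) : C2)
       map_add' := fun x y => by simp only [Prod.fst_add, Prod.snd_add, map_add, add_smul]; abel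
       map_smul' := fun r y => by
        simp only [Prod.smul_fst, Prod.smul_snd, map_smul, smul_assoc, smul_add, RingHom.id_apply] } :
      E2 × ℂ →ₗ[ℝ] C2)
    (by
      rw [← LinearMap.ker_eq_bot, LinearMap.ker_eq_bot']
      intro y hy
      have h1 := congrArg Prod.fst hy
      have h2 := congrArg Prod.snd hy
      simp only [LinearMap.coe_mk, AddHom.coe_mk, Prod.fst_add, Prod.smul_fst, Prod.snd_add,
        Prod.smul_snd, smul_eq_mul, Prod.fst_zero, Prod.snd_zero] at h1 h2
      -- This is the complex determinant of `w` and `(-conj w.2, conj w.1)`, namely `|w|²`; Cramer's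
      -- rule gives injectivity.
      have h3 : (starRingEnd ℂ w.1 * w.1 + starRingEnd ℂ w.2 * w.2) ≠ 0 := by
        rw [mul_comm, Complex.mul_conj, mul_comm (starRingEnd ℂ w.2), Complex.mul_conj,
          Complex.normSq_eq_norm_sq, Complex.normSq_eq_norm_sq, ← Complex.ofReal_add, ← hin_self]
        exact_mod_cast (hin_self_pos hw).ne'
      have h4 : planeC y.1 = 0 := (mul_eq_zero.1 (show planeC y.1 *
        (starRingEnd ℂ w.1 * w.1 + starRingEnd ℂ w.2 * w.2) = 0 by
          linear_combination starRingEnd ℂ w.1 * h1 + starRingEnd ℂ w.2 * h2)).resolve_right h3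
      have h5 : y.2 = 0 := (mul_eq_zero.1 (show y.2 *
        (starRingEnd ℂ w.1 * w.1 + starRingEnd ℂ w.2 * w.2) = 0 by
          linear_combination -w.2 * h1 + w.1 * h2)).resolve_right h3
      exact Prod.ext (by simpa using h4) h5)
    (by simp [Complex.finrank_real_complex])).toContinuousLinearEquiv

lemma spinorEquiv_apply {w : C2} (hw : w ≠ 0) (y : E2) : spinorEquiv hw (y, 0) = planeC y • w := by
  simp [spinorEquiv]

/-! ### The sphere over a segment. -/

variable {ι : Type*} [Fintype ι] [DecidableEq ι] [Nonempty ι] (p : ι ↪ E3)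

/-- The parametrization of the preimage of the segment from `p i` to `p j` by the sphere. -/
def sphereMap (i j : ι) (b : ι → Bool) (x : S2) : Space p :=
  if 0 < 1 + x.1 2 then param p (i, b) (planeC (polarAux 1 x) • spinor p i j b)
  -- On the sphere this case occurs only at the pole `(0, 0, -1)`.
  else param p (j, b) (planeC (polarAux (-1) x) • spinor p j i b)

lemma sphereMap_of_pos {i j : ι} (b : ι → Bool) {x : S2} (hx : 0 < 1 + 1 * x.1 2) :
    sphereMap p i j b x = param p (i, b) (planeC (polarAux 1 x) • spinor p i j b) := by
  rw [one_mul] at hx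
  rw [sphereMap, if_pos hx]

/-- Away from the poles both Lambert coordinates are positive multiples of `(x 0, x 1)`, so they
share their phase and their squared radii add up to one. This is the transition in
`param_smul_spinor`, so the two formulas agree. -/
lemma sphereMap_of_neg {i j : ι} (hij : i ≠ j) (b : ι → Bool) {x : S2} (hx : 0 < 1 + (-1) * x.1 2) :
    sphereMap p i j b x = param p (j, b) (planeC (polarAux (-1) x) • spinor p j i b) := by
  by_cases h : 0 < 1 + 1 * x.1 2
  · have hn := norm_sq_polarAux (σ := 1) (by norm_num) h
    have hlt := norm_polarAux_lt (σ := 1) (by norm_num) h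
    have hne : planeC (polarAux 1 x) ≠ 0 := by
      rw [← norm_ne_zero_iff, LinearIsometryEquiv.norm_map]
      intro h0
      rw [h0] at hn
      linarith
    rw [sphereMap_of_pos p b h, param_smul_spinor p hij b hne (by rwa [LinearIsometryEquiv.norm_map])]
    congr 2
    rw [phase, LinearIsometryEquiv.norm_map, hn]
    set Z := planeC !₂[x.1 0, x.1 1] with hZ
    have h1 : ∀ σ : ℝ, planeC (polarAux σ x) = ((√(2 * (1 + σ * x.1 2)))⁻¹ : ℂ) * Z := by
      intro σ
      rw [polarAux, map_smul, Complex.real_smul, Complex.ofReal_inv]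
    have h2 : ‖polarAux 1 x‖ = √((1 - 1 * x.1 2) / 2) := by
      rw [← hn, Real.sqrt_sq (norm_nonneg _)]
    have e1 : √(2 * (1 + 1 * x.1 2)) = 2 * √((1 + x.1 2) / 2) := by
      rw [show 2 * (1 + 1 * x.1 2) = 2 ^ 2 * ((1 + x.1 2) / 2) by ring, Real.sqrt_mul (by norm_num),
        Real.sqrt_sq (by norm_num)]
    have e2 : √(2 * (1 + -1 * x.1 2)) = 2 * √((1 - x.1 2) / 2) := by
      rw [show 2 * (1 + -1 * x.1 2) = 2 ^ 2 * ((1 - x.1 2) / 2) by ring, Real.sqrt_mul (by norm_num),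
        Real.sqrt_sq (by norm_num)]
    rw [h1, h1, h2, e1, e2, show 1 - (1 - 1 * x.1 2) / 2 = (1 + x.1 2) / 2 by ring, one_mul]
    have h3 : (√((1 + x.1 2) / 2) : ℂ) ≠ 0 := by
      exact_mod_cast (Real.sqrt_pos.2 (by linarith)).ne'
    push_cast
    field_simp
  · rw [sphereMap, if_neg (by simpa using h)]

variable {p}

/-- In the Lambert chart and the chart at `p i` the map is the restriction of a real linear
isomorphism to the plane `y ↦ (y, 0)`. The statement takes `f` and `σ` as variables so that it
covers both hemispheres, with `i` and `j` exchanged. -/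
lemma SegDom.isImmersionAt {i j : ι} (hij : i ≠ j) {b : ι → Bool} (h : SegDom p i j b) {σ : ℝ}
    (hσ : σ ^ 2 = 1) {f : S2 → Space p}
    (hf : ∀ x : S2, 0 < 1 + σ * x.1 2 →
      f x = param p (i, b) (planeC (polarAux σ x) • spinor p i j b))
    {x : S2} (hx : 0 < 1 + σ * x.1 2) :
    Manifold.IsImmersionAtOfComplement ℂ (𝓡 2) 𝓘(ℝ, C2) ∞ f x := by
  have hs : ∀ x : S2, 0 < 1 + σ * x.1 2 → f x ∈ (ochart p (i, b)).source := by
    intro x hx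
    rw [hf x hx]
    exact param_mem_source p (h.coordDom (by
      rw [LinearIsometryEquiv.norm_map]; exact norm_polarAux_lt hσ hx))
  refine Manifold.IsImmersionAtOfComplement.mk_of_charts (spinorEquiv (spinor_ne_zero p hij b))
    (polarChart hσ) (ochart p (i, b)) hx (hs x hx) (polarChart_mem_maximalAtlas hσ)
    (ochart_mem_maximalAtlas p _) (fun y hy => hs y hy) ?_
  intro y hy
  have hy' : y ∈ (polarChart hσ).target := by simpa using hy
  have hn : ‖y‖ < 1 := mem_ball_zero_iff.1 hy'
  simp only [Function.comp_apply, spinorEquiv_apply]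
  change chart p (i, b) (f ((polarChart hσ).symm y)) = _
  rw [hf _ ((polarChart hσ).map_target hy')]
  have e : polarAux σ ((polarChart hσ).symm y : S2) = y := (polarChart hσ).right_inv hy'
  rw [e, chart_param p (h.coordDom (by rwa [LinearIsometryEquiv.norm_map]))]

lemma SegDom.injOn {i j : ι} (hij : i ≠ j) {b : ι → Bool} (h : SegDom p i j b) {σ : ℝ}
    (hσ : σ ^ 2 = 1) {f : S2 → Space p}
    (hf : ∀ x : S2, 0 < 1 + σ * x.1 2 →
      f x = param p (i, b) (planeC (polarAux σ x) • spinor p i j b))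
    {x y : S2} (hx : 0 < 1 + σ * x.1 2) (hy : 0 < 1 + σ * y.1 2) (hxy : f x = f y) : x = y := by
  have key : ∀ x : S2, 0 < 1 + σ * x.1 2 →
      chart p (i, b) (f x) = planeC (polarAux σ x) • spinor p i j b := by
    intro x hx
    rw [hf x hx, chart_param p (h.coordDom (by
      rw [LinearIsometryEquiv.norm_map]; exact norm_polarAux_lt hσ hx))]
  have h1 := key x hx
  rw [hxy, key y hy] at h1
  have h2 := planeC.injective (smul_left_injective ℂ (spinor_ne_zero p hij b) h1)
  exact (polarChart hσ).injOn hx hy h2.symm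

lemma SegDom.proj_eq {i j : ι} {b : ι → Bool} {σ : ℝ}
    (hσ : σ ^ 2 = 1) {f : S2 → Space p}
    (hf : ∀ x : S2, 0 < 1 + σ * x.1 2 →
      f x = param p (i, b) (planeC (polarAux σ x) • spinor p i j b))
    {x : S2} (hx : 0 < 1 + σ * x.1 2) : proj p (f x) = p i + ((1 - σ * x.1 2) / 2) • (p j - p i) := by
  rw [hf x hx, proj_param, hopf_smul_spinor, LinearIsometryEquiv.norm_map, norm_sq_polarAux hσ hx]

lemma SegDom.exists_eq {i j : ι} {b : ι → Bool} (h : SegDom p i j b) {σ : ℝ}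
    (hσ : σ ^ 2 = 1) {f : S2 → Space p}
    (hf : ∀ x : S2, 0 < 1 + σ * x.1 2 →
      f x = param p (i, b) (planeC (polarAux σ x) • spinor p i j b))
    {x : Space p} {τ : ℝ} (h0 : 0 ≤ τ) (h1 : τ < 1) (hx : proj p x = p i + τ • (p j - p i)) :
    ∃ y, f y = x := by
  obtain ⟨z, hz, rfl⟩ := h.exists_param h0 h1 hx
  have hz1 : ‖planeC.symm z‖ < 1 := by
    rw [LinearIsometryEquiv.norm_map]; nlinarith [norm_nonneg z]
  have ht : planeC.symm z ∈ (polarChart hσ).target := mem_ball_zero_iff.2 hz1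
  refine ⟨(polarChart hσ).symm (planeC.symm z), ?_⟩
  rw [hf _ ((polarChart hσ).map_target ht)]
  have e : polarAux σ ((polarChart hσ).symm (planeC.symm z) : S2) = planeC.symm z :=
    (polarChart hσ).right_inv ht
  rw [e, LinearIsometryEquiv.apply_symm_apply]

/-- The preimage of a segment between two of the singular points is a smoothly embedded sphere. -/
theorem exists_sphere_embedding {i j : ι} (hij : i ≠ j)
    (hseg : ∀ k, k ≠ i → k ≠ j → p k ∉ segment ℝ (p i) (p j)) :
    ∃ f : S2 → Space p, Manifold.IsSmoothEmbedding (𝓡 2) 𝓘(ℝ, C2) ∞ f ∧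
      Set.range f = proj p ⁻¹' segment ℝ (p i) (p j) := by
  obtain ⟨b, hb1, hb2⟩ := exists_segDom p hij hseg
  set f := sphereMap p i j b with hf
  have h1 : (1 : ℝ) ^ 2 = 1 := by norm_num
  have h2 : (-1 : ℝ) ^ 2 = 1 := by norm_num
  have hf1 : ∀ x : S2, 0 < 1 + 1 * x.1 2 →
      f x = param p (i, b) (planeC (polarAux 1 x) • spinor p i j b) :=
    fun x hx => sphereMap_of_pos p b hx
  have hf2 : ∀ x : S2, 0 < 1 + (-1) * x.1 2 →
      f x = param p (j, b) (planeC (polarAux (-1) x) • spinor p j i b) :=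
    fun x hx => sphereMap_of_neg p hij b hx
  have hcov : ∀ x : S2, 0 < 1 + 1 * x.1 2 ∨ 0 < 1 + (-1) * x.1 2 := by
    intro x
    by_contra! h
    linarith
  have himm : Manifold.IsImmersionOfComplement ℂ (𝓡 2) 𝓘(ℝ, C2) ∞ f := by
    intro x
    rcases hcov x with hx | hx
    · exact hb1.isImmersionAt hij h1 hf1 hx
    · exact hb2.isImmersionAt hij.symm h2 hf2 hx
  have hproj : ∀ x : S2, proj p (f x) = p i + ((1 - x.1 2) / 2) • (p j - p i) := by
    intro x
    rcases hcov x with hx | hx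
    · rw [SegDom.proj_eq h1 hf1 hx, one_mul]
    · rw [SegDom.proj_eq h2 hf2 hx]
      module
  have hne : p j - p i ≠ 0 := sub_ne_zero.2 fun h => hij (p.injective h).symm
  -- The projection determines the height, so two points with the same image lie in a common Lambert
  -- chart.
  have hinj : Function.Injective f := by
    intro x y hxy
    have h3 := hproj x
    rw [hxy, hproj y] at h3
    have h4 : y.1 2 = x.1 2 := by
      have := smul_left_injective ℝ hne (add_left_cancel h3)
      simp only at this
      linarith
    rcases hcov x with hx | hx
    · exact hb1.injOn hij h1 hf1 hx (by rwa [h4]) hxy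
    · exact hb2.injOn hij.symm h2 hf2 hx (by rwa [h4]) hxy
  have : IsManifold (𝓡 2) ∞ S2 := IsManifold.of_le (n := ω) le_top
  -- The sphere is compact and `X` is Hausdorff.
  refine ⟨f, ⟨himm.isImmersion, (himm.contMDiff.continuous.isClosedEmbedding hinj).isEmbedding⟩, ?_⟩
  ext x
  constructor
  · rintro ⟨y, rfl⟩
    rw [Set.mem_preimage, hproj, segment_eq_image']
    have := S2_eq y
    refine ⟨_, ⟨?_, ?_⟩, rfl⟩ <;> nlinarith [sq_nonneg (y.1 0), sq_nonneg (y.1 1)]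
  · intro hx
    rw [Set.mem_preimage, segment_eq_image'] at hx
    obtain ⟨τ, ⟨h3, h4⟩, hx⟩ := hx
    rcases h4.lt_or_eq with h5 | h5
    · exact hb1.exists_eq h1 hf1 h3 h5 hx.symm
    · refine hb2.exists_eq h2 hf2 le_rfl zero_lt_one ?_
      rw [← hx, h5]
      simp

end
end GibbonsHawking

namespace GibbonsHawking

noncomputable section

/-! The metric in the charts of the atlas. -/

variable {ι : Type*} [Fintype ι] [DecidableEq ι] [Nonempty ι] (p : ι ↪ E3)

/-! ### Pulling the metric back along maps into a chart. -/

section Pullback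

variable {V : Type*} [NormedAddCommGroup V] [NormedSpace ℝ V]

lemma contMDiffOn_param_comp {c : ChartIndex ι} {f : V → C2} {U : Set V} (hf : ContDiffOn ℝ ∞ f U)
    (hU : ∀ v ∈ U, coordDom c (lift p c (f v))) :
    ContMDiffOn 𝓘(ℝ, V) 𝓘(ℝ, C2) ∞ (fun v => param p c (f v)) U :=
  (contMDiffOn_symm_of_mem_maximalAtlas (ochart_mem_maximalAtlas p c)).comp hf.contMDiffOn hU

/-- Tangent vectors at a point are expressed in the preferred chart of that point, so the transition
map from `c` to this chart appears. -/
lemma mfderiv_param_comp {c : ChartIndex ι} {f : V → C2} {v : V} (hf : ContDiffAt ℝ ∞ f v)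
    (hv : coordDom c (lift p c (f v))) (a : V) :
    (mfderiv 𝓘(ℝ, V) 𝓘(ℝ, C2) (fun v => param p c (f v)) v a : C2) =
      fderiv ℝ (trans p c (indexAt p (param p c (f v)))) (f v) (fderiv ℝ f v a) := by
  have hm : MDifferentiableAt 𝓘(ℝ, V) 𝓘(ℝ, C2) (fun v => param p c (f v)) v := by
    have h1 : MDifferentiableAt 𝓘(ℝ, C2) 𝓘(ℝ, C2) (param p c) (f v) :=
      (contMDiffAt_symm_of_mem_maximalAtlas (ochart_mem_maximalAtlas p c) hv).mdifferentiableAt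
        (by simp)
    exact h1.comp v (hf.differentiableAt (by simp)).mdifferentiableAt
  have h' : coordDom (indexAt p (param p c (f v))) (lift p c (f v)) :=
    mem_source_indexAt p (param p c (f v))
  refine (congrArg (fun L : V →L[ℝ] C2 => L a) hm.mfderiv).trans ?_
  simp only [modelWithCornersSelf_coe, Set.range_id, fderivWithin_univ]
  have h2 := (differentiableAt_trans p hv h').hasFDerivAt.comp v
    (hf.differentiableAt (by simp)).hasFDerivAt
  exact congrArg (fun L : V →L[ℝ] C2 => L a) h2.fderiv

/-- By `coordForm_trans` the transition to the preferred chart cancels, so everything can be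
computed in one fixed chart `c`. -/
lemma metric_param_comp {m : ℝ} (hm : 0 ≤ m) {c : ChartIndex ι} {f : V → C2} {v : V}
    (hf : ContDiffAt ℝ ∞ f v) (hv : coordDom c (lift p c (f v))) (a b : V) :
    (metric p m hm).inner (param p c (f v))
      (mfderiv 𝓘(ℝ, V) 𝓘(ℝ, C2) (fun v => param p c (f v)) v a)
      (mfderiv 𝓘(ℝ, V) 𝓘(ℝ, C2) (fun v => param p c (f v)) v b) =
    smoothForm p m c (f v) (fderiv ℝ f v a) (fderiv ℝ f v b) := by
  have h' : coordDom (indexAt p (param p c (f v))) (lift p c (f v)) :=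
    mem_source_indexAt p (param p c (f v))
  rw [← coordForm_eq p hm hv, ← coordForm_trans p m hv h', ← mfderiv_param_comp p hf hv,
    ← mfderiv_param_comp p hf hv]
  rfl

/-- A vector in the kernel would have zero length for the pulled back metric, which is positive on
nonzero vectors. The metric with `m = 0` serves as the auxiliary one. -/
lemma injective_mfderiv_param_comp {c : ChartIndex ι} {f : V → C2} {v : V}
    (hf : ContDiffAt ℝ ∞ f v) (hv : coordDom c (lift p c (f v)))
    (hi : Function.Injective (fderiv ℝ f v)) :
    Function.Injective (mfderiv 𝓘(ℝ, V) 𝓘(ℝ, C2) (fun v => param p c (f v)) v) := by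
  rw [injective_iff_map_eq_zero]
  intro (a : V) ha
  by_contra h0
  have h1 : fderiv ℝ f v a ≠ 0 := fun h => h0 ((injective_iff_map_eq_zero _).1 hi a h)
  have h2 := coordForm_pos p (m := 0) le_rfl hv h1
  have h3 := metric_param_comp p le_rfl hf hv a a
  rw [coordForm_eq p le_rfl hv, ← h3, ha, map_zero] at h2
  exact lt_irrefl _ h2

end Pullback

variable {p}

lemma coordMetric_ochart {m : ℝ} (hm : 0 ≤ m) {c : ChartIndex ι} {y : C2}
    (hy : coordDom c (lift p c y)) (a b : C2) :
    coordMetric (metric p m hm) (ochart p c) a b y = smoothForm p m c y a b := by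
  have := metric_param_comp p hm (f := id) (v := y) contDiffAt_id hy a b
  simp only [fderiv_id] at this
  exact this

lemma inducedMetric_param_comp {m : ℝ} (hm : 0 ≤ m) {c : ChartIndex ι} {f : ℝ × ℝ → C2} {v : ℝ × ℝ}
    (hf : ContDiffAt ℝ ∞ f v) (hv : coordDom c (lift p c (f v))) (a b : ℝ × ℝ) :
    inducedMetric (metric p m hm) (fun v => param p c (f v)) a b v =
      smoothForm p m c (f v) (fderiv ℝ f v a) (fderiv ℝ f v b) :=
  metric_param_comp p hm hf hv a b

lemma isSurfacePatch_param_comp {c : ChartIndex ι} {f : ℝ × ℝ → C2} {U : Set (ℝ × ℝ)} {s : Set E3}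
    (hU : IsOpen U) (hf : ContDiffOn ℝ ∞ f U) (hdom : ∀ v ∈ U, coordDom c (lift p c (f v)))
    (hi : ∀ v ∈ U, Function.Injective (fderiv ℝ f v)) (hs : ∀ v ∈ U, p c.1 + hopf (f v) ∈ s) :
    IsSurfacePatch (E := C2) (proj p ⁻¹' s) U (fun v => param p c (f v)) where
  isOpen := hU
  contMDiffOn := contMDiffOn_param_comp p hf hdom
  injective_mfderiv v hv :=
    injective_mfderiv_param_comp p (hf.contDiffAt (hU.mem_nhds hv)) (hdom v hv) (hi v hv)
  mapsTo v hv := by rw [Set.mem_preimage, proj_param]; exact hs v hv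

lemma christoffel_ochart {m : ℝ} (hm : 0 ≤ m) {c : ChartIndex ι} {y : C2}
    (hy : coordDom c (lift p c y)) (a b ν : C2) :
    christoffel (metric p m hm) (ochart p c) y a b ν =
      (fderiv ℝ (smoothForm p m c) y a b ν + fderiv ℝ (smoothForm p m c) y b a ν -
        fderiv ℝ (smoothForm p m c) y ν a b) / 2 := by
  have key : ∀ a b w, fderiv ℝ (coordMetric (metric p m hm) (ochart p c) a b) y w =
      fderiv ℝ (smoothForm p m c) y w a b := by
    intro a b w
    have h1 : coordMetric (metric p m hm) (ochart p c) a b =ᶠ[𝓝 y]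
        fun y => smoothForm p m c y a b := by
      filter_upwards [(isOpen_coordDom p c).mem_nhds hy] with z hz
      exact coordMetric_ochart hm hz a b
    have h2 := ((contDiffAt_smoothForm p hm hy).differentiableAt (by simp)).hasFDerivAt
    have h3 := (h2.clm_apply (hasFDerivAt_const a y)).clm_apply (hasFDerivAt_const b y)
    rw [h1.fderiv_eq, h3.fderiv]
    simp
  rw [christoffel, key, key, key]

lemma ochart_param_comp {c : ChartIndex ι} {f : ℝ × ℝ → C2} {v : ℝ × ℝ}
    (hf : ContinuousAt f v) (hv : coordDom c (lift p c (f v))) :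
    (ochart p c ∘ fun v => param p c (f v)) =ᶠ[𝓝 v] f := by
  filter_upwards [hf.preimage_mem_nhds ((isOpen_coordDom p c).mem_nhds hv)] with z hz
  exact chart_param p hz

/-- The chart undoes `param` in a neighbourhood of `v`, so first and second derivatives are those of
`f`. -/
lemma secondForm_param_comp {m : ℝ} (hm : 0 ≤ m) {c : ChartIndex ι} {f : ℝ × ℝ → C2} {v : ℝ × ℝ}
    (hf : ContinuousAt f v) (hv : coordDom c (lift p c (f v))) (a b : ℝ × ℝ) (ν : C2) :
    secondForm (metric p m hm) (ochart p c) (fun v => param p c (f v)) v a b ν =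
      smoothForm p m c (f v) (fderiv ℝ (fun z => fderiv ℝ f z b) v a) ν +
        (fderiv ℝ (smoothForm p m c) (f v) (fderiv ℝ f v a) (fderiv ℝ f v b) ν +
          fderiv ℝ (smoothForm p m c) (f v) (fderiv ℝ f v b) (fderiv ℝ f v a) ν -
          fderiv ℝ (smoothForm p m c) (f v) ν (fderiv ℝ f v a) (fderiv ℝ f v b)) / 2 := by
  have h1 := ochart_param_comp hf hv
  have h2 : (fun z => fderiv ℝ (ochart p c ∘ fun v => param p c (f v)) z b) =ᶠ[𝓝 v]
      fun z => fderiv ℝ f z b := (h1.fderiv (𝕜 := ℝ)).mono fun z hz => by simp only [hz]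
  have h3 : ochart p c (param p c (f v)) = f v := chart_param p hv
  rw [secondForm, h3, h2.fderiv_eq, h1.fderiv_eq, coordMetric_ochart hm hv, christoffel_ochart hm hv]

end
end GibbonsHawking

namespace GibbonsHawking

noncomputable section

/-! The connection form and the first derivatives of the metric away from the fixed points. -/

lemma dhopf_comm (u v : C2) : dhopf u v = dhopf v u := by
  ext i
  fin_cases i <;> simp [dhopf, Complex.inner] <;> ring

lemma dhopf_add (u v w : C2) : dhopf u (v + w) = dhopf u v + dhopf u w := by
  ext i
  fin_cases i <;> simp [dhopf, Complex.inner] <;> ring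

lemma dhopf_smul (u v : C2) (r : ℝ) : dhopf u (r • v) = r • dhopf u v := by
  ext i
  fin_cases i <;> simp [dhopf, Complex.inner] <;> ring

lemma dhopf_I_smul_self (u : C2) : dhopf u (Complex.I • u) = 0 := by
  ext i
  fin_cases i <;> simp [dhopf, Complex.inner, mul_comm] <;> ring

lemma dhopf_I_I (u v : C2) : dhopf (Complex.I • u) (Complex.I • v) = dhopf u v := by
  ext i
  fin_cases i <;> simp [dhopf, Complex.inner, add_comm]

lemma hin_I_smul_self (u : C2) : hin (Complex.I • u) u = 0 := by
  simp [hin_eq]; ring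

lemma dhopf_smul_smul (z a : ℂ) (w : C2) :
    dhopf (z • w) (a • w) = (2 * (starRingEnd ℂ z * a).re) • hopf w := by
  ext i
  fin_cases i <;> simp [dhopf, hopf, Complex.inner, Complex.normSq_apply] <;> ring

lemma hin_I_smul_smul (z a : ℂ) (w : C2) :
    hin (Complex.I • z • w) (a • w) = (starRingEnd ℂ z * a).im * hin w w := by
  simp [hin_eq]; ring

variable {ι : Type*} [Fintype ι] [DecidableEq ι] [Nonempty ι] (p : ι ↪ E3)

lemma lift_ne_zero {c : ChartIndex ι} {u : C2} (h : coordDom c (lift p c u)) {j : ι} (hj : j ≠ c.1) :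
    lift p c u j ≠ 0 := by
  intro h0
  exact h j hj (by rw [h0]; cases c.2 j <;> simp [cpt])

lemma contDiffAt_phiReg (m : ℝ) {c : ChartIndex ι} {u : C2}
    (h : coordDom c (lift p c u)) : ContDiffAt ℝ ∞ (phiReg p m c) u := by
  refine contDiffAt_const.add (ContDiffAt.sum fun j hj => ?_)
  have h1 : ContDiffAt ℝ ∞ (fun u => p c.1 + hopf u - p j) u :=
    (contDiffAt_const.add contDiff_hopf.contDiffAt).sub contDiffAt_const
  have h2 : p c.1 + hopf u - p j ≠ 0 := by
    intro h0
    apply lift_ne_zero p h (Finset.ne_of_mem_erase hj)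
    apply hopf_eq_zero
    have := add_hopf_lift p c u j
    rw [sub_eq_zero.1 h0] at this
    simpa using this
  exact contDiffAt_const.div (contDiffAt_const.mul (h1.norm ℝ h2)) (by simpa using h2)

lemma contDiffAt_hopfConn {w : C2} (hw : w ≠ 0) : ContDiffAt ℝ ∞ hopfConn w := by
  unfold hopfConn
  refine ContDiffAt.smul (contDiff_hin.contDiffAt.inv (hin_self_pos hw).ne') ?_
  exact hin.contDiff.contDiffAt.comp _ (contDiffAt_id.const_smul Complex.I)

lemma contDiffAt_etaReg {c : ChartIndex ι} {u : C2}
    (h : coordDom c (lift p c u)) : ContDiffAt ℝ ∞ (etaReg p c) u := by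
  unfold etaReg
  refine ContDiffAt.sum fun j hj => ?_
  have h1 := contDiffAt_lift p h j
  exact ((contDiffAt_hopfConn (lift_ne_zero p h (Finset.ne_of_mem_erase hj))).comp u h1).clm_comp
    (h1.fderiv_right (m := ∞) (by simp))

lemma contDiffAt_etaForm {c : ChartIndex ι} {u : C2}
    (h : coordDom c (lift p c u)) (hu : u ≠ 0) : ContDiffAt ℝ ∞ (etaForm p c) u := by
  have : etaForm p c = fun u => hopfConn u + etaReg p c u := funext fun u => etaForm_eq p c u
  rw [this]
  exact (contDiffAt_hopfConn hu).add (contDiffAt_etaReg p h)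

lemma coordDom_lift_smul {c : ChartIndex ι} {u : C2} {l : ℂ} (hl : ‖l‖ = 1) :
    coordDom c (lift p c (l • u)) ↔ coordDom c (lift p c u) := by
  rw [coordDom_lift_iff, coordDom_lift_iff, hopf_smul _ hl]

/-- The connection form is invariant under the circle action. -/
lemma etaForm_smul {c : ChartIndex ι} {u : C2} (h : coordDom c (lift p c u)) {l : ℂ} (hl : ‖l‖ = 1)
    (v : C2) : etaForm p c (l • u) (l • v) = etaForm p c u v := by
  have h1 : etaReg p c (l • u) (l • v) = etaReg p c u v := by
    simp only [etaReg, sum_apply, ContinuousLinearMap.comp_apply]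
    refine Finset.sum_congr rfl fun j hj => ?_
    have hj' := Finset.ne_of_mem_erase hj
    -- For `j ≠ c.1` the components depend on `u` through `hopf u` only, which the circle action
    -- fixes.
    have h2 : (fun u => lift p c (l • u) j) = fun u => lift p c u j := by
      funext u
      simp only [lift, if_neg hj', hopf_smul _ hl]
    have h3 : HasFDerivAt (fun u => lift p c u j) _ (l • u) :=
      ((contDiffAt_lift p ((coordDom_lift_smul p hl).2 h) j).differentiableAt (by simp)).hasFDerivAt
    have h4 : HasFDerivAt (fun u : C2 => l • u) (l • ContinuousLinearMap.id ℝ C2) u :=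
      (hasFDerivAt_id (𝕜 := ℝ) u).const_smul l
    have h5 := h3.comp u h4
    have h6 : ((fun u => lift p c u j) ∘ fun u : C2 => l • u) = fun u => lift p c u j := h2
    rw [h6] at h5
    have h7 : lift p c (l • u) j = lift p c u j := congrFun h2 u
    rw [h5.fderiv, h7]
    simp
  rw [etaForm_eq, etaForm_eq, add_apply, add_apply, h1]
  simp only [smul_apply, smul_eq_mul]
  rw [smul_comm Complex.I l u, hin_smul_smul, hin_smul_smul, hl]
  simp

/-- The vector `I • u` is vertical, so the summands pulled back from the base vanish on it; the Hopf
form of the centre is normalized to be one there. -/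
lemma etaForm_I_smul {c : ChartIndex ι} {u : C2} (h : coordDom c (lift p c u)) (hu : u ≠ 0) :
    etaForm p c u (Complex.I • u) = 1 := by
  have h1 : etaReg p c u (Complex.I • u) = 0 :=
    etaReg_apply_eq_zero p h (by rw [fderiv_hopf, dhopf_I_smul_self])
  have h2 := (hin_self_pos hu).ne'
  rw [etaForm_eq, add_apply, h1, smul_apply, hin_smul_smul]
  simp [h2]

/-- The chain rule with a base point that equals `g t` only propositionally, as for `u + t • a` at
`t = 0`. -/
lemma hasDerivAt_comp_of_eq {W : Type*} [NormedAddCommGroup W] [NormedSpace ℝ W] {f : C2 → W}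
    {f' : C2 →L[ℝ] W} {x : C2} (hf : HasFDerivAt f f' x) {g : ℝ → C2} {g' : C2} {t : ℝ}
    (hg : HasDerivAt g g' t) (h : g t = x) : HasDerivAt (fun t => f (g t)) (f' g') t := by
  subst h
  exact hf.comp_hasDerivAt t hg

/-- The interior product of the curvature of the connection with the generator of the circle action
vanishes. -/
lemma fderiv_etaForm_I_smul {c : ChartIndex ι} {u : C2} (h : coordDom c (lift p c u)) (hu : u ≠ 0)
    (v : C2) : fderiv ℝ (etaForm p c) u (Complex.I • u) v =
      fderiv ℝ (etaForm p c) u v (Complex.I • u) := by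
  have hd := ((contDiffAt_etaForm p h hu).differentiableAt (by simp)).hasFDerivAt
  -- Differentiate circle invariance in the form `η (e^{iθ} u) v = η u (e^{-iθ} v)` at `θ = 0`.
  have h1 : fderiv ℝ (etaForm p c) u (Complex.I • u) v = etaForm p c u (-Complex.I • v) := by
    have hexp : ∀ a : ℂ, HasDerivAt (fun θ : ℝ => Complex.exp (θ * a)) a (0 : ℝ) := by
      intro a
      have h2 : HasDerivAt (fun θ : ℂ => Complex.exp (θ * a)) a ((0 : ℝ) : ℂ) := by
        simpa using ((hasDerivAt_id (0 : ℂ)).mul_const a).cexp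
      exact h2.comp_ofReal
    have h3 : HasDerivAt (fun θ : ℝ => Complex.exp (θ * Complex.I) • u) (Complex.I • u) 0 :=
      (hexp Complex.I).smul_const u
    have h4 : HasDerivAt (fun θ : ℝ => Complex.exp (θ * (-Complex.I)) • v) (-Complex.I • v) 0 :=
      (hexp (-Complex.I)).smul_const v
    have h5 : HasDerivAt (fun θ : ℝ => etaForm p c (Complex.exp (θ * Complex.I) • u) v)
        (fderiv ℝ (etaForm p c) u (Complex.I • u) v) 0 := by
      have h5' := hasDerivAt_comp_of_eq hd h3 (by simp)
      have := h5'.clm_apply (hasDerivAt_const (0 : ℝ) v)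
      rwa [map_zero, add_zero] at this
    have h6 : HasDerivAt (fun θ : ℝ => etaForm p c u (Complex.exp (θ * (-Complex.I)) • v))
        (etaForm p c u (-Complex.I • v)) 0 :=
      hasDerivAt_comp_of_eq (etaForm p c u).hasFDerivAt h4 rfl
    have h7 : (fun θ : ℝ => etaForm p c (Complex.exp (θ * Complex.I) • u) v) =
        fun θ : ℝ => etaForm p c u (Complex.exp (θ * (-Complex.I)) • v) := by
      funext θ
      rw [← etaForm_smul p h (Complex.norm_exp_ofReal_mul_I θ), smul_smul, ← Complex.exp_add]
      simp
    rw [h7] at h5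
    exact h5.unique h6
  -- Differentiate the identity `η u (I • u) = 1` in the direction `v`.
  have h2 : fderiv ℝ (etaForm p c) u v (Complex.I • u) = -etaForm p c u (Complex.I • v) := by
    have h3 : HasFDerivAt (fun u : C2 => Complex.I • u)
        (Complex.I • ContinuousLinearMap.id ℝ C2) u := (hasFDerivAt_id (𝕜 := ℝ) u).const_smul Complex.I
    have h4 := hd.clm_apply h3
    have h5 : HasFDerivAt (fun u => etaForm p c u (Complex.I • u)) (0 : C2 →L[ℝ] ℝ) u := by
      refine (hasFDerivAt_const (1 : ℝ) u).congr_of_eventuallyEq ?_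
      filter_upwards [(isOpen_coordDom p c).mem_nhds h, isOpen_ne.mem_nhds hu] with z hz hz0
      exact etaForm_I_smul p hz hz0
    have h6 := congrArg (fun L : C2 →L[ℝ] ℝ => L v) (h4.unique h5)
    simp at h6
    linarith
  rw [h1, h2, neg_smul, map_neg]

/-- The function `φ` in a chart. -/
def chartPhi (m : ℝ) (c : ChartIndex ι) (u : C2) : ℝ := phi p m (p c.1 + hopf u)

lemma contDiffAt_chartPhi (m : ℝ) {c : ChartIndex ι} {u : C2}
    (h : coordDom c (lift p c u)) (hu : u ≠ 0) : ContDiffAt ℝ ∞ (chartPhi p m c) u := by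
  refine ((contDiff_hin.contDiffAt.inv (hin_self_pos hu).ne').add
    (contDiffAt_phiReg p m h)).congr_of_eventuallyEq ?_
  filter_upwards [isOpen_ne.mem_nhds hu] with z hz
  exact phi_eq p m c hz

lemma chartPhi_pos {m : ℝ} (hm : 0 ≤ m) {c : ChartIndex ι} {u : C2} (hu : u ≠ 0) :
    0 < chartPhi p m c u := by
  rw [chartPhi, phi_eq p m c hu]
  have := hin_self_pos hu
  have := phiReg_nonneg p hm c u
  positivity

lemma smoothForm_apply {m : ℝ} (hm : 0 ≤ m) {c : ChartIndex ι} {u : C2}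
    (h : coordDom c (lift p c u)) (hu : u ≠ 0) (v w : C2) :
    smoothForm p m c u v w = (chartPhi p m c u)⁻¹ * (etaForm p c u v * etaForm p c u w) +
      chartPhi p m c u * inner ℝ (dhopf u v) (dhopf u w) := by
  rw [← coordForm_eq p hm h, coordForm, if_neg (fun h' => hu ((not_mem_range p h).1 h'))]
  simp [fderiv_hopf, innerE3_apply, chartPhi]

/-- The product rule for `φ⁻¹ η² + φ |dπ|²` along the line `u + t • a`; `dhopf` is real bilinear, so
differentiating it in its base point replaces `u` by `a`. -/
lemma fderiv_smoothForm_apply {m : ℝ} (hm : 0 ≤ m) {c : ChartIndex ι} {u : C2}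
    (h : coordDom c (lift p c u)) (hu : u ≠ 0) (a v w : C2) :
    fderiv ℝ (smoothForm p m c) u a v w =
      -(fderiv ℝ (chartPhi p m c) u a) / chartPhi p m c u ^ 2 *
          (etaForm p c u v * etaForm p c u w) +
        (chartPhi p m c u)⁻¹ * (fderiv ℝ (etaForm p c) u a v * etaForm p c u w +
          etaForm p c u v * fderiv ℝ (etaForm p c) u a w) +
        (fderiv ℝ (chartPhi p m c) u a * inner ℝ (dhopf u v) (dhopf u w) +
        chartPhi p m c u * (inner ℝ (dhopf u v) (dhopf a w) + inner ℝ (dhopf a v) (dhopf u w))) := by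
  have hl : HasDerivAt (fun t : ℝ => u + t • a) a 0 := by
    simpa using ((hasDerivAt_id (0 : ℝ)).smul_const a).const_add u
  have hcomp : ∀ {W : Type} [NormedAddCommGroup W] [NormedSpace ℝ W] {f : C2 → W},
      DifferentiableAt ℝ f u → HasDerivAt (fun t : ℝ => f (u + t • a)) (fderiv ℝ f u a) 0 := by
    intro W _ _ f hf
    exact hasDerivAt_comp_of_eq hf.hasFDerivAt hl (by simp)
  have hS := ((hcomp ((contDiffAt_smoothForm p hm h).differentiableAt (by simp))).clm_apply
    (hasDerivAt_const (0 : ℝ) v)).clm_apply (hasDerivAt_const (0 : ℝ) w)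
  have hP := hcomp ((contDiffAt_chartPhi p m h hu).differentiableAt (by simp))
  have hE := hcomp ((contDiffAt_etaForm p h hu).differentiableAt (by simp))
  have hEv := hE.clm_apply (hasDerivAt_const (0 : ℝ) v)
  have hEw := hE.clm_apply (hasDerivAt_const (0 : ℝ) w)
  have hD : ∀ v, HasDerivAt (fun t : ℝ => dhopf (u + t • a) v) (dhopf a v) 0 := by
    intro v
    have h1 : (fun t : ℝ => dhopf (u + t • a) v) = fun t : ℝ => dhopf u v + t • dhopf a v := by
      funext t
      rw [dhopf_comm, dhopf_add, dhopf_smul, dhopf_comm v u, dhopf_comm v a]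
    rw [h1]
    simpa using ((hasDerivAt_id (0 : ℝ)).smul_const (dhopf a v)).const_add (dhopf u v)
  have hne := (chartPhi_pos p hm (c := c) hu).ne'
  have hR := ((hP.inv (by simpa using hne)).mul (hEv.mul hEw)).add
    (hP.mul ((hD v).inner ℝ (hD w)))
  have heq : (fun t : ℝ => smoothForm p m c (u + t • a) v w) =ᶠ[𝓝 0] fun t : ℝ =>
      (chartPhi p m c (u + t • a))⁻¹ * (etaForm p c (u + t • a) v * etaForm p c (u + t • a) w) +
      chartPhi p m c (u + t • a) * inner ℝ (dhopf (u + t • a) v) (dhopf (u + t • a) w) := by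
    have hopen : IsOpen ({u | coordDom c (lift p c u)} ∩ {0}ᶜ) :=
      (isOpen_coordDom p c).inter isOpen_compl_singleton
    have hmem : u + (0 : ℝ) • a ∈ ({u | coordDom c (lift p c u)} ∩ {0}ᶜ) := by
      rw [zero_smul, add_zero]; exact ⟨h, hu⟩
    filter_upwards [hl.continuousAt.preimage_mem_nhds (hopen.mem_nhds hmem)] with t ht
    exact smoothForm_apply p hm ht.1 ht.2 v w
  have := hS.unique (hR.congr_of_eventuallyEq heq)
  simpa using this

/-- The Christoffel symbols of the metric in a chart. -/
def chartGamma (m : ℝ) (c : ChartIndex ι) (u a b ν : C2) : ℝ :=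
  (fderiv ℝ (smoothForm p m c) u a b ν + fderiv ℝ (smoothForm p m c) u b a ν -
    fderiv ℝ (smoothForm p m c) u ν a b) / 2

/-- The complex line through `u` is a minimal surface to second order at `u`. -/
lemma trace_chartGamma_eq_zero {m : ℝ} (hm : 0 ≤ m) {c : ChartIndex ι} {u : C2}
    (h : coordDom c (lift p c u)) (hu : u ≠ 0) {ν : C2}
    (h1 : smoothForm p m c u u ν = 0) (h2 : smoothForm p m c u (Complex.I • u) ν = 0) :
    smoothForm p m c u (Complex.I • u) (Complex.I • u) * chartGamma p m c u u u ν
      - 2 * smoothForm p m c u u (Complex.I • u) * chartGamma p m c u u (Complex.I • u) ν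
      + smoothForm p m c u u u * chartGamma p m c u (Complex.I • u) (Complex.I • u) ν = 0 := by
  have hpos := chartPhi_pos p hm (c := c) hu
  have hI := etaForm_I_smul p h hu
  have hdI := fderiv_etaForm_I_smul p h hu ν
  -- Orthogonality to the vertical vector `I • u` says that `ν` is horizontal, `η ν = 0`.
  rw [smoothForm_apply p hm h hu, hI, dhopf_I_smul_self, inner_zero_left, mul_zero, add_zero, one_mul,
    mul_eq_zero, inv_eq_zero] at h2
  have hν := h2.resolve_left hpos.ne'
  -- Orthogonality to `u` then says that `dπ ν` is perpendicular to `dπ u`, the direction of the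
  -- segment.
  rw [smoothForm_apply p hm h hu, hν, mul_zero, mul_zero, zero_add, mul_eq_zero] at h1
  have hdν := h1.resolve_left hpos.ne'
  have hII : dhopf (Complex.I • u) (Complex.I • u) = dhopf u u := dhopf_I_I u u
  have hIu : dhopf (Complex.I • u) u = 0 := by rw [dhopf_comm, dhopf_I_smul_self]
  have hνu : inner ℝ (dhopf ν u) (dhopf u u) = 0 := by rw [dhopf_comm ν u, real_inner_comm, hdν]
  have hνu' : inner ℝ (dhopf u u) (dhopf ν u) = 0 := by rw [dhopf_comm ν u, hdν]
  simp only [chartGamma, smoothForm_apply p hm h hu, fderiv_smoothForm_apply p hm h hu, hI, hν, hdν,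
    dhopf_I_smul_self, hII, hIu, hdI, inner_zero_left, inner_zero_right, hνu, hνu',
    dhopf_comm ν (Complex.I • u)]
  -- What remains are terms in `dφ ν` and in the curvature `dη (u, ν)`. The former cancel because
  -- `φ` enters with exponents `1` and `-1`, the latter because the mixed coefficient is `g(u, I u)
  -- = φ⁻¹ η u`.
  field_simp
  ring

end
end GibbonsHawking

namespace GibbonsHawking

noncomputable section

/-! The preimage of a segment away from its endpoints. -/

/-! ### The Brioschi formula for metrics invariant under a translation. -/

section Brioschi

variable {J : Set ℝ} {H : ℝ × ℝ → ℝ} {h : ℝ → ℝ}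

lemma hasFDerivAt_of_eq_fst (hJ : IsOpen J) (hh : DifferentiableOn ℝ h J)
    (hH : ∀ v : ℝ × ℝ, v.1 ∈ J → H v = h v.1) {v : ℝ × ℝ} (hv : v.1 ∈ J) :
    HasFDerivAt H (deriv h v.1 • ContinuousLinearMap.fst ℝ ℝ ℝ) v := by
  have h1 := (hh.differentiableAt (hJ.mem_nhds hv)).hasDerivAt.comp_hasFDerivAt v
    (hasFDerivAt_fst (𝕜 := ℝ) (E := ℝ) (F := ℝ) (p := v))
  refine h1.congr_of_eventuallyEq ?_
  filter_upwards [(hJ.preimage continuous_fst).mem_nhds hv] with z hz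
  exact hH z hz

lemma pd1_of_eq_fst (hJ : IsOpen J) (hh : DifferentiableOn ℝ h J)
    (hH : ∀ v : ℝ × ℝ, v.1 ∈ J → H v = h v.1) {v : ℝ × ℝ} (hv : v.1 ∈ J) :
    pd1 H v = deriv h v.1 := by
  rw [pd1, (hasFDerivAt_of_eq_fst hJ hh hH hv).fderiv]
  simp

lemma pd2_of_eq_fst (hJ : IsOpen J) (hh : DifferentiableOn ℝ h J)
    (hH : ∀ v : ℝ × ℝ, v.1 ∈ J → H v = h v.1) {v : ℝ × ℝ} (hv : v.1 ∈ J) : pd2 H v = 0 := by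
  rw [pd2, (hasFDerivAt_of_eq_fst hJ hh hH hv).fderiv]
  simp

/-- The Gauss curvature of a metric with unit determinant that is invariant under translations of
the second coordinate. -/
lemma brioschi_of_eq_fst (hJ : IsOpen J) {E F G : ℝ × ℝ → ℝ} {e f g : ℝ → ℝ}
    (he : ContDiffOn ℝ ∞ e J) (hf : ContDiffOn ℝ ∞ f J) (hg : ContDiffOn ℝ ∞ g J)
    (hE : ∀ v : ℝ × ℝ, v.1 ∈ J → E v = e v.1) (hF : ∀ v : ℝ × ℝ, v.1 ∈ J → F v = f v.1)
    (hG : ∀ v : ℝ × ℝ, v.1 ∈ J → G v = g v.1) (hdet : ∀ s ∈ J, e s * g s - f s ^ 2 = 1)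
    {v : ℝ × ℝ} (hv : v.1 ∈ J) : brioschi E F G v = -deriv (deriv g) v.1 / 2 := by
  have de := he.differentiableOn (by simp)
  have df := hf.differentiableOn (by simp)
  have dg := hg.differentiableOn (by simp)
  have ddf : DifferentiableOn ℝ (deriv f) J :=
    (hf.deriv_of_isOpen (m := ∞) hJ (by simp)).differentiableOn (by simp)
  have ddg : DifferentiableOn ℝ (deriv g) J :=
    (hg.deriv_of_isOpen (m := ∞) hJ (by simp)).differentiableOn (by simp)
  have dz : DifferentiableOn ℝ (fun _ : ℝ => (0 : ℝ)) J := differentiableOn_const 0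
  have e22 : pd2 (pd2 E) v = 0 :=
    pd2_of_eq_fst (h := fun _ => 0) hJ dz (fun z hz => pd2_of_eq_fst hJ de hE hz) hv
  have f12 : pd2 (pd1 F) v = 0 :=
    pd2_of_eq_fst hJ ddf (fun z hz => pd1_of_eq_fst hJ df hF hz) hv
  have g11 : pd1 (pd1 G) v = deriv (deriv g) v.1 :=
    pd1_of_eq_fst hJ ddg (fun z hz => pd1_of_eq_fst hJ dg hG hz) hv
  have hat := fun {k : ℝ → ℝ} (hk : DifferentiableOn ℝ k J) =>
    (hk.differentiableAt (hJ.mem_nhds hv)).hasDerivAt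
  have h1 := ((hat de).mul (hat dg)).sub ((hat df).pow 2)
  have h2 : HasDerivAt (e * g - f ^ 2) 0 v.1 := by
    refine (hasDerivAt_const v.1 (1 : ℝ)).congr_of_eventuallyEq ?_
    filter_upwards [hJ.mem_nhds hv] with s hs
    exact hdet s hs
  have h3 := h1.unique h2
  have h4 := hdet _ hv
  simp only [brioschi, Matrix.det_fin_three, pd1_of_eq_fst hJ de hE hv, pd1_of_eq_fst hJ df hF hv,
    pd1_of_eq_fst hJ dg hG hv, pd2_of_eq_fst hJ de hE hv, pd2_of_eq_fst hJ df hF hv,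
    pd2_of_eq_fst hJ dg hG hv, e22, f12, g11, hE v hv, hF v hv, hG v hv, h4]
  simp
  simp at h3
  -- The first-order terms add up to `g' / 4` times the derivative of the determinant, which is
  -- zero.
  linear_combination (-deriv (deriv g) v.1 / 2) * h4 + deriv g v.1 / 4 * h3

end Brioschi

/-! ### Polar coordinates on a complex line. -/

/-- The coordinate `√(s / L) e ^ (i θ)` on the punctured disk. -/
def polarCoord (L : ℝ) (v : ℝ × ℝ) : ℂ := (√(v.1 / L) : ℂ) * Complex.exp (v.2 * Complex.I)

/-- The logarithmic derivative of `polarCoord`. -/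
def polarLog (v a : ℝ × ℝ) : ℂ := (a.1 / (2 * v.1) : ℝ) + a.2 * Complex.I

/-- The strip on which `polarCoord` is used. -/
def polarStrip (L : ℝ) : Set (ℝ × ℝ) := {v | v.1 ∈ Set.Ioo 0 L}

lemma isOpen_polarStrip (L : ℝ) : IsOpen (polarStrip L) := isOpen_Ioo.preimage continuous_fst

lemma norm_polarCoord_sq {L : ℝ} {v : ℝ × ℝ} (hv : v ∈ polarStrip L) :
    ‖polarCoord L v‖ ^ 2 = v.1 / L := by
  have := div_pos hv.1 (hv.1.trans hv.2)
  rw [polarCoord, norm_mul, Complex.norm_exp_ofReal_mul_I, mul_one, Complex.norm_real,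
    Real.norm_of_nonneg (Real.sqrt_nonneg _), Real.sq_sqrt this.le]

lemma norm_polarCoord_lt {L : ℝ} {v : ℝ × ℝ} (hv : v ∈ polarStrip L) : ‖polarCoord L v‖ < 1 := by
  have h := norm_polarCoord_sq hv
  have : v.1 / L < 1 := (div_lt_one (hv.1.trans hv.2)).2 hv.2
  nlinarith [norm_nonneg (polarCoord L v)]

lemma polarCoord_ne_zero {L : ℝ} {v : ℝ × ℝ} (hv : v ∈ polarStrip L) : polarCoord L v ≠ 0 := by
  intro h
  have h1 := norm_polarCoord_sq hv
  have := div_pos hv.1 (hv.1.trans hv.2)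
  rw [h, norm_zero, zero_pow two_ne_zero] at h1
  exact this.ne h1

lemma contDiffOn_polarCoord (L : ℝ) : ContDiffOn ℝ ∞ (polarCoord L) (polarStrip L) := by
  intro v hv
  have h0 : v.1 / L ≠ 0 := (div_pos hv.1 (hv.1.trans hv.2)).ne'
  have h1 : ContDiffAt ℝ ∞ (fun v : ℝ × ℝ => √(v.1 / L)) v :=
    (contDiffAt_fst.div_const L).sqrt h0
  have hofReal : ContDiff ℝ ∞ (fun x : ℝ => (x : ℂ)) := Complex.ofRealCLM.contDiff
  have h2 : ContDiff ℝ ∞ (fun v : ℝ × ℝ => Complex.exp (v.2 * Complex.I)) :=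
    ((hofReal.comp contDiff_snd).mul contDiff_const).cexp
  exact ((hofReal.contDiffAt.comp v h1).mul h2.contDiffAt).contDiffWithinAt

lemma fderiv_polarCoord {L : ℝ} {v : ℝ × ℝ} (hv : v ∈ polarStrip L) (a : ℝ × ℝ) :
    fderiv ℝ (polarCoord L) v a = polarLog v a * polarCoord L v := by
  have hL : 0 < L := hv.1.trans hv.2
  have hq : 0 < v.1 / L := div_pos hv.1 hL
  have hl : HasDerivAt (fun t : ℝ => v + t • a) a 0 := by
    simpa using ((hasDerivAt_id (0 : ℝ)).smul_const a).const_add v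
  have h0 : HasDerivAt (fun t : ℝ => polarCoord L (v + t • a)) (fderiv ℝ (polarCoord L) v a) 0 := by
    have h1 := (((contDiffOn_polarCoord L).contDiffAt
      ((isOpen_polarStrip L).mem_nhds hv)).differentiableAt (by simp)).hasFDerivAt
    have h2 : HasFDerivAt (polarCoord L) (fderiv ℝ (polarCoord L) v) (v + (0 : ℝ) • a) := by
      simpa using h1
    exact h2.comp_hasDerivAt (0 : ℝ) hl
  have e1 : HasDerivAt (fun t : ℝ => √((v.1 + t * a.1) / L)) (a.1 / (2 * v.1) * √(v.1 / L)) 0 := by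
    have h1 : HasDerivAt (fun t : ℝ => (v.1 + t * a.1) / L) (a.1 / L) 0 := by
      simpa using (((hasDerivAt_id (0 : ℝ)).mul_const a.1).const_add v.1).div_const L
    have h2 := h1.sqrt (by simpa using hq.ne')
    convert! h2 using 1
    have h3 : √(v.1 / L) ≠ 0 := (Real.sqrt_pos.2 hq).ne'
    have h4 : √(v.1 / L) ^ 2 = v.1 / L := Real.sq_sqrt hq.le
    have h5 : v.1 ≠ 0 := hv.1.ne'
    simp only [zero_mul, add_zero]
    rw [div_mul_eq_mul_div, div_eq_div_iff (by positivity) (by positivity)]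
    have h6 : v.1 = √(v.1 / L) ^ 2 * L := by rw [h4]; field_simp
    calc _ = 2 * a.1 * √(v.1 / L) ^ 2 := by ring
      _ = a.1 / L * (2 * (√(v.1 / L) ^ 2 * L)) := by field_simp
      _ = _ := by rw [← h6]
  have e2 : HasDerivAt (fun t : ℝ => Complex.exp (((v.2 + t * a.2 : ℝ) : ℂ) * Complex.I))
      (Complex.exp (v.2 * Complex.I) * (a.2 * Complex.I)) 0 := by
    have h1 : HasDerivAt (fun t : ℝ => v.2 + t * a.2) a.2 0 := by
      simpa using ((hasDerivAt_id (0 : ℝ)).mul_const a.2).const_add v.2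
    have h2 := (h1.ofReal_comp.mul_const Complex.I).cexp
    simpa using h2
  have h3 := e1.ofReal_comp.mul e2
  have h4 := h0.unique h3
  rw [h4]
  simp only [polarLog, polarCoord, zero_mul, add_zero]
  push_cast
  ring

/-! ### The surface patch over the open segment: minimality and curvature. -/

variable {ι : Type*} [Fintype ι] [DecidableEq ι] [Nonempty ι] (p : ι ↪ E3)

/-- The parametrization of the preimage of the segment from `p i` to `p j` by arclength and angle,
in the chart with index `(i, b)`. -/
def polarSpinor (i j : ι) (b : ι → Bool) (v : ℝ × ℝ) : C2 :=
  polarCoord (dist (p i) (p j)) v • spinor p i j b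

lemma contDiffOn_polarSpinor (i j : ι) (b : ι → Bool) :
    ContDiffOn ℝ ∞ (polarSpinor p i j b) (polarStrip (dist (p i) (p j))) :=
  (contDiffOn_polarCoord _).smul contDiffOn_const

lemma fderiv_polarSpinor {i j : ι} (b : ι → Bool) {v : ℝ × ℝ}
    (hv : v ∈ polarStrip (dist (p i) (p j))) (a : ℝ × ℝ) :
    fderiv ℝ (polarSpinor p i j b) v a = polarLog v a • polarSpinor p i j b v := by
  have h1 := (((contDiffOn_polarCoord _).contDiffAt
      ((isOpen_polarStrip _).mem_nhds hv)).differentiableAt (by simp)).hasFDerivAt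
  have h2 := h1.smul_const (spinor p i j b)
  change fderiv ℝ (fun v => polarCoord (dist (p i) (p j)) v • spinor p i j b) v a = _
  rw [h2.fderiv]
  simp [fderiv_polarCoord hv, polarSpinor, mul_smul]

/-- All derivatives stay in the complex line through the point, which is tangent to the surface. So
the coordinate second derivatives do not contribute to the second fundamental form. -/
lemma exists_fderiv_fderiv_polarSpinor {i j : ι} (b : ι → Bool) {v : ℝ × ℝ}
    (hv : v ∈ polarStrip (dist (p i) (p j))) (a a' : ℝ × ℝ) :
    ∃ k : ℂ, fderiv ℝ (fun z => fderiv ℝ (polarSpinor p i j b) z a') v a =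
      k • polarSpinor p i j b v := by
  have h1 : (fun z => fderiv ℝ (polarSpinor p i j b) z a') =ᶠ[𝓝 v]
      fun z => polarLog z a' • polarSpinor p i j b z := by
    filter_upwards [(isOpen_polarStrip _).mem_nhds hv] with z hz
    exact fderiv_polarSpinor p b hz a'
  have h2 := (((contDiffOn_polarSpinor p i j b).contDiffAt
      ((isOpen_polarStrip _).mem_nhds hv)).differentiableAt (by simp)).hasFDerivAt
  have h3 : DifferentiableAt ℝ (fun z => polarLog z a') v := by
    have h4 : DifferentiableAt ℝ (fun z : ℝ × ℝ => a'.1 / (2 * z.1)) v :=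
      (contDiffAt_const.div (contDiffAt_const.mul contDiffAt_fst)
        (by have := hv.1.ne'; simpa using this) :
          ContDiffAt ℝ ∞ (fun z : ℝ × ℝ => a'.1 / (2 * z.1)) v).differentiableAt (by simp)
    have hofReal : Differentiable ℝ (fun x : ℝ => (x : ℂ)) := Complex.ofRealCLM.differentiable
    exact ((hofReal _).comp v h4).add (differentiableAt_const _)
  have h5 : HasFDerivAt (fun z => polarLog z a' • polarSpinor p i j b z) _ v :=
    h3.hasFDerivAt.smul h2
  rw [h1.fderiv_eq, h5.fderiv]
  refine ⟨polarLog v a' * polarLog v a + fderiv ℝ (fun z => polarLog z a') v a, ?_⟩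
  simp [fderiv_polarSpinor p b hv, add_smul, mul_smul]

lemma hopf_polarSpinor {i j : ι} (b : ι → Bool) {v : ℝ × ℝ}
    (hv : v ∈ polarStrip (dist (p i) (p j))) :
    hopf (polarSpinor p i j b v) = (v.1 / dist (p i) (p j)) • (p j - p i) := by
  rw [polarSpinor, hopf_smul_spinor, norm_polarCoord_sq hv]

lemma polarSpinor_ne_zero {i j : ι} (hij : i ≠ j) (b : ι → Bool) {v : ℝ × ℝ}
    (hv : v ∈ polarStrip (dist (p i) (p j))) : polarSpinor p i j b v ≠ 0 :=
  smul_ne_zero (polarCoord_ne_zero hv) (spinor_ne_zero p hij b)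

variable {p}

lemma SegDom.coordDom_polarSpinor {i j : ι} {b : ι → Bool} (h : SegDom p i j b) {v : ℝ × ℝ}
    (hv : v ∈ polarStrip (dist (p i) (p j))) :
    GibbonsHawking.coordDom (i, b) (lift p (i, b) (polarSpinor p i j b v)) :=
  h.coordDom (norm_polarCoord_lt hv)

lemma SegDom.isSurfacePatch_polarSpinor {i j : ι} (hij : i ≠ j) {b : ι → Bool}
    (h : SegDom p i j b) :
    IsSurfacePatch (E := C2) (proj p ⁻¹' segment ℝ (p i) (p j)) (polarStrip (dist (p i) (p j)))
      (fun v => param p (i, b) (polarSpinor p i j b v)) := by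
  refine isSurfacePatch_param_comp (isOpen_polarStrip _) (contDiffOn_polarSpinor p i j b)
    (fun v hv => h.coordDom_polarSpinor hv) (fun v hv => ?_) (fun v hv => ?_)
  · rw [injective_iff_map_eq_zero]
    intro a ha
    rw [fderiv_polarSpinor p b hv, smul_eq_zero] at ha
    have h1 := ha.resolve_right (polarSpinor_ne_zero p hij b hv)
    have h2 := congrArg Complex.re h1
    have h3 := congrArg Complex.im h1
    have h4 := hv.1.ne'
    simp only [polarLog, Complex.add_re, Complex.ofReal_re, Complex.mul_re, Complex.I_re, mul_zero,
      Complex.ofReal_im, Complex.I_im, mul_one, sub_self, add_zero, Complex.zero_re, Complex.add_im,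
      Complex.mul_im, zero_add, Complex.zero_im] at h2 h3
    refine Prod.ext ?_ h3
    have := (div_eq_zero_iff.1 h2).resolve_right (by simpa using h4)
    exact this
  · rw [hopf_polarSpinor p b hv, segment_eq_image']
    have hL : 0 < dist (p i) (p j) := hv.1.trans hv.2
    exact ⟨_, ⟨(div_pos hv.1 hL).le, ((div_lt_one hL).2 hv.2).le⟩, rfl⟩

lemma SegDom.exists_polarSpinor {i j : ι} {b : ι → Bool} (h : SegDom p i j b)
    {x : Space p} {s : ℝ} (hs : s ∈ Set.Ioo 0 (dist (p i) (p j)))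
    (hx : proj p x = p i + (s / dist (p i) (p j)) • (p j - p i)) :
    ∃ θ : ℝ, param p (i, b) (polarSpinor p i j b (s, θ)) = x := by
  have hL : 0 < dist (p i) (p j) := hs.1.trans hs.2
  obtain ⟨z, hz, rfl⟩ := h.exists_param (div_pos hs.1 hL).le ((div_lt_one hL).2 hs.2) hx
  refine ⟨z.arg, ?_⟩
  rw [polarSpinor, polarCoord]
  simp only
  rw [← hz, Real.sqrt_sq (norm_nonneg z), Complex.norm_mul_exp_arg_mul_I]

/-- The second fundamental form reduces to Christoffel symbols of the tangent vectors `u / (2 s)`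
and `I • u`, and `trace_chartGamma_eq_zero` applies to them. -/
lemma meanCurvature_polarSpinor {m : ℝ} (hm : 0 ≤ m) {i j : ι} (hij : i ≠ j) {b : ι → Bool}
    (h : SegDom p i j b) {v : ℝ × ℝ} (hv : v ∈ polarStrip (dist (p i) (p j))) {ν : C2}
    (h1 : smoothForm p m (i, b) (polarSpinor p i j b v) (polarSpinor p i j b v) ν = 0)
    (h2 : smoothForm p m (i, b) (polarSpinor p i j b v) (Complex.I • polarSpinor p i j b v) ν = 0) :
    meanCurvature (metric p m hm) (ochart p (i, b))
      (fun v => param p (i, b) (polarSpinor p i j b v)) v ν = 0 := by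
  have hdom := h.coordDom_polarSpinor hv
  have hne := polarSpinor_ne_zero p hij b hv
  have hf := (contDiffOn_polarSpinor p i j b).contDiffAt ((isOpen_polarStrip _).mem_nhds hv)
  have hlin : ∀ k : ℂ, smoothForm p m (i, b) (polarSpinor p i j b v)
      (k • polarSpinor p i j b v) ν = 0 := by
    intro k
    have : k • polarSpinor p i j b v =
        k.re • polarSpinor p i j b v + k.im • Complex.I • polarSpinor p i j b v := by
      conv_lhs => rw [← Complex.re_add_im k]
      rw [add_smul, mul_smul]
      rfl
    rw [this]
    simp [h1, h2]
  have hsec : ∀ a a' : ℝ × ℝ, secondForm (metric p m hm) (ochart p (i, b))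
      (fun v => param p (i, b) (polarSpinor p i j b v)) v a a' ν =
      chartGamma p m (i, b) (polarSpinor p i j b v) (fderiv ℝ (polarSpinor p i j b) v a)
        (fderiv ℝ (polarSpinor p i j b) v a') ν := by
    intro a a'
    obtain ⟨k, hk⟩ := exists_fderiv_fderiv_polarSpinor p b hv a a'
    rw [secondForm_param_comp hm hf.continuousAt hdom, hk, hlin, zero_add]
    rfl
  have e1 : fderiv ℝ (polarSpinor p i j b) v (1, 0) =
      (1 / (2 * v.1)) • polarSpinor p i j b v := by
    rw [fderiv_polarSpinor p b hv, polarLog]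
    simp only [Complex.ofReal_zero, zero_mul, add_zero]
    rfl
  have e2 : fderiv ℝ (polarSpinor p i j b) v (0, 1) =
      Complex.I • polarSpinor p i j b v := by
    rw [fderiv_polarSpinor p b hv, polarLog]
    simp
  have key := trace_chartGamma_eq_zero p hm hdom hne h1 h2
  rw [meanCurvature, div_eq_zero_iff]
  left
  simp only [hsec, inducedMetric_param_comp hm hf hdom, e1, e2]
  simp only [chartGamma, map_smul, smul_apply, smul_eq_mul] at key ⊢
  -- Each term of the trace is quadratic in the first tangent vector, so passing from `u` to `u / (2
  -- s)` costs the square of the factor.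
  linear_combination (1 / (2 * v.1)) ^ 2 * key

/-- The metric coefficient `1 / φ` along the segment. -/
lemma brioschi_polarSpinor {m : ℝ} (hm : 0 ≤ m) {i j : ι} (hij : i ≠ j) {b : ι → Bool}
    (h : SegDom p i j b) {v : ℝ × ℝ} (hv : v ∈ polarStrip (dist (p i) (p j))) :
    brioschi
      (inducedMetric (metric p m hm) (fun v => param p (i, b) (polarSpinor p i j b v)) (1, 0) (1, 0))
      (inducedMetric (metric p m hm) (fun v => param p (i, b) (polarSpinor p i j b v)) (1, 0) (0, 1))
      (inducedMetric (metric p m hm) (fun v => param p (i, b) (polarSpinor p i j b v)) (0, 1) (0, 1))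
      v = -deriv (deriv fun s => (phi p m (p i + (s / dist (p i) (p j)) • (p j - p i)))⁻¹) v.1 / 2 := by
  set L := dist (p i) (p j) with hL
  set f := polarSpinor p i j b with hf
  set Φ : ℝ → ℝ := fun s => phi p m (p i + (s / L) • (p j - p i)) with hΦ
  -- The value of `η` on `∂s`, taken at `θ = 0`. By circle invariance it does not depend on `θ`; it
  -- need not vanish, since the chosen sections need not be horizontal along the segment.
  set α : ℝ → ℝ := fun s => etaForm p (i, b) (f (s, 0)) ((1 / (2 * s)) • f (s, 0)) with hα
  have hstrip : ∀ s ∈ Set.Ioo 0 L, ∀ θ, ((s, θ) : ℝ × ℝ) ∈ polarStrip L := fun s hs θ => hs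
  have hphi : ∀ v ∈ polarStrip L, chartPhi p m (i, b) (f v) = Φ v.1 := by
    intro v hv
    rw [chartPhi, hopf_polarSpinor p b hv]
  have hfat : ∀ v ∈ polarStrip L, ContDiffAt ℝ ∞ f v := fun v hv =>
    (contDiffOn_polarSpinor p i j b).contDiffAt ((isOpen_polarStrip _).mem_nhds hv)
  have hf0 : ∀ s ∈ Set.Ioo 0 L, ContDiffAt ℝ ∞ (fun s : ℝ => f (s, 0)) s := fun s hs =>
    (hfat _ (hstrip s hs 0)).comp s (contDiffAt_id.prodMk contDiffAt_const)
  have cΦ : ContDiffOn ℝ ∞ Φ (Set.Ioo 0 L) := by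
    intro s hs
    have h1 : ContDiffAt ℝ ∞ (fun s : ℝ => chartPhi p m (i, b) (f (s, 0))) s :=
      ContDiffAt.comp (g := chartPhi p m (i, b)) s
        (contDiffAt_chartPhi p m (h.coordDom_polarSpinor (hstrip s hs 0))
          (polarSpinor_ne_zero p hij b (hstrip s hs 0))) (hf0 s hs)
    refine (h1.congr_of_eventuallyEq ?_).contDiffWithinAt
    filter_upwards [isOpen_Ioo.mem_nhds hs] with z hz
    exact (hphi _ (hstrip z hz 0)).symm
  have cα : ContDiffOn ℝ ∞ α (Set.Ioo 0 L) := by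
    intro s hs
    have h1 : ContDiffAt ℝ ∞ (fun s : ℝ => etaForm p (i, b) (f (s, 0))) s :=
      ContDiffAt.comp (g := etaForm p (i, b)) s
        (contDiffAt_etaForm p (h.coordDom_polarSpinor (hstrip s hs 0))
          (polarSpinor_ne_zero p hij b (hstrip s hs 0))) (hf0 s hs)
    have h2 : ContDiffAt ℝ ∞ (fun s : ℝ => 1 / (2 * s)) s :=
      contDiffAt_const.div (contDiffAt_const.mul contDiffAt_id) (by simpa using hs.1.ne')
    exact (h1.clm_apply (h2.smul (hf0 s hs))).contDiffWithinAt
  have hΦpos : ∀ s ∈ Set.Ioo 0 L, 0 < Φ s := by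
    intro s hs
    rw [← hphi (s, 0) (hstrip s hs 0)]
    exact chartPhi_pos p hm (polarSpinor_ne_zero p hij b (hstrip s hs 0))
  have e1 : ∀ v ∈ polarStrip L, fderiv ℝ f v (1, 0) = (1 / (2 * v.1)) • f v := by
    intro v hv
    rw [hf, fderiv_polarSpinor p b hv, polarLog]
    simp only [Complex.ofReal_zero, zero_mul, add_zero]
    rfl
  have e2 : ∀ v ∈ polarStrip L, fderiv ℝ f v (0, 1) = Complex.I • f v := by
    intro v hv
    rw [hf, fderiv_polarSpinor p b hv, polarLog]
    simp
  have hαv : ∀ v ∈ polarStrip L, etaForm p (i, b) (f v) ((1 / (2 * v.1)) • f v) = α v.1 := by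
    intro v hv
    have h1 : f v = Complex.exp (v.2 * Complex.I) • f (v.1, 0) := by
      simp only [hf, polarSpinor, polarCoord, smul_smul]
      congr 1
      simp
      ring
    rw [h1, smul_comm, etaForm_smul p (h.coordDom_polarSpinor (hstrip v.1 hv 0))
      (Complex.norm_exp_ofReal_mul_I _)]
  -- The projection of `∂s` is a unit vector: the coordinate `s` is Euclidean arclength.
  have hd1 : ∀ v ∈ polarStrip L, inner ℝ (dhopf (f v) ((1 / (2 * v.1)) • f v))
      (dhopf (f v) ((1 / (2 * v.1)) • f v)) = (1 : ℝ) := by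
    intro v hv
    have h1 : hin (f v) (f v) = 2 * v.1 := by
      have h2 := norm_hopf (f v)
      have h3 := hv.1
      have h4 : 0 < L := hv.1.trans hv.2
      rw [hf, hopf_polarSpinor p b hv, norm_smul, ← dist_eq_norm, dist_comm (p j), ← hL,
        Real.norm_of_nonneg (by positivity), div_mul_cancel₀ _ h4.ne'] at h2
      rw [hf]
      linarith
    rw [inner_dhopf]
    simp only [map_smul, smul_apply, smul_eq_mul, h1, hin_I_smul_self]
    have := hv.1.ne'
    field_simp
    ring
  have hI : ∀ v ∈ polarStrip L, etaForm p (i, b) (f v) (Complex.I • f v) = 1 := fun v hv =>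
    etaForm_I_smul p (h.coordDom_polarSpinor hv) (polarSpinor_ne_zero p hij b hv)
  have hform : ∀ v ∈ polarStrip L, ∀ a a' : ℝ × ℝ,
      inducedMetric (metric p m hm) (fun v => param p (i, b) (f v)) a a' v =
      (Φ v.1)⁻¹ * (etaForm p (i, b) (f v) (fderiv ℝ f v a) * etaForm p (i, b) (f v) (fderiv ℝ f v a')) +
      Φ v.1 * inner ℝ (dhopf (f v) (fderiv ℝ f v a)) (dhopf (f v) (fderiv ℝ f v a')) := by
    intro v hv a a'
    rw [inducedMetric_param_comp hm (hfat v hv) (h.coordDom_polarSpinor hv),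
      smoothForm_apply p hm (h.coordDom_polarSpinor hv) (polarSpinor_ne_zero p hij b hv), hphi v hv]
  have cΦi : ContDiffOn ℝ ∞ (fun s => (Φ s)⁻¹) (Set.Ioo 0 L) :=
    cΦ.inv fun s hs => (hΦpos s hs).ne'
  -- These are the coefficients of `Φ⁻¹ (dθ + α ds)² + Φ ds²`; the determinant is one, and `α` drops
  -- out of the curvature.
  refine brioschi_of_eq_fst (e := fun s => (Φ s)⁻¹ * α s ^ 2 + Φ s) (f := fun s => (Φ s)⁻¹ * α s)
    isOpen_Ioo ((cΦi.mul (cα.pow 2)).add cΦ) (cΦi.mul cα) cΦi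
    (fun v hv => ?_) (fun v hv => ?_) (fun v hv => ?_) (fun s hs => ?_) hv
  · rw [hform v hv, e1 v hv, hαv v hv, hd1 v hv]; ring
  · rw [hform v hv, e1 v hv, e2 v hv, hαv v hv, hI v hv, dhopf_I_smul_self, inner_zero_right]; ring
  · rw [hform v hv, e2 v hv, hI v hv, dhopf_I_smul_self, inner_zero_right]; ring
  · have := (hΦpos s hs).ne'
    field_simp
    ring

end
end GibbonsHawking

namespace GibbonsHawking

noncomputable section

/-! The preimage of a segment at an endpoint. -/

/-! ### Two-jets of functions in quadratic form. -/

section Quadratic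

lemma pd1_of_hasFDerivAt {H : ℝ × ℝ → ℝ} {H' : ℝ × ℝ →L[ℝ] ℝ} {v : ℝ × ℝ} (h : HasFDerivAt H H' v) :
    pd1 H v = H' (1, 0) := by rw [pd1, h.fderiv]

lemma pd2_of_hasFDerivAt {H : ℝ × ℝ → ℝ} {H' : ℝ × ℝ →L[ℝ] ℝ} {v : ℝ × ℝ} (h : HasFDerivAt H H' v) :
    pd2 H v = H' (0, 1) := by rw [pd2, h.fderiv]

/-- The one-jet at the origin of a function that vanishes there. -/
lemma hasFDerivAt_linear {A B : ℝ × ℝ → ℝ} (hA : DifferentiableAt ℝ A 0) (hB : DifferentiableAt ℝ B 0) :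
    HasFDerivAt (fun v : ℝ × ℝ => v.1 * A v + v.2 * B v)
      (A 0 • ContinuousLinearMap.fst ℝ ℝ ℝ + B 0 • ContinuousLinearMap.snd ℝ ℝ ℝ) 0 := by
  have h : HasFDerivAt (fun v : ℝ × ℝ => v.1 * A v + v.2 * B v) _ 0 := ((hasFDerivAt_fst (𝕜 := ℝ) (E := ℝ) (F := ℝ) (p := 0)).mul hA.hasFDerivAt).add
    ((hasFDerivAt_snd (𝕜 := ℝ) (E := ℝ) (F := ℝ) (p := 0)).mul hB.hasFDerivAt)
  convert! h using 1
  simp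

variable {H a b c : ℝ × ℝ → ℝ} {k : ℝ}

/-- Holds near the origin and not just at it, in the shape `v.1 * A v + v.2 * B v`, so that
`hasFDerivAt_linear` then gives the second derivatives. -/
lemma pd1_quadratic (ha : ContDiffAt ℝ ∞ a 0) (hb : ContDiffAt ℝ ∞ b 0) (hc : ContDiffAt ℝ ∞ c 0)
    (hH : ∀ᶠ v in 𝓝 (0 : ℝ × ℝ), H v = k + v.1 ^ 2 * a v + v.1 * v.2 * b v + v.2 ^ 2 * c v) :
    pd1 H =ᶠ[𝓝 0] (fun v => v.1 * (2 * a v + v.1 * pd1 a v) + v.2 * (b v + v.1 * pd1 b v + v.2 * pd1 c v))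
    ∧ pd2 H =ᶠ[𝓝 0]
      (fun v => v.1 * (b v + v.1 * pd2 a v + v.2 * pd2 b v) + v.2 * (2 * c v + v.2 * pd2 c v)) := by
  have hev : ∀ {f : ℝ × ℝ → ℝ}, ContDiffAt ℝ ∞ f 0 → ∀ᶠ v in 𝓝 (0 : ℝ × ℝ), DifferentiableAt ℝ f v := by
    intro f hf
    have h1 : ContDiffAt ℝ 1 f 0 := hf.of_le (by simp)
    exact (h1.eventually (by simp)).mono fun v hv => hv.differentiableAt (by simp)
  have key : ∀ᶠ v in 𝓝 (0 : ℝ × ℝ), HasFDerivAt H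
      ((v.1 ^ 2 • fderiv ℝ a v + (2 * v.1 * a v) • ContinuousLinearMap.fst ℝ ℝ ℝ) +
      ((v.1 * v.2) • fderiv ℝ b v + b v • (v.1 • ContinuousLinearMap.snd ℝ ℝ ℝ +
        v.2 • ContinuousLinearMap.fst ℝ ℝ ℝ)) +
      (v.2 ^ 2 • fderiv ℝ c v + (2 * v.2 * c v) • ContinuousLinearMap.snd ℝ ℝ ℝ)) v := by
    filter_upwards [hev ha, hev hb, hev hc, hH.eventually_nhds] with v h1 h2 h3 h4
    have hx : HasFDerivAt (fun v : ℝ × ℝ => v.1) (ContinuousLinearMap.fst ℝ ℝ ℝ) v := hasFDerivAt_fst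
    have hy : HasFDerivAt (fun v : ℝ × ℝ => v.2) (ContinuousLinearMap.snd ℝ ℝ ℝ) v := hasFDerivAt_snd
    have h5 := ((((hx.pow 2).mul h1.hasFDerivAt).const_add k).add ((hx.mul hy).mul h2.hasFDerivAt)).add
      ((hy.pow 2).mul h3.hasFDerivAt)
    refine HasFDerivAt.congr_of_eventuallyEq ?_ h4
    convert! h5 using 1
    ext <;> simp <;> ring
  constructor
  · filter_upwards [key] with v hv
    rw [pd1_of_hasFDerivAt hv]
    simp [pd1]
    ring
  · filter_upwards [key] with v hv
    rw [pd2_of_hasFDerivAt hv]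
    simp [pd2]
    ring

/-- The two-jet at the origin of a function in quadratic form. -/
lemma jet_quadratic (ha : ContDiffAt ℝ ∞ a 0) (hb : ContDiffAt ℝ ∞ b 0) (hc : ContDiffAt ℝ ∞ c 0)
    (hH : ∀ᶠ v in 𝓝 (0 : ℝ × ℝ), H v = k + v.1 ^ 2 * a v + v.1 * v.2 * b v + v.2 ^ 2 * c v) :
    H 0 = k ∧ pd1 H 0 = 0 ∧ pd2 H 0 = 0 ∧ pd1 (pd1 H) 0 = 2 * a 0 ∧ pd2 (pd1 H) 0 = b 0 ∧
      pd2 (pd2 H) 0 = 2 * c 0 := by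
  obtain ⟨h1, h2⟩ := pd1_quadratic ha hb hc hH
  have hpd1 : ∀ {f : ℝ × ℝ → ℝ}, ContDiffAt ℝ ∞ f 0 → DifferentiableAt ℝ (pd1 f) 0 := fun hf =>
    ((hf.fderiv_right (m := ∞) (by simp)).clm_apply contDiffAt_const).differentiableAt (by simp)
  have hpd2 : ∀ {f : ℝ × ℝ → ℝ}, ContDiffAt ℝ ∞ f 0 → DifferentiableAt ℝ (pd2 f) 0 := fun hf =>
    ((hf.fderiv_right (m := ∞) (by simp)).clm_apply contDiffAt_const).differentiableAt (by simp)
  have da := ha.differentiableAt (by simp)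
  have db := hb.differentiableAt (by simp)
  have dc := hc.differentiableAt (by simp)
  have dx : DifferentiableAt ℝ (fun v : ℝ × ℝ => v.1) 0 := differentiableAt_fst
  have dy : DifferentiableAt ℝ (fun v : ℝ × ℝ => v.2) 0 := differentiableAt_snd
  have h3 := (hasFDerivAt_linear ((da.const_mul 2).fun_add (dx.fun_mul (hpd1 ha)))
    ((db.fun_add (dx.fun_mul (hpd1 hb))).fun_add (dy.fun_mul (hpd1 hc)))).congr_of_eventuallyEq h1
  have h4 := (hasFDerivAt_linear ((db.fun_add (dx.fun_mul (hpd2 ha))).fun_add (dy.fun_mul (hpd2 hb)))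
    ((dc.const_mul 2).fun_add (dy.fun_mul (hpd2 hc)))).congr_of_eventuallyEq h2
  refine ⟨?_, ?_, ?_, ?_, ?_, ?_⟩
  · rw [hH.self_of_nhds]; simp
  · rw [h1.self_of_nhds]; simp
  · rw [h2.self_of_nhds]; simp
  · rw [pd1_of_hasFDerivAt h3]; simp
  · rw [pd2_of_hasFDerivAt h3]; simp
  · rw [pd2_of_hasFDerivAt h4]; simp

end Quadratic

/-! ### The metric near a fixed point and on a complex line through it. -/

variable {ι : Type*} [Fintype ι] [DecidableEq ι] [Nonempty ι] (p : ι ↪ E3)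

/-- The component along `hopf w` of the part of the connection form that is pulled back
from the base. -/
def etaBase (c : ChartIndex ι) (w u : C2) : ℝ :=
  ∑ j ∈ Finset.univ.erase c.1, hopfConn (lift p c u j)
    (fderiv ℝ (sec (c.2 j)) (p c.1 + hopf u - p j) (hopf w))

lemma contDiffAt_etaBase {c : ChartIndex ι} (w : C2) {u : C2} (h : coordDom c (lift p c u)) :
    ContDiffAt ℝ ∞ (etaBase p c w) u := by
  unfold etaBase
  refine ContDiffAt.sum fun j hj => ?_
  have hj' := Finset.ne_of_mem_erase hj
  have h1 := contDiffAt_lift p h j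
  have h2 := (contDiffAt_hopfConn (lift_ne_zero p h hj')).comp u h1
  have h3 : ContDiffAt ℝ ∞ (fun u => p c.1 + hopf u - p j) u :=
    (contDiffAt_const.add contDiff_hopf.contDiffAt).sub contDiffAt_const
  have h4 := contDiffAt_sec _ _ ((coordDom_lift_iff p c u).1 h j hj')
  have h5 : ContDiffAt ℝ ∞ (fun u => fderiv ℝ (sec (c.2 j)) (p c.1 + hopf u - p j)) u :=
    ContDiffAt.comp (g := fderiv ℝ (sec (c.2 j))) u (h4.fderiv_right (m := ∞) (by simp)) h3
  exact h2.clm_apply (h5.clm_apply contDiffAt_const)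

/-- The regular part of `η` is pulled back along `hopf`, which maps the complex line to a ray; its
differential there only sees `2 Re (conj z * a)`. -/
lemma etaReg_smul_smul {c : ChartIndex ι} {w : C2} {z : ℂ} (h : coordDom c (lift p c (z • w))) (a : ℂ) :
    etaReg p c (z • w) (a • w) = 2 * (starRingEnd ℂ z * a).re * etaBase p c w (z • w) := by
  simp only [etaReg, etaBase, sum_apply, ContinuousLinearMap.comp_apply, Finset.mul_sum]
  refine Finset.sum_congr rfl fun j hj => ?_
  have hj' := Finset.ne_of_mem_erase hj
  have h1 : (fun u => lift p c u j) = sec (c.2 j) ∘ fun u => p c.1 + hopf u - p j := by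
    funext u; simp [lift, hj']
  have h3 : HasFDerivAt (fun u => p c.1 + hopf u - p j) (fderiv ℝ hopf (z • w)) (z • w) :=
    (((contDiff_hopf.differentiable (by simp)).differentiableAt).hasFDerivAt.const_add _).sub_const _
  have h4 := ((contDiffAt_sec _ _ ((coordDom_lift_iff p c _).1 h j hj')).differentiableAt
    (by simp)).hasFDerivAt.comp (z • w) h3
  rw [h1, h4.fderiv, ContinuousLinearMap.comp_apply, fderiv_hopf, dhopf_smul_smul]
  simp only [map_smul, smul_eq_mul]

/-- The metric on a complex line through the origin. -/
lemma smoothForm_smul_smul (m : ℝ) {c : ChartIndex ι} {w : C2} {z : ℂ}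
    (h : coordDom c (lift p c (z • w))) (a a' : ℂ) :
    smoothForm p m c (z • w) (a • w) (a' • w) =
      (1 + phiReg p m c (z • w) * (‖z‖ ^ 2 * hin w w)) * ((starRingEnd ℂ a * a').re * hin w w)
      - phiReg p m c (z • w) * (((starRingEnd ℂ z * a).im * hin w w) *
          ((starRingEnd ℂ z * a').im * hin w w))
      + (1 + ‖z‖ ^ 2 * hin w w * phiReg p m c (z • w))⁻¹ *
        (((starRingEnd ℂ z * a).im * hin w w) *
            (2 * (starRingEnd ℂ z * a').re * etaBase p c w (z • w))
          + (2 * (starRingEnd ℂ z * a).re * etaBase p c w (z • w)) *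
            ((starRingEnd ℂ z * a').im * hin w w)
          + ‖z‖ ^ 2 * hin w w * ((2 * (starRingEnd ℂ z * a).re * etaBase p c w (z • w)) *
            (2 * (starRingEnd ℂ z * a').re * etaBase p c w (z • w)))
          - phiReg p m c (z • w) * (((starRingEnd ℂ z * a).im * hin w w) *
            ((starRingEnd ℂ z * a').im * hin w w))) := by
  have h1 : hin (a • w) (a' • w) = (starRingEnd ℂ a * a').re * hin w w := by
    simp [hin_eq]; ring
  simp only [smoothForm, add_apply, sub_apply, smul_apply, ContinuousLinearMap.smulRight_apply,
    smul_eq_mul, etaReg_smul_smul p h, hin_I_smul_smul, h1, hin_smul_smul]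

/-- The derivative of the metric vanishes at the fixed points. -/
lemma fderiv_smoothForm_zero {m : ℝ} (hm : 0 ≤ m) {c : ChartIndex ι} (h : coordDom c (lift p c 0)) :
    fderiv ℝ (smoothForm p m c) 0 = 0 := by
  -- The element `-1` of the circle acts by `u ↦ -u`, so the coefficients of the metric are even,
  -- and the derivative of an even function vanishes at the origin.
  have h1 : (fun u => smoothForm p m c (-u)) =ᶠ[𝓝 0] smoothForm p m c := by
    filter_upwards [(isOpen_coordDom p c).mem_nhds h] with u hu
    by_cases hu0 : u = 0
    · simp [hu0]
    · have hneg : -u = (-1 : ℂ) • u := by simp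
      have hn : ‖(-1 : ℂ)‖ = 1 := by simp
      have hu' : coordDom c (lift p c (-u)) := by rw [hneg, coordDom_lift_smul p hn]; exact hu
      have hη : ∀ v, etaForm p c (-u) v = -etaForm p c u v := by
        intro v
        rw [← etaForm_smul p hu' hn]
        simp
      have hd : ∀ v, dhopf (-u) v = -dhopf u v := by
        intro v
        have := dhopf_smul v u (-1)
        simp only [neg_smul, one_smul] at this
        rw [dhopf_comm, this, dhopf_comm]
      refine ContinuousLinearMap.ext fun v => ContinuousLinearMap.ext fun w => ?_
      have hphi : chartPhi p m c (-u) = chartPhi p m c u := by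
        rw [chartPhi, hneg, hopf_smul _ hn, chartPhi]
      rw [smoothForm_apply p hm hu' (neg_ne_zero.2 hu0), smoothForm_apply p hm hu hu0, hη, hη, hd, hd,
        hphi, inner_neg_neg, neg_mul_neg]
  have h2 := ((contDiffAt_smoothForm p hm h).differentiableAt (by simp)).hasFDerivAt
  have h3 : HasFDerivAt (fun u : C2 => -u) (-ContinuousLinearMap.id ℝ C2) 0 :=
    (hasFDerivAt_id (𝕜 := ℝ) (0 : C2)).fun_neg
  have h4 := HasFDerivAt.comp (g := smoothForm p m c) (f := fun u => -u) (0 : C2)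
    (by rw [neg_zero]; exact h2) h3
  have h5 := (h4.congr_of_eventuallyEq h1.symm).unique h2
  refine ContinuousLinearMap.ext fun a => ContinuousLinearMap.ext fun v =>
    ContinuousLinearMap.ext fun w => ?_
  have h6 := congrArg (fun L : C2 →L[ℝ] C2 →L[ℝ] C2 →L[ℝ] ℝ => L a v w) h5
  simp only [ContinuousLinearMap.comp_apply, neg_apply, ContinuousLinearMap.id_apply, map_neg] at h6
  simp only [zero_apply]
  linarith

/-! ### The surface patch around a pole. -/

/-- The coordinate `x + i y`. -/
def cartesianCoord : ℝ × ℝ →L[ℝ] ℂ := Complex.equivRealProdCLM.symm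

lemma cartesianCoord_apply (v : ℝ × ℝ) : cartesianCoord v = ⟨v.1, v.2⟩ := rfl

/-- The parametrization of the preimage of the segment from `p i` to `p j` near `p i`, in the chart
with index `(i, b)`. -/
def tipSpinor (i j : ι) (b : ι → Bool) (v : ℝ × ℝ) : C2 := cartesianCoord v • spinor p i j b

lemma fderiv_tipSpinor (i j : ι) (b : ι → Bool) (v a : ℝ × ℝ) :
    fderiv ℝ (tipSpinor p i j b) v a = cartesianCoord a • spinor p i j b := by
  have h2 := (cartesianCoord.hasFDerivAt (x := v)).smul_const (spinor p i j b)
  change fderiv ℝ (fun v => cartesianCoord v • spinor p i j b) v a = _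
  rw [h2.fderiv]
  simp

lemma contDiff_tipSpinor (i j : ι) (b : ι → Bool) : ContDiff ℝ ∞ (tipSpinor p i j b) :=
  cartesianCoord.contDiff.smul contDiff_const

/-- The unit disk. -/
def tipDisk : Set (ℝ × ℝ) := {v | ‖cartesianCoord v‖ < 1}

lemma isOpen_tipDisk : IsOpen tipDisk :=
  isOpen_lt (continuous_norm.comp cartesianCoord.continuous) continuous_const

lemma zero_mem_tipDisk : (0 : ℝ × ℝ) ∈ tipDisk := by simp [tipDisk]

lemma tipSpinor_zero (i j : ι) (b : ι → Bool) : tipSpinor p i j b 0 = 0 := by simp [tipSpinor]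

variable {p}

lemma SegDom.coordDom_tipSpinor {i j : ι} {b : ι → Bool} (h : SegDom p i j b) {v : ℝ × ℝ}
    (hv : v ∈ tipDisk) : GibbonsHawking.coordDom (i, b) (lift p (i, b) (tipSpinor p i j b v)) :=
  h.coordDom hv

lemma SegDom.isSurfacePatch_tipSpinor {i j : ι} (hij : i ≠ j) {b : ι → Bool} (h : SegDom p i j b) :
    IsSurfacePatch (E := C2) (proj p ⁻¹' segment ℝ (p i) (p j)) tipDisk
      (fun v => param p (i, b) (tipSpinor p i j b v)) := by
  refine isSurfacePatch_param_comp isOpen_tipDisk (contDiff_tipSpinor p i j b).contDiffOn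
    (fun v hv => h.coordDom_tipSpinor hv) (fun v hv => ?_) (fun v hv => ?_)
  · rw [injective_iff_map_eq_zero]
    intro a ha
    rw [fderiv_tipSpinor, smul_eq_zero] at ha
    exact Complex.equivRealProdCLM.symm.injective
      ((ha.resolve_right (spinor_ne_zero p hij b)).trans (map_zero _).symm)
  · rw [tipSpinor, hopf_smul_spinor, segment_eq_image']
    have hv' : ‖cartesianCoord v‖ < 1 := hv
    exact ⟨_, ⟨by positivity, by nlinarith [norm_nonneg (cartesianCoord v)]⟩, rfl⟩

lemma SegDom.param_tipSpinor_zero {i j : ι} {b : ι → Bool} (h : SegDom p i j b) {x : Space p}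
    (hx : proj p x = p i) : param p (i, b) (tipSpinor p i j b 0) = x := by
  obtain ⟨z, hz, rfl⟩ := h.exists_param le_rfl zero_lt_one (x := x) (by rw [hx]; simp)
  have : z = 0 := by simpa using hz
  rw [tipSpinor_zero, this, zero_smul]

/-- The patch is linear in the chart and the Christoffel symbols vanish at its centre, so the whole
second form is zero, not just its trace. -/
lemma meanCurvature_tipSpinor {m : ℝ} (hm : 0 ≤ m) {i j : ι} {b : ι → Bool} (h : SegDom p i j b)
    (ν : C2) : meanCurvature (metric p m hm) (ochart p (i, b))
      (fun v => param p (i, b) (tipSpinor p i j b v)) 0 ν = 0 := by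
  have hdom := h.coordDom_tipSpinor zero_mem_tipDisk
  have hsec : ∀ a a' : ℝ × ℝ, secondForm (metric p m hm) (ochart p (i, b))
      (fun v => param p (i, b) (tipSpinor p i j b v)) 0 a a' ν = 0 := by
    intro a a'
    have h0 := fderiv_smoothForm_zero p hm (c := (i, b)) (by rwa [tipSpinor_zero] at hdom)
    rw [secondForm_param_comp hm (contDiff_tipSpinor p i j b).continuous.continuousAt hdom,
      tipSpinor_zero, h0]
    simp only [fderiv_tipSpinor]
    simp
  simp [meanCurvature, hsec]

/-- The value is the limit of `-(1 / (2 φ))''` at the pole: with `φ = 1 / (2 s) + phiReg`, one has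
`1 / (2 φ) = s - 2 s² phiReg + O(s³)`. -/
lemma brioschi_tipSpinor {m : ℝ} (hm : 0 ≤ m) {i j : ι} (hij : i ≠ j) {b : ι → Bool}
    (h : SegDom p i j b) :
    brioschi
      (inducedMetric (metric p m hm) (fun v => param p (i, b) (tipSpinor p i j b v)) (1, 0) (1, 0))
      (inducedMetric (metric p m hm) (fun v => param p (i, b) (tipSpinor p i j b v)) (1, 0) (0, 1))
      (inducedMetric (metric p m hm) (fun v => param p (i, b) (tipSpinor p i j b v)) (0, 1) (0, 1))
      0 = 4 * phiReg p m (i, b) 0 := by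
  set f := tipSpinor p i j b with hf
  set κ := hin (spinor p i j b) (spinor p i j b) with hκ
  have hκ0 : κ ≠ 0 := (hin_self_pos (spinor_ne_zero p hij b)).ne'
  set ψ : ℝ × ℝ → ℝ := fun v => phiReg p m (i, b) (f v) with hψ
  set A : ℝ × ℝ → ℝ := fun v => etaBase p (i, b) (spinor p i j b) (f v) with hA
  set D : ℝ × ℝ → ℝ := fun v => (1 + (v.1 ^ 2 + v.2 ^ 2) * κ * ψ v)⁻¹ with hD
  have hdom := h.coordDom_tipSpinor zero_mem_tipDisk
  have cf : ContDiffAt ℝ ∞ f 0 := (contDiff_tipSpinor p i j b).contDiffAt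
  have cψ : ContDiffAt ℝ ∞ ψ 0 :=
    ContDiffAt.comp (g := phiReg p m (i, b)) 0 (contDiffAt_phiReg p m hdom) cf
  have cA : ContDiffAt ℝ ∞ A 0 :=
    ContDiffAt.comp (g := etaBase p (i, b) (spinor p i j b)) 0 (contDiffAt_etaBase p _ hdom) cf
  have cn : ContDiffAt ℝ ∞ (fun v : ℝ × ℝ => v.1 ^ 2 + v.2 ^ 2) 0 :=
    (contDiffAt_fst.pow 2).add (contDiffAt_snd.pow 2)
  have cD : ContDiffAt ℝ ∞ D 0 :=
    (contDiffAt_const.add ((cn.mul contDiffAt_const).mul cψ)).inv (by simp)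
  have hD0 : D 0 = 1 := by simp [hD]
  have hform : ∀ a a' : ℝ × ℝ, ∀ᶠ v in 𝓝 (0 : ℝ × ℝ),
      inducedMetric (metric p m hm) (fun v => param p (i, b) (f v)) a a' v =
      (1 + ψ v * ((v.1 ^ 2 + v.2 ^ 2) * κ)) * ((a.1 * a'.1 + a.2 * a'.2) * κ)
      - ψ v * (((v.1 * a.2 - v.2 * a.1) * κ) * ((v.1 * a'.2 - v.2 * a'.1) * κ))
      + D v * (((v.1 * a.2 - v.2 * a.1) * κ) * (2 * (v.1 * a'.1 + v.2 * a'.2) * A v)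
          + (2 * (v.1 * a.1 + v.2 * a.2) * A v) * ((v.1 * a'.2 - v.2 * a'.1) * κ)
          + (v.1 ^ 2 + v.2 ^ 2) * κ * ((2 * (v.1 * a.1 + v.2 * a.2) * A v) *
            (2 * (v.1 * a'.1 + v.2 * a'.2) * A v))
          - ψ v * (((v.1 * a.2 - v.2 * a.1) * κ) * ((v.1 * a'.2 - v.2 * a'.1) * κ))) := by
    intro a a'
    filter_upwards [isOpen_tipDisk.mem_nhds zero_mem_tipDisk] with v hv
    have hv' := h.coordDom_tipSpinor hv
    have hre : ∀ x y : ℝ × ℝ, (starRingEnd ℂ (cartesianCoord x) * cartesianCoord y).re =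
        x.1 * y.1 + x.2 * y.2 := by intro x y; simp [cartesianCoord_apply]
    have him : ∀ x y : ℝ × ℝ, (starRingEnd ℂ (cartesianCoord x) * cartesianCoord y).im =
        x.1 * y.2 - x.2 * y.1 := by intro x y; simp [cartesianCoord_apply]; ring
    have hnorm : ‖cartesianCoord v‖ ^ 2 = v.1 ^ 2 + v.2 ^ 2 := by
      rw [← Complex.normSq_eq_norm_sq, Complex.normSq_apply, cartesianCoord_apply]; ring
    rw [inducedMetric_param_comp hm (contDiff_tipSpinor p i j b).contDiffAt hv', fderiv_tipSpinor,
      fderiv_tipSpinor]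
    change smoothForm p m (i, b) (cartesianCoord v • spinor p i j b) _ _ = _
    rw [smoothForm_smul_smul p m hv']
    simp only [hre, him, hnorm]
    rfl
  -- First derivatives vanish at the origin, so only the `yy` term of the first coefficient, the
  -- `xy` term of the mixed one and the `xx` term of the last one enter the curvature. There the
  -- connection term `A` is absent or comes with the factor `x² + y²`.
  have jE := jet_quadratic
    (H := inducedMetric (metric p m hm) (fun v => param p (i, b) (f v)) (1, 0) (1, 0)) (k := κ)
    (a := fun v => ψ v * κ ^ 2 + 4 * (D v * κ * A v ^ 2 * (v.1 ^ 2 + v.2 ^ 2)))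
    (b := fun v => -4 * (D v * A v * κ)) (c := fun v => -(D v * ψ v * κ ^ 2))
    (by fun_prop) (by fun_prop) (by fun_prop)
    ((hform (1, 0) (1, 0)).mono fun v hv => by rw [hv]; ring)
  have jF := jet_quadratic
    (H := inducedMetric (metric p m hm) (fun v => param p (i, b) (f v)) (1, 0) (0, 1)) (k := 0)
    (a := fun v => 2 * (D v * A v * κ))
    (b := fun v => ψ v * κ ^ 2 + D v * ψ v * κ ^ 2 + 4 * (D v * κ * (v.1 ^ 2 + v.2 ^ 2) * A v ^ 2))
    (c := fun v => -2 * (D v * A v * κ))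
    (by fun_prop) (by fun_prop) (by fun_prop)
    ((hform (1, 0) (0, 1)).mono fun v hv => by rw [hv]; ring)
  have jG := jet_quadratic
    (H := inducedMetric (metric p m hm) (fun v => param p (i, b) (f v)) (0, 1) (0, 1)) (k := κ)
    (a := fun v => -(D v * ψ v * κ ^ 2)) (b := fun v => 4 * (D v * A v * κ))
    (c := fun v => ψ v * κ ^ 2 + 4 * (D v * κ * A v ^ 2 * (v.1 ^ 2 + v.2 ^ 2)))
    (by fun_prop) (by fun_prop) (by fun_prop)
    ((hform (0, 1) (0, 1)).mono fun v hv => by rw [hv]; ring)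
  obtain ⟨e0, e1, e2, -, -, e22⟩ := jE
  obtain ⟨f0, f1, f2, -, f12, -⟩ := jF
  obtain ⟨g0, g1, g2, g11, -, -⟩ := jG
  have hψ0 : ψ 0 = phiReg p m (i, b) 0 := by simp only [hψ, hf, tipSpinor_zero]
  simp only [brioschi, Matrix.det_fin_three, e0, e1, e2, e22, f0, f1, f2, f12, g0, g1, g2, g11, hD0]
  simp [hψ0]
  field_simp
  ring

/-- The charge at `p j` contributes a positive term even when `m = 0`. -/
lemma phiReg_zero_pos {m : ℝ} (hm : 0 ≤ m) {i j : ι} (hij : i ≠ j) (b : ι → Bool) :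
    0 < phiReg p m (i, b) 0 := by
  refine add_pos_of_nonneg_of_pos hm (Finset.sum_pos (fun k hk => ?_)
    ⟨j, Finset.mem_erase.2 ⟨hij.symm, Finset.mem_univ j⟩⟩)
  have : 0 < ‖p i + hopf 0 - p k‖ := by
    rw [hopf_zero, add_zero, norm_pos_iff, sub_ne_zero]
    exact fun h => Finset.ne_of_mem_erase hk (p.injective h).symm
  positivity

end
end GibbonsHawking

namespace GibbonsHawking

noncomputable section

/-! Positivity of the Gauss curvature. -/

/-- The convexity inequality for the potential of two charges at distance `2 d` on a line, perturbed
by further charges at distances `r k` whose projections to the line are at signed distances `a k`. -/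
lemma potential_inequality {κ : Type*} [Fintype κ] {m d x y : ℝ} {r a : κ → ℝ} (hm : 0 ≤ m)
    (hd : 0 < d) (hx : 0 < x) (hy : 0 < y) (hxy : x + y = 4 * d * (x * y)) (hr : ∀ k, 3 * d < r k)
    (ha : ∀ k, a k ^ 2 ≤ r k ^ 2) (hX : ∑ k, 1 / (2 * r k ^ 3) ≤ 16 / 27 / d ^ 3) :
    0 < (m + (x + y + ∑ k, 1 / (2 * r k))) *
        (8 * x ^ 3 + 8 * y ^ 3 + ∑ k, (3 * a k ^ 2 - r k ^ 2) / (2 * r k ^ 5)) -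
      2 * (-2 * x ^ 2 + 2 * y ^ 2 + ∑ k, -a k / (2 * r k ^ 3)) ^ 2 := by
  have hr0 : ∀ k, 0 < r k := fun k => by linarith [hr k]
  set A := x + y with hA
  set D := x - y with hD
  set B := ∑ k, 1 / (2 * r k) with hB
  set B1 := ∑ k, -a k / (2 * r k ^ 3) with hB1
  set B2 := ∑ k, (3 * a k ^ 2 - r k ^ 2) / (2 * r k ^ 5) with hB2
  set X := ∑ k, 1 / (2 * r k ^ 3) with hXdef
  set Y := ∑ k, a k ^ 2 / (2 * r k ^ 5) with hY
  have hApos : 0 < A := by positivity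
  have hBpos : 0 ≤ B := Finset.sum_nonneg fun k _ => by have := hr0 k; positivity
  -- From `A² ≥ 4 x y = A / d`.
  have hA1 : 1 / d ≤ A := by
    rw [div_le_iff₀ hd]
    nlinarith [sq_nonneg (x - y)]
  have hxyA : x * y = A / (4 * d) := by rw [hxy]; field_simp
  have e1 : 8 * x ^ 3 + 8 * y ^ 3 = 8 * A * D ^ 2 + 2 * A ^ 2 / d := by
    have : 2 * A ^ 2 / d = 8 * A * (A / (4 * d)) := by field_simp; ring
    rw [this, ← hxyA, hA, hD]; ring
  have e2 : -2 * x ^ 2 + 2 * y ^ 2 = -2 * A * D := by rw [hA, hD]; ring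
  -- The contribution of the two end charges alone: the dependence on `D` cancels, since `1 / A` is
  -- a quadratic polynomial in arclength.
  have e3 : A * (8 * A * D ^ 2 + 2 * A ^ 2 / d) - 2 * (-2 * A * D) ^ 2 = 2 * A ^ 3 / d := by ring
  have hA2 : 1 / d ^ 3 ≤ A ^ 2 / d := by
    have : 1 / d ^ 3 = (1 / d) ^ 2 / d := by field_simp
    rw [this]
    gcongr
  have hXA : X ≤ 16 / 27 * (A ^ 2 / d) := by
    refine hX.trans ?_
    rw [div_eq_mul_one_div]
    gcongr
  have hB2X : B2 = 3 * Y - X := by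
    rw [hB2, hY, hXdef, Finset.mul_sum, ← Finset.sum_sub_distrib]
    refine Finset.sum_congr rfl fun k _ => ?_
    have := (hr0 k).ne'
    field_simp
  have hY0 : 0 ≤ Y := Finset.sum_nonneg fun k _ => by have := hr0 k; positivity
  -- Cauchy–Schwarz: termwise, the square of the summand of `B1` is the product of the summands of
  -- `B` and `Y`.
  have hcs : B1 ^ 2 ≤ B * Y := by
    refine Finset.sum_sq_le_sum_mul_sum_of_sq_le_mul _ (fun k _ => ?_) (fun k _ => ?_) (fun k _ => ?_)
    · have := hr0 k; positivity
    · have := hr0 k; positivity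
    · have := (hr0 k).ne'
      refine le_of_eq ?_
      field_simp
  have hYX : Y ≤ X := Finset.sum_le_sum fun k _ => by
    have h1 := hr0 k
    rw [div_le_div_iff₀ (by positivity) (by positivity)]
    have := mul_le_mul_of_nonneg_right (ha k) (show 0 ≤ 2 * r k ^ 3 by positivity)
    nlinarith
  -- The cross terms also have to absorb `-B * X`, the worst case for the far charges among
  -- themselves (`h8`). With the weights `1 / (2 r k)` factored out, each summand is a quadratic
  -- form in `a k / r k ^ 2` and `D` plus a remainder.
  have hcross : 0 ≤ A * B2 + (8 * A * D ^ 2 + 2 * A ^ 2 / d) * B - 4 * (-2 * A * D) * B1 - B * X := by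
    have h1 : A * B2 + (8 * A * D ^ 2 + 2 * A ^ 2 / d) * B - 4 * (-2 * A * D) * B1 - B * X =
        ∑ k, 1 / (2 * r k) * (A * (3 * (a k / r k ^ 2) ^ 2 - 8 * D * (a k / r k ^ 2) + 8 * D ^ 2)
          + (2 * (A ^ 2 / d) - A / r k ^ 2 - X)) := by
      rw [hB2, hB, hB1, Finset.mul_sum, Finset.mul_sum, Finset.mul_sum, Finset.sum_mul,
        ← Finset.sum_add_distrib, ← Finset.sum_sub_distrib, ← Finset.sum_sub_distrib]
      refine Finset.sum_congr rfl fun k _ => ?_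
      have := (hr0 k).ne'
      field_simp
      ring
    rw [h1]
    refine Finset.sum_nonneg fun k _ => mul_nonneg (by have := hr0 k; positivity) (add_nonneg ?_ ?_)
    · generalize a k / r k ^ 2 = t
      -- Positive definite, since `8² < 4 * 3 * 8`.
      have : 0 ≤ 3 * t ^ 2 - 8 * D * t + 8 * D ^ 2 := by
        nlinarith [sq_nonneg (3 * t - 4 * D), sq_nonneg D]
      positivity
    -- From `r k > 3 d` and `1 / d ≤ A`. The remainder is then at least `(2 - 1/9 - 16/27) * (A ^ 2
    -- / d)`.
    · have h2 : A / r k ^ 2 ≤ 1 / 9 * (A ^ 2 / d) := by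
        have h3 : 9 * d ^ 2 ≤ r k ^ 2 := by nlinarith [hr k]
        calc A / r k ^ 2 ≤ A / (9 * d ^ 2) := by gcongr
          _ = 1 / 9 * (A * (1 / d) / d) := by field_simp
          _ ≤ 1 / 9 * (A * A / d) := by gcongr
          _ = 1 / 9 * (A ^ 2 / d) := by ring
      have h4 : 0 < A ^ 2 / d := by positivity
      linarith
  rw [e1, e2]
  have hAd : 0 < A ^ 2 / d := by positivity
  -- The mass multiplies `φ''`, which is nonnegative because `B2 ≥ -X` and `X` is less than `2 * A ^
  -- 2 / d`.
  have h5 : 0 ≤ m * (8 * A * D ^ 2 + 2 * A ^ 2 / d + B2) := by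
    refine mul_nonneg hm ?_
    have : 0 ≤ 8 * A * D ^ 2 := by positivity
    have h6 : 2 * A ^ 2 / d = 2 * (A ^ 2 / d) := by ring
    rw [h6, hB2X]
    linarith
  have h7 : 0 < 2 * A ^ 3 / d := by positivity
  have h8 : -(B * X) ≤ B * B2 - 2 * B1 ^ 2 := by
    have h9 := mul_nonneg hBpos hY0
    have h10 : B * (3 * Y - X) = 3 * (B * Y) - B * X := by ring
    rw [hB2X, h10]
    linarith
  clear_value A D B B1 B2 X Y
  have h11 : (m + (A + B)) * (8 * A * D ^ 2 + 2 * A ^ 2 / d + B2) - 2 * (-2 * A * D + B1) ^ 2 =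
      m * (8 * A * D ^ 2 + 2 * A ^ 2 / d + B2) +
      (A * (8 * A * D ^ 2 + 2 * A ^ 2 / d) - 2 * (-2 * A * D) ^ 2) +
      (A * B2 + (8 * A * D ^ 2 + 2 * A ^ 2 / d) * B - 4 * (-2 * A * D) * B1 - B * X) +
      (B * B2 - 2 * B1 ^ 2 + B * X) := by ring
  rw [h11, e3]
  linarith

/-- Turns positivity of the curvature into `f * f2 > 2 * f1 ^ 2`. -/
lemma deriv_deriv_inv {J : Set ℝ} (hJ : IsOpen J) {f f1 f2 : ℝ → ℝ}
    (h1 : ∀ s ∈ J, HasDerivAt f (f1 s) s) (h2 : ∀ s ∈ J, HasDerivAt f1 (f2 s) s)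
    (h0 : ∀ s ∈ J, f s ≠ 0) {s : ℝ} (hs : s ∈ J) :
    deriv (deriv fun s => (f s)⁻¹) s = -(f s * f2 s - 2 * f1 s ^ 2) / f s ^ 3 := by
  have h3 : (deriv fun s => (f s)⁻¹) =ᶠ[𝓝 s] fun s => -f1 s / f s ^ 2 := by
    filter_upwards [hJ.mem_nhds hs] with z hz
    exact ((h1 z hz).fun_inv (h0 z hz)).deriv
  have h4 := (h2 s hs).fun_neg.fun_div ((h1 s hs).fun_pow 2) (pow_ne_zero 2 (h0 s hs))
  rw [h3.deriv_eq, h4.deriv]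
  have := h0 s hs
  field_simp
  push_cast
  ring

/-! ### Derivatives of a Coulomb potential along a line. -/

section Line

variable {V : Type*} [NormedAddCommGroup V] [InnerProductSpace ℝ V] {v e : V}

lemma hasDerivAt_norm_line (he : ‖e‖ = 1) {s : ℝ} (hs : v + s • e ≠ 0) :
    HasDerivAt (fun s : ℝ => ‖v + s • e‖) ((inner ℝ v e + s) / ‖v + s • e‖) s := by
  have h1 : HasDerivAt (fun s : ℝ => v + s • e) e s := by
    simpa using ((hasDerivAt_id s).smul_const e).const_add v
  have h2 := h1.norm_sq.sqrt (by simpa using hs)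
  simp only [Real.sqrt_sq (norm_nonneg _)] at h2
  convert! h2 using 1
  rw [inner_add_left, real_inner_smul_left, real_inner_self_eq_norm_sq, he]
  have := norm_ne_zero_iff.2 hs
  field_simp

lemma hasDerivAt_potential (he : ‖e‖ = 1) {s : ℝ} (hs : v + s • e ≠ 0) :
    HasDerivAt (fun s : ℝ => 1 / (2 * ‖v + s • e‖))
      (-(inner ℝ v e + s) / (2 * ‖v + s • e‖ ^ 3)) s := by
  have h0 := norm_ne_zero_iff.2 hs
  have h1 := (hasDerivAt_const s (1 : ℝ)).fun_div ((hasDerivAt_norm_line he hs).const_mul 2)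
    (mul_ne_zero two_ne_zero h0)
  convert! h1 using 1
  field_simp
  ring

lemma hasDerivAt_potential_deriv (he : ‖e‖ = 1) {s : ℝ} (hs : v + s • e ≠ 0) :
    HasDerivAt (fun s : ℝ => -(inner ℝ v e + s) / (2 * ‖v + s • e‖ ^ 3))
      ((3 * (inner ℝ v e + s) ^ 2 - ‖v + s • e‖ ^ 2) / (2 * ‖v + s • e‖ ^ 5)) s := by
  have h0 := norm_ne_zero_iff.2 hs
  have h1 := ((hasDerivAt_id s).const_add (inner ℝ v e)).fun_neg.fun_div
    (((hasDerivAt_norm_line he hs).fun_pow 3).const_mul 2) (by positivity)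
  convert! h1 using 1
  simp only [id]
  field_simp
  push_cast
  ring

lemma sq_inner_add_le (he : ‖e‖ = 1) (s : ℝ) : (inner ℝ v e + s) ^ 2 ≤ ‖v + s • e‖ ^ 2 := by
  have h1 : inner ℝ v e + s = inner ℝ (v + s • e) e := by
    rw [inner_add_left, real_inner_smul_left, real_inner_self_eq_norm_sq, he]; ring
  rw [h1, sq_le_sq, abs_norm]
  simpa [he] using abs_real_inner_le_norm (v + s • e) e

end Line

/-- Equality holds at `s = 4`; in powers of `s - 4`, the difference `16 (s - 1)³ - 27 s²` has
nonnegative coefficients. -/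
lemma sq_div_cube_le {s : ℝ} (hs : 4 ≤ s) : s ^ 2 / (s - 1) ^ 3 ≤ 16 / 27 := by
  have h1 : 0 < (s - 1) ^ 3 := pow_pos (by linarith) 3
  rw [div_le_div_iff₀ h1 (by norm_num)]
  nlinarith [mul_nonneg (sub_nonneg.2 hs) (sub_nonneg.2 hs),
    mul_nonneg (mul_nonneg (sub_nonneg.2 hs) (sub_nonneg.2 hs)) (sub_nonneg.2 hs)]

/-- Points of the segment from `p 0` to `p 1` are far from the other singular points. -/
lemma lt_norm_sub_of_far {V : Type*} [NormedAddCommGroup V] [NormedSpace ℝ V] {a b c : V} {d s t : ℝ}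
    (hd : 2 * d = dist a b) (h : s * d < dist c (midpoint ℝ a b)) (ht0 : 0 ≤ t) (ht1 : t ≤ 1) :
    (s - 1) * d < ‖a + t • (b - a) - c‖ := by
  have h1 : a + t • (b - a) - midpoint ℝ a b = (t - 1 / 2) • (b - a) := by
    rw [midpoint_eq_smul_add, invOf_eq_inv]
    module
  have h2 : dist (a + t • (b - a)) (midpoint ℝ a b) ≤ d := by
    have h3 : |t - 1 / 2| ≤ 1 / 2 := abs_le.2 ⟨by linarith, by linarith⟩
    rw [dist_eq_norm, h1, norm_smul, Real.norm_eq_abs, ← dist_eq_norm, dist_comm b, ← hd]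
    have h4 : 0 ≤ d := by linarith [dist_nonneg (x := a) (y := b)]
    nlinarith
  have h3 := dist_triangle c (a + t • (b - a)) (midpoint ℝ a b)
  rw [← dist_eq_norm, dist_comm _ c]
  linarith

/-! ### The curvature over the open segment is positive. -/

variable {n : ℕ} {p : Fin (n + 2) ↪ E3} {m d s : ℝ}

lemma neg_deriv_deriv_phi_pos (hm : 0 ≤ m) (hd : 2 * d = dist (p 0) (p 1))
    (hs : max 4 (√((((n + 2 : ℕ) : ℝ) - 2) / 2)) ≤ s)
    (hfar : ∀ i, i ≠ 0 → i ≠ 1 → s * d < dist (p i) (midpoint ℝ (p 0) (p 1))) {t : ℝ}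
    (ht : t ∈ Set.Ioo 0 (dist (p 0) (p 1))) :
    0 < -deriv (deriv fun t => (phi p m (p 0 + (t / dist (p 0) (p 1)) • (p 1 - p 0)))⁻¹) t / 2 := by
  set L := dist (p 0) (p 1) with hL
  have hLpos : 0 < L := ht.1.trans ht.2
  have hdpos : 0 < d := by linarith
  have hs4 : 4 ≤ s := (le_max_left _ _).trans hs
  set e := (1 / L) • (p 1 - p 0) with he
  have hnorm : ‖e‖ = 1 := by
    rw [he, norm_smul, ← dist_eq_norm, dist_comm, ← hL, Real.norm_of_nonneg (by positivity)]
    field_simp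
  have hpt : ∀ t k, p 0 + (t / L) • (p 1 - p 0) - p k = (p 0 - p k) + t • e := by
    intro t k
    rw [he, smul_smul, mul_one_div]
    abel
  have hone : p 0 - p 1 = (-L) • e := by
    rw [he, smul_smul, ← neg_sub (p 1) (p 0), show -L * (1 / L) = -1 by field_simp, neg_one_smul]
  have hnorm0 : ∀ t ∈ Set.Ioo 0 L, ‖(p 0 - p 0) + t • e‖ = t := by
    intro t ht
    rw [sub_self, zero_add, norm_smul, hnorm, mul_one, Real.norm_of_nonneg ht.1.le]
  have hnorm1 : ∀ t ∈ Set.Ioo 0 L, ‖(p 0 - p 1) + t • e‖ = L - t := by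
    intro t ht
    rw [hone, ← add_smul, norm_smul, hnorm, mul_one, Real.norm_of_nonpos (by linarith [ht.2])]
    ring
  have hfar' : ∀ t ∈ Set.Ioo 0 L, ∀ k : Fin n, (s - 1) * d < ‖(p 0 - p k.succ.succ) + t • e‖ := by
    intro t ht k
    rw [← hpt]
    refine lt_norm_sub_of_far hd (hfar _ (Fin.succ_ne_zero _) ?_) (div_pos ht.1 hLpos).le
      ((div_lt_one hLpos).2 ht.2).le
    intro h
    exact Fin.succ_ne_zero k (Fin.succ_injective _ h)
  have hne : ∀ t ∈ Set.Ioo 0 L, ∀ k, (p 0 - p k) + t • e ≠ 0 := by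
    intro t ht k
    rw [← norm_pos_iff]
    refine Fin.cases ?_ (fun k => Fin.cases ?_ (fun k => ?_) k) k
    · rw [hnorm0 t ht]; exact ht.1
    · rw [Fin.succ_zero_eq_one, hnorm1 t ht]; linarith [ht.2]
    · exact lt_trans (mul_pos (by linarith) hdpos) (hfar' t ht k)
  have hphi : ∀ t, phi p m (p 0 + (t / L) • (p 1 - p 0)) =
      m + ∑ k, 1 / (2 * ‖(p 0 - p k) + t • e‖) := by
    intro t
    simp only [phi, hpt]
  set f1 : ℝ → ℝ := fun t => ∑ k, -(inner ℝ (p 0 - p k) e + t) / (2 * ‖(p 0 - p k) + t • e‖ ^ 3) with hf1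
  set f2 : ℝ → ℝ := fun t => ∑ k, (3 * (inner ℝ (p 0 - p k) e + t) ^ 2 - ‖(p 0 - p k) + t • e‖ ^ 2) /
    (2 * ‖(p 0 - p k) + t • e‖ ^ 5) with hf2
  have hpos : ∀ t ∈ Set.Ioo 0 L, 0 < m + ∑ k, 1 / (2 * ‖(p 0 - p k) + t • e‖) := fun t ht =>
    add_pos_of_nonneg_of_pos hm (Finset.sum_pos (fun k _ => by
      have := norm_pos_iff.2 (hne t ht k); positivity) Finset.univ_nonempty)
  have hderiv := deriv_deriv_inv (f := fun t => m + ∑ k, 1 / (2 * ‖(p 0 - p k) + t • e‖))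
    (f1 := f1) (f2 := f2) (isOpen_Ioo (a := 0) (b := L))
    (fun t ht => (HasDerivAt.fun_sum fun k _ => hasDerivAt_potential hnorm (hne t ht k)).const_add m)
    (fun t ht => HasDerivAt.fun_sum fun k _ => hasDerivAt_potential_deriv hnorm (hne t ht k))
    (fun t ht => (hpos t ht).ne') ht
  simp only [hphi]
  rw [hderiv]
  have hin0 : inner ℝ (p 0 - p 0) e + t = t := by simp
  have hin1 : inner ℝ (p 0 - p 1) e + t = -(L - t) := by
    rw [hone, real_inner_smul_left, real_inner_self_eq_norm_sq, hnorm]; ring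
  have ht1 : 0 < L - t := by linarith [ht.2]
  -- The bound `√(n / 2) ≤ s` on the number `n` of further points enters here: each is at distance
  -- more than `(s - 1) d`, so the sum is at most `(n / 2) / ((s - 1) d)³ ≤ s² / ((s - 1) d)³`.
  have hX : ∑ k : Fin n, 1 / (2 * ‖(p 0 - p k.succ.succ) + t • e‖ ^ 3) ≤ 16 / 27 / d ^ 3 := by
    have hn : (n : ℝ) / 2 ≤ s ^ 2 := by
      have h1 : √((n : ℝ) / 2) ≤ s := by
        have := (le_max_right _ _).trans hs
        push_cast at this
        simpa using this
      rwa [Real.sqrt_le_left (by linarith)] at h1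
    have h1 : 0 < (s - 1) * d := mul_pos (by linarith) hdpos
    calc ∑ k : Fin n, 1 / (2 * ‖(p 0 - p k.succ.succ) + t • e‖ ^ 3)
        ≤ ∑ k : Fin n, 1 / (2 * ((s - 1) * d) ^ 3) := by
          refine Finset.sum_le_sum fun k _ => ?_
          have := hfar' t ht k
          gcongr
      _ = (n / 2) / (s - 1) ^ 3 / d ^ 3 := by
          have : s - 1 ≠ 0 := by linarith
          simp only [Finset.sum_const, Finset.card_univ, Fintype.card_fin, nsmul_eq_mul]
          field_simp
      _ ≤ s ^ 2 / (s - 1) ^ 3 / d ^ 3 := by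
          have : 0 < s - 1 := by linarith
          gcongr
      _ ≤ 16 / 27 / d ^ 3 := by
          exact div_le_div_of_nonneg_right (sq_div_cube_le hs4) (by positivity)
  -- Here `x` and `y` are the potentials of the two ends, and `1 / x + 1 / y = 2 L = 4 d` is the
  -- relation between them. The numbers `a k` are the components along the segment of the vectors of
  -- length `r k`.
  have key := potential_inequality (κ := Fin n) (m := m) (d := d) (x := 1 / (2 * t))
    (y := 1 / (2 * (L - t))) (r := fun k => ‖(p 0 - p k.succ.succ) + t • e‖)
    (a := fun k => inner ℝ (p 0 - p k.succ.succ) e + t) hm hdpos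
    (by have := ht.1; positivity) (by positivity)
    (by
      have := ht.1.ne'
      have := ht1.ne'
      have : L = 2 * d := hd.symm
      field_simp
      linarith)
    (fun k => lt_of_le_of_lt (by nlinarith) (hfar' t ht k))
    (fun k => sq_inner_add_le hnorm t) hX
  have s0 : ∑ k, 1 / (2 * ‖(p 0 - p k) + t • e‖) = 1 / (2 * t) + 1 / (2 * (L - t)) +
      ∑ k : Fin n, 1 / (2 * ‖(p 0 - p k.succ.succ) + t • e‖) := by
    rw [Fin.sum_univ_succ, Fin.sum_univ_succ, Fin.succ_zero_eq_one, hnorm0 t ht, hnorm1 t ht]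
    ring
  have s1 : f1 t = -2 * (1 / (2 * t)) ^ 2 + 2 * (1 / (2 * (L - t))) ^ 2 +
      ∑ k : Fin n, -(inner ℝ (p 0 - p k.succ.succ) e + t) /
        (2 * ‖(p 0 - p k.succ.succ) + t • e‖ ^ 3) := by
    rw [hf1]
    simp only
    rw [Fin.sum_univ_succ, Fin.sum_univ_succ, Fin.succ_zero_eq_one, hnorm0 t ht, hnorm1 t ht, hin0,
      hin1]
    have := ht.1.ne'
    field_simp
    ring
  have s2 : f2 t = 8 * (1 / (2 * t)) ^ 3 + 8 * (1 / (2 * (L - t))) ^ 3 +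
      ∑ k : Fin n, (3 * (inner ℝ (p 0 - p k.succ.succ) e + t) ^ 2 -
        ‖(p 0 - p k.succ.succ) + t • e‖ ^ 2) / (2 * ‖(p 0 - p k.succ.succ) + t • e‖ ^ 5) := by
    rw [hf2]
    simp only
    rw [Fin.sum_univ_succ, Fin.sum_univ_succ, Fin.succ_zero_eq_one, hnorm0 t ht, hnorm1 t ht, hin0,
      hin1]
    have := ht.1.ne'
    field_simp
    ring
  have hp := hpos t ht
  rw [s0] at hp ⊢
  have hneg : ∀ Z W : ℝ, -(-Z / W) / 2 = Z / W / 2 := fun Z W => by ring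
  rw [s1, s2, hneg]
  exact div_pos (div_pos key (pow_pos hp 3)) two_pos

end
end GibbonsHawking

namespace GibbonsHawking

noncomputable section

/-! The preimage of a segment is covered by the patches around its poles and the patch of its
remaining points. -/

section Patches

variable {ι : Type*} [Fintype ι] [DecidableEq ι] [Nonempty ι] {p : ι ↪ E3} {i j : ι} {b : ι → Bool}

/-- Formulated for an ordered pair `i`, `j`, so that exchanging them treats the other pole. -/
lemma SegDom.exists_minimal_patch_of_proj_eq {m : ℝ} (hm : 0 ≤ m) (hij : i ≠ j)
    (h : SegDom p i j b) {x : Space p} (hx : proj p x = p i) :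
    ∃ (U : Set (ℝ × ℝ)) (F : ℝ × ℝ → Space p) (u : ℝ × ℝ),
      IsSurfacePatch (E := C2) (proj p ⁻¹' segment ℝ (p i) (p j)) U F ∧ u ∈ U ∧ F u = x ∧
      ∃ e ∈ IsManifold.maximalAtlas 𝓘(ℝ, C2) ∞ (Space p), x ∈ e.source ∧
        ∀ ν : C2, (∀ a : ℝ × ℝ, coordMetric (metric p m hm) e (fderiv ℝ (e ∘ F) u a) ν (e x) = 0) →
          meanCurvature (metric p m hm) e F u ν = 0 := by
  refine ⟨tipDisk, _, 0, h.isSurfacePatch_tipSpinor hij, zero_mem_tipDisk,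
    h.param_tipSpinor_zero hx, ochart p (i, b), ochart_mem_maximalAtlas p _, ?_,
    fun ν _ => meanCurvature_tipSpinor hm h ν⟩
  rw [← h.param_tipSpinor_zero hx]
  exact param_mem_source p (h.coordDom_tipSpinor zero_mem_tipDisk)

lemma SegDom.exists_minimal_patch {m : ℝ} (hm : 0 ≤ m) (hij : i ≠ j) (h : SegDom p i j b)
    {x : Space p} {s : ℝ} (hs : s ∈ Set.Ioo 0 (dist (p i) (p j)))
    (hx : proj p x = p i + (s / dist (p i) (p j)) • (p j - p i)) :
    ∃ (U : Set (ℝ × ℝ)) (F : ℝ × ℝ → Space p) (u : ℝ × ℝ),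
      IsSurfacePatch (E := C2) (proj p ⁻¹' segment ℝ (p i) (p j)) U F ∧ u ∈ U ∧ F u = x ∧
      ∃ e ∈ IsManifold.maximalAtlas 𝓘(ℝ, C2) ∞ (Space p), x ∈ e.source ∧
        ∀ ν : C2, (∀ a : ℝ × ℝ, coordMetric (metric p m hm) e (fderiv ℝ (e ∘ F) u a) ν (e x) = 0) →
          meanCurvature (metric p m hm) e F u ν = 0 := by
  obtain ⟨θ, rfl⟩ := h.exists_polarSpinor hs hx
  have hv : (s, θ) ∈ polarStrip (dist (p i) (p j)) := hs
  have hdom := h.coordDom_polarSpinor hv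
  refine ⟨polarStrip (dist (p i) (p j)), _, (s, θ), h.isSurfacePatch_polarSpinor hij, hv, rfl,
    ochart p (i, b), ochart_mem_maximalAtlas p _, param_mem_source p hdom, fun ν hν => ?_⟩
  have hc := ((contDiffOn_polarSpinor p i j b).continuousOn.continuousAt
    ((isOpen_polarStrip _).mem_nhds hv))
  have key : ∀ a : ℝ × ℝ, smoothForm p m (i, b) (polarSpinor p i j b (s, θ))
      (polarLog (s, θ) a • polarSpinor p i j b (s, θ)) ν = 0 := by
    intro a
    have h1 := hν a
    rwa [(ochart_param_comp hc hdom).fderiv_eq, show ochart p (i, b) _ = _ from chart_param p hdom,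
      coordMetric_ochart hm hdom, fderiv_polarSpinor p b hv] at h1
  refine meanCurvature_polarSpinor hm hij h hv ?_ ?_
  -- The parameter directions `(2 s, 0)` and `(0, 1)` have logarithmic derivatives `1` and `I`, so
  -- `ν` is orthogonal to `u` and to `I • u`.
  · have h1 := key (2 * s, 0)
    rwa [show polarLog (s, θ) (2 * s, 0) = 1 by
      simp [polarLog, div_self (mul_ne_zero two_ne_zero hs.1.ne')], one_smul] at h1
  · have h1 := key (0, 1)
    rwa [show polarLog (s, θ) (0, 1) = Complex.I by simp [polarLog]] at h1

lemma SegDom.hasGaussCurvatureAt_of_proj_eq {m : ℝ} (hm : 0 ≤ m) (hij : i ≠ j)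
    (h : SegDom p i j b) {x : Space p} (hx : proj p x = p i) :
    HasGaussCurvatureAt (metric p m hm) (proj p ⁻¹' segment ℝ (p i) (p j)) x
      (4 * phiReg p m (i, b) 0) :=
  ⟨tipDisk, _, 0, h.isSurfacePatch_tipSpinor hij, zero_mem_tipDisk, h.param_tipSpinor_zero hx,
    (brioschi_tipSpinor hm hij h).symm⟩

lemma SegDom.hasGaussCurvatureAt {m : ℝ} (hm : 0 ≤ m) (hij : i ≠ j) (h : SegDom p i j b)
    {x : Space p} {s : ℝ} (hs : s ∈ Set.Ioo 0 (dist (p i) (p j)))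
    (hx : proj p x = p i + (s / dist (p i) (p j)) • (p j - p i)) :
    HasGaussCurvatureAt (metric p m hm) (proj p ⁻¹' segment ℝ (p i) (p j)) x
      (-deriv (deriv fun s => (phi p m (p i + (s / dist (p i) (p j)) • (p j - p i)))⁻¹) s / 2) := by
  obtain ⟨θ, hθ⟩ := h.exists_polarSpinor hs hx
  exact ⟨polarStrip (dist (p i) (p j)), _, (s, θ), h.isSurfacePatch_polarSpinor hij, hs, hθ,
    (brioschi_polarSpinor hm hij h (v := (s, θ)) hs).symm⟩

/-- A point of the preimage of a segment lies over one of the poles or between them. -/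
lemma proj_cases (hij : i ≠ j) {x : Space p} (hx : x ∈ proj p ⁻¹' segment ℝ (p i) (p j)) :
    proj p x = p i ∨ proj p x = p j ∨ ∃ s ∈ Set.Ioo 0 (dist (p i) (p j)),
      proj p x = p i + (s / dist (p i) (p j)) • (p j - p i) := by
  have hL : 0 < dist (p i) (p j) := dist_pos.2 (p.injective.ne hij)
  rw [Set.mem_preimage, segment_eq_image'] at hx
  obtain ⟨τ, hτ, hx⟩ := hx
  rcases hτ.1.eq_or_lt with rfl | h0
  · left; rw [← hx]; simp
  rcases hτ.2.eq_or_lt with rfl | h1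
  · right; left; rw [← hx]; simp
  refine Or.inr (Or.inr ⟨τ * dist (p i) (p j), ⟨by positivity, by nlinarith⟩, ?_⟩)
  rw [mul_div_cancel_right₀ _ hL.ne', ← hx]

end Patches

lemma iteratedDeriv_two_one_div_two_mul (Φ : ℝ → ℝ) (c t : ℝ) :
    iteratedDeriv 2 (fun τ => 1 / (2 * Φ (τ + c))) t = deriv (deriv fun s => (Φ s)⁻¹) (t + c) / 2 := by
  have h1 : (fun τ => 1 / (2 * Φ (τ + c))) = fun τ => 1 / 2 * (Φ (τ + c))⁻¹ := by
    funext τ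
    rw [one_div, mul_inv, one_div]
  have h2 : (deriv fun τ => (Φ (τ + c))⁻¹) = fun τ => deriv (fun s => (Φ s)⁻¹) (τ + c) :=
    funext fun τ => deriv_comp_add_const (fun s => (Φ s)⁻¹) c τ
  rw [h1, iteratedDeriv_succ, iteratedDeriv_one, deriv_const_mul_field', h2,
    deriv_const_mul_field, deriv_comp_add_const]
  ring

end
end GibbonsHawking

/-! ### The main theorem. -/

theorem propositionA1 (n : ℕ) (p : Fin (n + 2) ↪ GibbonsHawking.E3) (m : ℝ) (hm : 0 ≤ m)
    (d : ℝ) (hd : 2 * d = dist (p 0) (p 1))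
    (s : ℝ) (hs : max 4 (√((((n + 2 : ℕ) : ℝ) - 2) / 2)) ≤ s)
    (hfar : ∀ i, i ≠ 0 → i ≠ 1 → s * d < dist (p i) (midpoint ℝ (p 0) (p 1))) :
    (∃ f : Metric.sphere (0 : GibbonsHawking.E3) 1 → GibbonsHawking.Space p,
      Manifold.IsSmoothEmbedding (𝓡 2) 𝓘(ℝ, GibbonsHawking.C2) ∞ f ∧
        Set.range f = GibbonsHawking.proj p ⁻¹' segment ℝ (p 0) (p 1)) ∧
    GibbonsHawking.IsMinimalSurface (GibbonsHawking.metric p m hm)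
      (GibbonsHawking.proj p ⁻¹' segment ℝ (p 0) (p 1)) ∧
    ∀ x ∈ GibbonsHawking.proj p ⁻¹' segment ℝ (p 0) (p 1), ∃ K : ℝ,
      GibbonsHawking.HasGaussCurvatureAt (GibbonsHawking.metric p m hm)
        (GibbonsHawking.proj p ⁻¹' segment ℝ (p 0) (p 1)) x K ∧
      0 < K ∧
      ∀ t ∈ Set.Ioo (-d) d,
        GibbonsHawking.proj p x = midpoint ℝ (p 0) (p 1) + (t / (2 * d)) • (p 1 - p 0) →
        K = -iteratedDeriv 2 (fun τ : ℝ => 1 / (2 * GibbonsHawking.phi p m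
          (midpoint ℝ (p 0) (p 1) + (τ / (2 * d)) • (p 1 - p 0)))) t := by
  have h01 : (0 : Fin (n + 2)) ≠ 1 := Fin.zero_ne_one
  have hL : 0 < dist (p 0) (p 1) := dist_pos.2 (p.injective.ne h01)
  have hdpos : 0 < d := by linarith
  have hs4 : 4 ≤ s := (le_max_left _ _).trans hs
  -- Points of the segment are at distance more than `(s - 1) d > 0` from the other singular points.
  have hseg : ∀ k, k ≠ 0 → k ≠ 1 → p k ∉ segment ℝ (p 0) (p 1) := by
    intro k hk0 hk1 hk
    rw [segment_eq_image'] at hk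
    obtain ⟨τ, hτ, hk⟩ := hk
    have h1 := GibbonsHawking.lt_norm_sub_of_far hd (hfar k hk0 hk1) hτ.1 hτ.2
    have h2 : p 0 + τ • (p 1 - p 0) - p k = 0 := sub_eq_zero.2 hk
    rw [h2, norm_zero] at h1
    nlinarith
  obtain ⟨b, hb, hb'⟩ := GibbonsHawking.exists_segDom p h01 hseg
  -- Arclength is measured from the midpoint in the statement and from `p 0` in the polar patch; the
  -- two differ by `d`.
  have hmid : ∀ τ : ℝ, midpoint ℝ (p 0) (p 1) + (τ / (2 * d)) • (p 1 - p 0) =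
      p 0 + ((τ + d) / dist (p 0) (p 1)) • (p 1 - p 0) := by
    intro τ
    have h1 : (τ + d) / dist (p 0) (p 1) = τ / (2 * d) + 1 / 2 := by rw [← hd]; field_simp
    rw [h1, midpoint_eq_smul_add, invOf_eq_inv]
    module
  have hinj : ∀ a a' : ℝ, p 0 + a • (p 1 - p 0) = p 0 + a' • (p 1 - p 0) → a = a' := by
    intro a a' h
    exact smul_left_injective ℝ (sub_ne_zero.2 (p.injective.ne h01.symm)) (add_left_cancel h)
  have hmem : ∀ t ∈ Set.Ioo (-d) d, (t + d) / dist (p 0) (p 1) ∈ Set.Ioo 0 1 := by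
    intro t ht
    exact ⟨div_pos (by linarith [ht.1]) hL, (div_lt_one hL).2 (by linarith [ht.2])⟩
  refine ⟨GibbonsHawking.exists_sphere_embedding h01 hseg, fun x hx => ?_, fun x hx => ?_⟩
  · rcases GibbonsHawking.proj_cases h01 hx with h | h | ⟨σ, hσ, h⟩
    · exact hb.exists_minimal_patch_of_proj_eq hm h01 h
    · rw [segment_symm]
      exact hb'.exists_minimal_patch_of_proj_eq hm h01.symm h
    · exact hb.exists_minimal_patch hm h01 hσ h
  · rcases GibbonsHawking.proj_cases h01 hx with h | h | ⟨σ, hσ, h⟩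
    · refine ⟨_, hb.hasGaussCurvatureAt_of_proj_eq hm h01 h,
        mul_pos four_pos (GibbonsHawking.phiReg_zero_pos hm h01 b), fun t ht h' => ?_⟩
      rw [hmid, h] at h'
      have := hinj 0 _ (by rw [← h']; simp)
      -- Over a pole the formula is vacuous: no `t` in the open interval projects there.
      exact absurd this (hmem t ht).1.ne
    · refine ⟨_, by
        rw [segment_symm]; exact hb'.hasGaussCurvatureAt_of_proj_eq hm h01.symm h,
        mul_pos four_pos (GibbonsHawking.phiReg_zero_pos hm h01.symm b), fun t ht h' => ?_⟩
      rw [hmid, h] at h'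
      have := hinj 1 _ (by rw [← h']; simp)
      exact absurd this (hmem t ht).2.ne'
    · refine ⟨_, hb.hasGaussCurvatureAt hm h01 hσ h,
        GibbonsHawking.neg_deriv_deriv_phi_pos hm hd hs hfar hσ, fun t ht h' => ?_⟩
      rw [hmid, h] at h'
      have h1 := hinj _ _ h'
      rw [div_left_inj' hL.ne'] at h1
      simp only [hmid]
      rw [GibbonsHawking.iteratedDeriv_two_one_div_two_mul
        (fun s => GibbonsHawking.phi p m (p 0 + (s / dist (p 0) (p 1)) • (p 1 - p 0))), h1]
      ring
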